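/- Fix $0<\tau<1$. For $n\in\mathbb N$ let $$\mathcal K_n(Z,Z')=\frac{1}{\pi\sqrt{1-\tau^2}}\sum_{j=0}^{n-1}\frac{(\tau/2)^j}{j!}\sqrt{\omega(Z)\,\omega(Z')}\;H_j\!\Big(\frac{Z}{\sqrt{2\tau}}\Big)\overline{H_j\!\Big(\frac{Z'}{\sqrt{2\tau}}\Big)},\qquad \omega(Z)=\exp\!\Big(-\frac{(\operatorname{Re}Z)^2}{1+\tau}-\frac{(\operatorname{Im}Z)^2}{1-\tau}\Big),$$ be the correlation kernel of the elliptic Ginibre ensemble, where $H_j$ is the (physicists') Hermite polynomial of degree $j$, with leading coefficient $2^j$. Let $\mathbb K_n(Z,Z')=n\,\mathcal K_n(\sqrt n Z,\sqrt n Z')$ be the rescaled kernel and let $T_2(Z,Z')=-|\mathbb K_n(Z,Z')|^2$ be the two-point cluster function. Let $$\mathcal E_\tau=\Big\{Z\in\mathbb C:\Big(\frac{\operatorname{Re}Z}{1+\tau}\Big)^2+\Big(\frac{\operatorname{Im}Z}{1-\tau}\Big)^2<1\Big\},\qquad \xi_\tau=-\tfrac12\log\tau .$$ Write points of $\mathbb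 C$ in elliptic coordinates, $Z=2\sqrt\tau\cosh(\xi+i\eta)$ with $\xi\ge 0$, where $\eta\in(-\pi,\pi]$ if $\xi>0$ and $\eta\in[0,\pi]$ if $\xi=0$; write $(\xi',\eta')$ for the coordinates of $Z'$, and set $\xi_+=\frac12(\xi+\xi')$. Define $g$ by $$-(\xi-\xi_\tau)^2 g(\xi+i\eta)=\tfrac12+\xi-\xi_\tau+\tfrac12 e^{-2\xi}\cos(2\eta)-2\tau\frac{\cosh^2\xi\cos^2\eta}{1+\tau}-2\tau\frac{\sinh^2\xi\sin^2\eta}{1-\tau}\qquad(\xi\ne\xi_\tau),$$ and $g(\xi_\tau+i\eta)=\frac{1+\tau^2-2\tau\cos(2\eta)}{1-\tau^2}$. Then for all $Z_0,Z_0'\in\partial\mathcal E_\tau$ with $Z_0\neq Z_0'$ there is an open neighbourhood $U\subset\mathbb C^2$ of $(Z_0,Z_0')$ such that, as $n\to\infty$, $$T_2(Z,Z')=-\frac{n}{16\tau\pi^3(1-\tau^2)}\,\frac{e^{-2n(\xi-\xi_\tau)^2g(\xi+i\eta)}\,e^{-2n(\xi'-\xi_\tau)^2g(\xi'+i\eta')}}{\cosh(2(\xi_+-\xi_\tau))-\cos(\eta-\eta')}\,\frac{1}{|\sinh(\xi+i\eta)\sinh(\xi'+i\eta')|}\Big(1+\mathcal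 O\Big(\frac1n\Big)\Big)$$ uniformly for $(Z,Z')\in U$. In particular, writing $Z_0=2\sqrt\tau\cosh(\xi_\tau+i\eta_0)$ and $Z_0'=2\sqrt\tau\cosh(\xi_\tau+i\eta_0')$ with $\eta_0,\eta_0'\in(-\pi,\pi]$, as $n\to\infty$, $$T_2(Z_0,Z_0')=-\frac{n}{16\tau\pi^3(1-\tau^2)}\,\frac{1}{1-\cos(\eta_0-\eta_0')}\,\frac{1}{|\sinh(\xi_\tau+i\eta_0)\sinh(\xi_\tau-i\eta_0')|}\Big(1+\mathcal O\Big(\frac1n\Big)\Big).$$ -/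

import Mathlib

namespace EllipticGinibre

noncomputable section

/-- The physicists' Hermite polynomial `H_j` evaluated at `z`, that is
`H_0 = 1`, `H_1 = 2 z`, `H_{j+1} = 2 z H_j - H_j'`, with leading coefficient `2 ^ j`.  It is obtained
from Mathlib's (probabilists') polynomial `He_j` by `H_j(z) = 2^{j/2} He_j(√2 z)`. -/
def hermiteH (j : ℕ) (z : ℂ) : ℂ :=
  ((Real.sqrt 2 : ℝ) : ℂ) ^ j *
    Polynomial.aeval (((Real.sqrt 2 : ℝ) : ℂ) * z) (Polynomial.hermite j)

/-- The weight `ω(Z) = exp(-(Re Z)²/(1+τ) - (Im Z)²/(1-τ))`. -/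
def weight (τ : ℝ) (Z : ℂ) : ℝ :=
  Real.exp (-(Z.re ^ 2 / (1 + τ)) - Z.im ^ 2 / (1 - τ))

/-- The (unscaled) correlation kernel of the elliptic Ginibre ensemble of `n × n` matrices. -/
def kernel (τ : ℝ) (n : ℕ) (Z Z' : ℂ) : ℂ :=
  ((1 / (Real.pi * Real.sqrt (1 - τ ^ 2)) : ℝ) : ℂ) *
    ∑ j ∈ Finset.range n,
      (((τ / 2) ^ j / (j.factorial : ℝ) * Real.sqrt (weight τ Z * weight τ Z') : ℝ) : ℂ) *
        hermiteH j (Z / ((Real.sqrt (2 * τ) : ℝ) : ℂ)) *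
        (starRingEnd ℂ) (hermiteH j (Z' / ((Real.sqrt (2 * τ) : ℝ) : ℂ)))

/-- The rescaled kernel `K_n(Z, Z') = n 𝒦_n(√n Z, √n Z')`. -/
def scaledKernel (τ : ℝ) (n : ℕ) (Z Z' : ℂ) : ℂ :=
  (n : ℂ) * kernel τ n (((Real.sqrt n : ℝ) : ℂ) * Z) (((Real.sqrt n : ℝ) : ℂ) * Z')

/-- The two-point cluster function `T₂(Z, Z') = -|K_n(Z, Z')|²`. -/
def clusterT2 (τ : ℝ) (n : ℕ) (Z Z' : ℂ) : ℝ :=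
  -‖scaledKernel τ n Z Z'‖ ^ 2

/-- The (open) elliptic domain with half-axes `1 + τ` and `1 - τ`. -/
def ellipse (τ : ℝ) : Set ℂ :=
  {Z | (Z.re / (1 + τ)) ^ 2 + (Z.im / (1 - τ)) ^ 2 < 1}

/-- The value `ξ_τ = -½ log τ` of the elliptic radial coordinate on the boundary of the ellipse. -/
def xiTau (τ : ℝ) : ℝ := -(1 / 2) * Real.log τ

/-- `(ξ, η)` are the elliptic coordinates of `Z`: `Z = 2√τ cosh(ξ + iη)` with `ξ ≥ 0`,
`η ∈ (-π, π]` if `ξ > 0`, and `η ∈ [0, π]` if `ξ = 0`. -/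
def IsEllipticCoord (τ : ℝ) (Z : ℂ) (ξ η : ℝ) : Prop :=
  0 ≤ ξ ∧ (0 < ξ → η ∈ Set.Ioc (-Real.pi) Real.pi) ∧ (ξ = 0 → η ∈ Set.Icc 0 Real.pi) ∧
    Z = 2 * ((Real.sqrt τ : ℝ) : ℂ) * Complex.cosh ((ξ : ℂ) + (η : ℂ) * Complex.I)

/-- The function `g(ξ + iη)`, defined for `ξ ≠ ξ_τ` by
`-(ξ - ξ_τ)² g(ξ + iη) = ½ + ξ - ξ_τ + ½ e^{-2ξ} cos(2η) - 2τ cosh²ξ cos²η/(1+τ) - 2τ sinh²ξ sin²η/(1-τ)`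
and for `ξ = ξ_τ` by `g(ξ_τ + iη) = (1 + τ² - 2τ cos(2η))/(1 - τ²)`. -/
def g (τ ξ η : ℝ) : ℝ :=
  open Classical in
  if ξ = xiTau τ then (1 + τ ^ 2 - 2 * τ * Real.cos (2 * η)) / (1 - τ ^ 2)
  else
    -(1 / 2 + ξ - xiTau τ + 1 / 2 * Real.exp (-2 * ξ) * Real.cos (2 * η)
        - 2 * τ * (Real.cosh ξ ^ 2 * Real.cos η ^ 2 / (1 + τ))
        - 2 * τ * (Real.sinh ξ ^ 2 * Real.sin η ^ 2 / (1 - τ))) / (ξ - xiTau τ) ^ 2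

/-- Every point of the plane has exactly one pair of elliptic coordinates. -/
theorem existsUnique_isEllipticCoord {τ : ℝ} (hτ : 0 < τ) (Z : ℂ) :
    ∃! p : ℝ × ℝ, IsEllipticCoord τ Z p.1 p.2 := by
  have hs : (2 * ((Real.sqrt τ : ℝ) : ℂ)) ≠ 0 := by
    have h : Real.sqrt τ ≠ 0 := (Real.sqrt_pos.2 hτ).ne'
    simpa using h
  have hcosh : ∀ w : ℂ, Complex.cosh w = (Complex.exp w + (Complex.exp w)⁻¹) / 2 := by
    intro w
    rw [← Complex.exp_neg, Complex.cosh]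
  obtain ⟨w, hw⟩ := Complex.cos_surjective (Z / (2 * ((Real.sqrt τ : ℝ) : ℂ)))
  -- a solution with nonnegative real part
  obtain ⟨v, hv, hvre⟩ : ∃ v : ℂ, Complex.cosh v = Z / (2 * ((Real.sqrt τ : ℝ) : ℂ)) ∧
      0 ≤ v.re := by
    rw [← Complex.cosh_mul_I] at hw
    rcases le_total 0 (w * Complex.I).re with h | h
    · exact ⟨_, hw, h⟩
    · refine ⟨-(w * Complex.I), by rw [Complex.cosh_neg, hw], ?_⟩
      rw [Complex.neg_re]
      linarith
  -- reduce the imaginary part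
  obtain ⟨u, hu, hure, hu1, hu2⟩ : ∃ u : ℂ,
      Complex.cosh u = Z / (2 * ((Real.sqrt τ : ℝ) : ℂ)) ∧ 0 ≤ u.re ∧ -Real.pi < u.im ∧
        u.im ≤ Real.pi := by
    refine ⟨Complex.log (Complex.exp v), ?_, ?_, ?_, ?_⟩
    · rw [← hv, hcosh, hcosh, Complex.exp_log (Complex.exp_ne_zero v)]
    · rw [Complex.log_re, Complex.norm_exp, Real.log_exp]
      exact hvre
    · exact Complex.neg_pi_lt_log_im _
    · exact Complex.log_im_le_pi _
  obtain ⟨q, hq⟩ : ∃ q : ℝ × ℝ, IsEllipticCoord τ Z q.1 q.2 := by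
    have key : ∀ x y : ℝ, Complex.cosh ((x : ℂ) + (y : ℂ) * Complex.I) =
        Z / (2 * ((Real.sqrt τ : ℝ) : ℂ)) →
        Z = 2 * ((Real.sqrt τ : ℝ) : ℂ) * Complex.cosh ((x : ℂ) + (y : ℂ) * Complex.I) := by
      intro x y h
      rw [h, mul_div_cancel₀ _ hs]
    by_cases h : u.re = 0 ∧ u.im < 0
    · refine ⟨(0, -u.im), le_refl _, fun h0 => absurd h0 (lt_irrefl _),
        fun _ => ⟨by linarith [h.2], by linarith⟩, key _ _ ?_⟩
      rw [← hu, ← Complex.cosh_neg u]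
      congr 1
      apply Complex.ext <;> simp [h.1]
    · refine ⟨(u.re, u.im), hure, fun _ => ⟨hu1, hu2⟩, fun h0 => ⟨?_, hu2⟩, key _ _ ?_⟩
      · by_contra h1
        exact h ⟨h0, not_le.1 h1⟩
      · rw [← hu, Complex.re_add_im]
  refine ⟨q, hq, ?_⟩
  rintro ⟨x, y⟩ hp
  obtain ⟨a, b⟩ := q
  obtain ⟨hx, hx1, hx0, hZx⟩ := hp
  obtain ⟨ha, ha1, ha0, hZa⟩ := hq
  simp only at *
  have hy : -Real.pi < y ∧ y ≤ Real.pi := by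
    rcases hx.lt_or_eq with h | h
    · exact hx1 h
    · exact ⟨by linarith [(hx0 h.symm).1, Real.pi_pos], (hx0 h.symm).2⟩
  have hb : -Real.pi < b ∧ b ≤ Real.pi := by
    rcases ha.lt_or_eq with h | h
    · exact ha1 h
    · exact ⟨by linarith [(ha0 h.symm).1, Real.pi_pos], (ha0 h.symm).2⟩
  have heq : Complex.cosh ((x : ℂ) + (y : ℂ) * Complex.I) =
      Complex.cosh ((a : ℂ) + (b : ℂ) * Complex.I) :=
    mul_left_cancel₀ hs (hZx.symm.trans hZa)
  have hexp : Complex.exp ((x : ℂ) + (y : ℂ) * Complex.I) =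
        Complex.exp ((a : ℂ) + (b : ℂ) * Complex.I) ∨
      Complex.exp ((x : ℂ) + (y : ℂ) * Complex.I) =
        Complex.exp (-((a : ℂ) + (b : ℂ) * Complex.I)) := by
    rw [hcosh, hcosh] at heq
    rw [Complex.exp_neg]
    have h1 := Complex.exp_ne_zero ((x : ℂ) + (y : ℂ) * Complex.I)
    have h2 := Complex.exp_ne_zero ((a : ℂ) + (b : ℂ) * Complex.I)
    generalize Complex.exp ((x : ℂ) + (y : ℂ) * Complex.I) = r at *
    generalize Complex.exp ((a : ℂ) + (b : ℂ) * Complex.I) = s at *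
    have h3 : (r - s) * (r * s - 1) = 0 := by
      field_simp at heq
      linear_combination heq
    rcases mul_eq_zero.1 h3 with h | h
    · exact Or.inl (sub_eq_zero.1 h)
    · exact Or.inr (eq_inv_of_mul_eq_one_left (sub_eq_zero.1 h))
  have inj : ∀ c d e f : ℝ, -Real.pi < d → d ≤ Real.pi → -Real.pi < f → f ≤ Real.pi →
      Complex.exp ((c : ℂ) + (d : ℂ) * Complex.I) =
        Complex.exp ((e : ℂ) + (f : ℂ) * Complex.I) → c = e ∧ d = f := by
    intro c d e f hd1 hd2 hf1 hf2 h
    have h' := Complex.exp_inj_of_neg_pi_lt_of_le_pi (by simpa using hd1) (by simpa using hd2)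
      (by simpa using hf1) (by simpa using hf2) h
    exact ⟨by simpa using congrArg Complex.re h', by simpa using congrArg Complex.im h'⟩
  rcases hexp with h | h
  · obtain ⟨h1, h2⟩ := inj x y a b hy.1 hy.2 hb.1 hb.2 h
    rw [h1, h2]
  · have hn := congrArg norm h
    rw [Complex.norm_exp, Complex.norm_exp, Real.exp_eq_exp] at hn
    simp at hn
    have hx' : x = 0 := by linarith
    have ha' : a = 0 := by linarith
    have hy0 := hx0 hx'
    have hb0 := ha0 ha'
    rcases hb0.2.lt_or_eq with hlt | hbpi
    · have h' : Complex.exp ((x : ℂ) + (y : ℂ) * Complex.I) =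
          Complex.exp (((-a : ℝ) : ℂ) + ((-b : ℝ) : ℂ) * Complex.I) := by
        rw [h]
        congr 1
        push_cast
        ring
      obtain ⟨-, h2⟩ := inj x y (-a) (-b) hy.1 hy.2 (by linarith) (by linarith [hb0.1]) h'
      have h3 : y = 0 := by linarith [hy0.1, hb0.1]
      have h4 : b = 0 := by linarith
      rw [hx', ha', h3, h4]
    · have h' : Complex.exp ((x : ℂ) + (y : ℂ) * Complex.I) =
          Complex.exp ((a : ℂ) + (b : ℂ) * Complex.I) := by
        rw [h, hbpi, ha', Complex.exp_neg]
        simp [Complex.exp_pi_mul_I]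
      obtain ⟨h1, h2⟩ := inj x y a b hy.1 hy.2 hb.1 hb.2 h'
      rw [h1, h2]

end

end EllipticGinibre

/-!
In the coordinates `a = exp (-(ξ + iη))`, `b = conj (exp (-(ξ' + iη')))` the kernel is, up to the
weights, the Mehler series `∑ H_j(x) H_j(y) s ^ j / (2 ^ j j!)` truncated to `j < n`, at `s = τ`,
`x = √(2n) (a + a⁻¹) / 2` and `y = √(2n) (b + b⁻¹) / 2`. The boundary of the ellipse is
`|a|² = |b|² = τ`, and distinct boundary points are those with `a b ≠ τ`. The expansion says that
the truncated sum is asymptotically its first omitted term times the factor `a b / (τ - a b)`.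

Two ingredients carry the proof. The first is the exterior Plancherel–Rotach asymptotics of `H_n`
and of `H_{n-1} / H_n` with relative error `O(1/n)` (`hermiteH_asymptotics`). They are obtained from
the three-term recurrence alone: an explicit WKB approximant (`wkb`) satisfies the recurrence up to
a residual of relative size `O(1/n²)` per step (`norm_wkb_ratio_le`), and since the dominant
characteristic root beats the recessive one by a definite factor, the ratio of the true solution to
the approximant has contracting increments (`norm_sub_one_le_of_contraction`), so that it deviates
from its initial value `1` by `O(1/n)` after `n` steps.

The second is an exact first-order differential equation in `s` for the truncated Mehler series
(`mehlerSum_ode`): it is the equation of the Mehler kernel with an inhomogeneous boundary term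
involving only `H_n` and `H_{n-1}`. After division by the Mehler kernel, the derivative of the
truncated series is explicit. With the limiting value of `√(2n) H_{n-1} / H_n` inserted, the
boundary term factors (`boundarySymbol_eq`), and the candidate
`(first omitted term) * a b / (s - a b)` has the same derivative up to a relative error `O(1/n)`. Integrating from `0` to `τ`
(`norm_mehlerSum_sub_le`), this error is controlled because `|s ^ n / Mehler kernel|` grows along
the path at a rate proportional to `n`, which is the positivity of the real part of `saddlePoly` at
a pair of distinct boundary points (`saddlePoly_re_pos`). The value `1` of the truncated sum at
`s = 0` is negligible, since the first omitted term exceeds the Mehler kernel at `s = τ` by an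
exponentially large factor (`edgeRate_pos`). Both positivity statements persist in a neighbourhood
(`exists_edge_bounds`), which gives the uniformity.

It remains to insert Stirling's formula with error `O(1/n)` and to translate into elliptic
coordinates, where the exponential factors combine into `exp (-2n (ξ - ξ_τ)² g)`
(`weight_mul_hermiteSize_sq`) and the square of `|a b / (τ - a b)|` yields
`1 / (cosh (2(ξ₊ - ξ_τ)) - cos (η - η'))` (`norm_edgeFactor_sq`). Although elliptic coordinates are
discontinuous in the angle, `a` is a Lipschitz function of the point near the boundary
(`norm_ellA_sub_le`).
-/

namespace EllipticGinibre

open Complex Set Filter Topology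

/-! ### Hermite polynomials -/

lemma derivative_hermite_succ (n : ℕ) :
    Polynomial.derivative (Polynomial.hermite (n + 1)) =
      ((n : Polynomial ℤ) + 1) * Polynomial.hermite n := by
  induction n with
  | zero => simp [Polynomial.hermite_zero]
  | succ k ih =>
    have h1 : Polynomial.derivative (Polynomial.hermite k) =
        Polynomial.X * Polynomial.hermite k - Polynomial.hermite (k + 1) := by
      rw [Polynomial.hermite_succ k]; ring
    rw [Polynomial.hermite_succ (k + 1), ih]
    simp only [Polynomial.derivative_sub, Polynomial.derivative_mul, Polynomial.derivative_X,
      Polynomial.derivative_add, Polynomial.derivative_natCast, Polynomial.derivative_one, ih, h1]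
    push_cast
    ring

lemma hermiteH_zero (x : ℂ) : hermiteH 0 x = 1 := by
  simp [hermiteH]

lemma hermiteH_one (x : ℂ) : hermiteH 1 x = 2 * x := by
  have h : (((Real.sqrt 2 : ℝ) : ℂ)) * ((Real.sqrt 2 : ℝ) : ℂ) = 2 := by
    rw [← ofReal_mul, Real.mul_self_sqrt (by norm_num)]; norm_num
  simp only [hermiteH, Polynomial.hermite_one, Polynomial.aeval_X, pow_one]
  linear_combination x * h

lemma hermiteH_succ_succ (n : ℕ) (x : ℂ) :
    hermiteH (n + 2) x = 2 * x * hermiteH (n + 1) x - 2 * (n + 1) * hermiteH n x := by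
  have h : (((Real.sqrt 2 : ℝ) : ℂ)) ^ 2 = 2 := by
    rw [← ofReal_pow, Real.sq_sqrt (by norm_num)]; norm_num
  simp only [hermiteH]
  rw [Polynomial.hermite_succ (n + 1), derivative_hermite_succ]
  simp only [map_sub, map_mul, Polynomial.aeval_X, map_add, map_natCast, map_one]
  generalize ((Real.sqrt 2 : ℝ) : ℂ) = r at *
  linear_combination (x * r ^ (n + 1) * Polynomial.aeval (r * x) (Polynomial.hermite (n + 1))
    - r ^ n * (n + 1) * Polynomial.aeval (r * x) (Polynomial.hermite n)) * h

/-- The three-term recurrence, in a form that also covers `n = 0`. -/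
lemma hermiteH_succ (n : ℕ) (x : ℂ) :
    hermiteH (n + 1) x = 2 * x * hermiteH n x - 2 * n * hermiteH (n - 1) x := by
  cases n with
  | zero => simp [hermiteH_zero, hermiteH_one]
  | succ k => rw [hermiteH_succ_succ]; push_cast; simp

/-- Conjugation symmetry: the coefficients of `H_j` are real. -/
lemma conj_hermiteH (j : ℕ) (x : ℂ) :
    (starRingEnd ℂ) (hermiteH j x) = hermiteH j ((starRingEnd ℂ) x) := by
  induction j using Nat.strong_induction_on with
  | _ j ih =>
    match j with
    | 0 => simp [hermiteH_zero]
    | 1 => simp [hermiteH_one, conj_ofNat]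
    | k + 2 =>
      rw [hermiteH_succ_succ, hermiteH_succ_succ, ← ih (k + 1) (by omega), ← ih k (by omega)]
      simp [conj_ofNat]

/-! ### Taylor estimates on a segment -/

lemma norm_sub_le_on_segment {f f' : ℂ → ℂ} {w ζ : ℂ} {C : ℝ}
    (hf : ∀ p ∈ segment ℝ w (w + ζ), HasDerivAt f (f' p) p)
    (hC : ∀ p ∈ segment ℝ w (w + ζ), ‖f' p‖ ≤ C) :
    ∀ p ∈ segment ℝ w (w + ζ), ‖f p - f w‖ ≤ C * ‖ζ‖ := by
  intro p hp
  have h0 : 0 ≤ C := (norm_nonneg _).trans (hC p hp)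
  have h := (convex_segment w (w + ζ)).norm_image_sub_le_of_norm_hasDerivWithin_le
    (fun q hq => (hf q hq).hasDerivWithinAt) hC (left_mem_segment ℝ _ _) hp
  refine h.trans (mul_le_mul_of_nonneg_left ?_ h0)
  rw [segment_eq_image'] at hp
  obtain ⟨θ, hθ, rfl⟩ := hp
  simp only [add_sub_cancel_left]
  rw [norm_smul, Real.norm_of_nonneg hθ.1]
  exact mul_le_of_le_one_left (norm_nonneg _) hθ.2

lemma norm_taylor_one_le_on_segment {f f' f'' : ℂ → ℂ} {w ζ : ℂ} {C : ℝ}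
    (hf : ∀ p ∈ segment ℝ w (w + ζ), HasDerivAt f (f' p) p)
    (hf' : ∀ p ∈ segment ℝ w (w + ζ), HasDerivAt f' (f'' p) p)
    (hC : ∀ p ∈ segment ℝ w (w + ζ), ‖f'' p‖ ≤ C) :
    ∀ p ∈ segment ℝ w (w + ζ), ‖f p - f w - (p - w) * f' w‖ ≤ C * ‖ζ‖ ^ 2 := by
  have h1 := norm_sub_le_on_segment hf' hC
  have h2 := norm_sub_le_on_segment (f := fun p => f p - (p - w) * f' w)
    (f' := fun p => f' p - 1 * f' w) (w := w) (ζ := ζ) (C := C * ‖ζ‖)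
    (fun p hp => (hf p hp).sub (((hasDerivAt_id p).sub_const w).mul_const (f' w)))
    (fun p hp => by simpa using h1 p hp)
  intro p hp
  have := h2 p hp
  rw [sub_self, zero_mul, sub_zero] at this
  rw [show f p - f w - (p - w) * f' w = f p - (p - w) * f' w - f w by ring]
  calc _ ≤ _ := this
    _ = _ := by ring

lemma norm_taylor_two_le_on_segment {f f' f'' f''' : ℂ → ℂ} {w ζ : ℂ} {C : ℝ}
    (hf : ∀ p ∈ segment ℝ w (w + ζ), HasDerivAt f (f' p) p)
    (hf' : ∀ p ∈ segment ℝ w (w + ζ), HasDerivAt f' (f'' p) p)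
    (hf'' : ∀ p ∈ segment ℝ w (w + ζ), HasDerivAt f'' (f''' p) p)
    (hC : ∀ p ∈ segment ℝ w (w + ζ), ‖f''' p‖ ≤ C) :
    ‖f (w + ζ) - f w - ζ * f' w - ζ ^ 2 / 2 * f'' w‖ ≤ C * ‖ζ‖ ^ 3 := by
  have h1 := norm_taylor_one_le_on_segment hf' hf'' hC
  have h2 := norm_sub_le_on_segment
    (f := fun p => f p - (p - w) * f' w - (p - w) ^ 2 / 2 * f'' w)
    (f' := fun p => f' p - f' w - (p - w) * f'' w) (w := w) (ζ := ζ) (C := C * ‖ζ‖ ^ 2)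
    (fun p hp => by
      have hid : HasDerivAt (fun p : ℂ => p - w) 1 p := (hasDerivAt_id p).sub_const w
      have := ((hf p hp).sub (hid.mul_const (f' w))).sub
        (((hid.pow 2).div_const 2).mul_const (f'' w))
      refine HasDerivAt.congr_deriv this ?_
      push_cast
      ring) h1
  have h3 := h2 _ (right_mem_segment ℝ w (w + ζ))
  simp only [add_sub_cancel_left, sub_self] at h3
  calc _ = ‖f (w + ζ) - ζ * f' w - ζ ^ 2 / 2 * f'' w -
        (f w - 0 * f' w - 0 ^ 2 / 2 * f'' w)‖ := by congr 1; ring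
    _ ≤ _ := h3
    _ = _ := by ring

/-! ### The WKB approximant of the Hermite recurrence -/

/-- The branch of `√(1 - w)` with positive real part. -/
noncomputable def wkbRoot (w : ℂ) : ℂ := exp (log (1 - w) / 2)

/-- The leading phase: `exp (wkbPhase (j * z) / z)` is the exponential part of the WKB approximant
of the recurrence `h (j + 1) = 2 * h j - j * z * h (j - 1)`. -/
noncomputable def wkbPhase (w : ℂ) : ℂ :=
  w * log (1 + wkbRoot w) + (1 - wkbRoot w) ^ 2 / 2

/-- The logarithm of the WKB amplitude `√((1 + m) / (2 * m))`, with `m = √(1 - w)`. -/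
noncomputable def wkbAmp (w : ℂ) : ℂ :=
  (log (1 + wkbRoot w) - log (wkbRoot w) - log 2) / 2

lemma wkbRoot_sq {w : ℂ} (hw : 1 - w ∈ slitPlane) : wkbRoot w ^ 2 = 1 - w := by
  rw [wkbRoot, ← exp_nat_mul]
  push_cast
  rw [mul_div_cancel₀ _ (by norm_num), exp_log (slitPlane_ne_zero hw)]

lemma wkbRoot_re_pos {w : ℂ} (hw : 1 - w ∈ slitPlane) : 0 < (wkbRoot w).re := by
  rw [wkbRoot, exp_re]
  have h1 := (mem_slitPlane_iff_arg.1 hw).1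
  have h2 : (log (1 - w) / 2).im = arg (1 - w) / 2 := by
    rw [show (2 : ℂ) = ((2 : ℝ) : ℂ) by norm_num, div_ofReal_im, log_im]
  refine mul_pos (Real.exp_pos _) (Real.cos_pos_of_mem_Ioo ⟨?_, ?_⟩)
  · rw [h2]; linarith [neg_pi_lt_arg (1 - w)]
  · rw [h2]; linarith [lt_of_le_of_ne (arg_le_pi (1 - w)) h1]

lemma wkbRoot_ne_zero (w : ℂ) : wkbRoot w ≠ 0 := exp_ne_zero _

lemma one_add_wkbRoot_ne_zero {w : ℂ} (hw : 1 - w ∈ slitPlane) : 1 + wkbRoot w ≠ 0 := by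
  intro h
  have := congrArg re h
  simp at this
  linarith [wkbRoot_re_pos hw]

lemma hasDerivAt_wkbRoot {w : ℂ} (hw : 1 - w ∈ slitPlane) :
    HasDerivAt wkbRoot (-1 / (2 * wkbRoot w)) w := by
  have h1 : HasDerivAt (fun w : ℂ => 1 - w) (-1) w := by
    simpa using (hasDerivAt_id w).const_sub 1
  have h := ((h1.clog hw).div_const 2).cexp
  refine HasDerivAt.congr_deriv h ?_
  have h2 : exp (log (1 - w) / 2) = wkbRoot w := rfl
  rw [h2, ← wkbRoot_sq hw]
  have := wkbRoot_ne_zero w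
  field_simp

lemma hasDerivAt_log_one_add_wkbRoot {w : ℂ} (hw : 1 - w ∈ slitPlane) :
    HasDerivAt (fun w => log (1 + wkbRoot w)) (-1 / (2 * wkbRoot w * (1 + wkbRoot w))) w := by
  have hm := wkbRoot_re_pos hw
  have h := ((hasDerivAt_wkbRoot hw).const_add 1).clog
    (Or.inl (by simp; linarith))
  refine HasDerivAt.congr_deriv h ?_
  have := wkbRoot_ne_zero w
  have := one_add_wkbRoot_ne_zero hw
  field_simp

lemma hasDerivAt_wkbPhase {w : ℂ} (hw : 1 - w ∈ slitPlane) :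
    HasDerivAt wkbPhase (log (1 + wkbRoot w)) w := by
  have h := ((hasDerivAt_id w).mul (hasDerivAt_log_one_add_wkbRoot hw)).add
    ((((hasDerivAt_wkbRoot hw).const_sub 1).pow 2).div_const 2)
  refine HasDerivAt.congr_deriv h ?_
  have h1 := wkbRoot_ne_zero w
  have h2 := one_add_wkbRoot_ne_zero hw
  have h3 : w = 1 - wkbRoot w ^ 2 := by rw [wkbRoot_sq hw]; ring
  simp only [id, one_mul]
  generalize wkbRoot w = m at *
  subst h3
  field_simp
  push_cast
  ring

lemma hasDerivAt_wkbAmp {w : ℂ} (hw : 1 - w ∈ slitPlane) :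
    HasDerivAt wkbAmp (1 / (4 * wkbRoot w ^ 2 * (1 + wkbRoot w))) w := by
  have hm := wkbRoot_re_pos hw
  have h := (((hasDerivAt_log_one_add_wkbRoot hw).sub
    ((hasDerivAt_wkbRoot hw).clog (Or.inl hm))).sub_const (log 2)).div_const 2
  refine HasDerivAt.congr_deriv h ?_
  have h1 := wkbRoot_ne_zero w
  have h2 := one_add_wkbRoot_ne_zero hw
  field_simp
  ring

lemma hasDerivAt_wkbPhase_deriv_two {w : ℂ} (hw : 1 - w ∈ slitPlane) :
    HasDerivAt (fun w => -1 / (2 * wkbRoot w * (1 + wkbRoot w)))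
      (-(1 + 2 * wkbRoot w) / (4 * wkbRoot w ^ 3 * (1 + wkbRoot w) ^ 2)) w := by
  have h1 := wkbRoot_ne_zero w
  have h2 := one_add_wkbRoot_ne_zero hw
  have h := (hasDerivAt_const w (-1 : ℂ)).div
    (((hasDerivAt_wkbRoot hw).const_mul 2).mul ((hasDerivAt_wkbRoot hw).const_add 1))
    (mul_ne_zero (mul_ne_zero two_ne_zero h1) h2)
  refine HasDerivAt.congr_deriv h ?_
  simp only [Pi.mul_apply]
  field_simp
  ring

lemma hasDerivAt_wkbAmp_deriv {w : ℂ} (hw : 1 - w ∈ slitPlane) :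
    HasDerivAt (fun w => 1 / (4 * wkbRoot w ^ 2 * (1 + wkbRoot w)))
      ((2 + 3 * wkbRoot w) / (8 * wkbRoot w ^ 4 * (1 + wkbRoot w) ^ 2)) w := by
  have h1 := wkbRoot_ne_zero w
  have h2 := one_add_wkbRoot_ne_zero hw
  have h := (hasDerivAt_const w (1 : ℂ)).div
    ((((hasDerivAt_wkbRoot hw).pow 2).const_mul 4).mul ((hasDerivAt_wkbRoot hw).const_add 1))
    (mul_ne_zero (mul_ne_zero (by norm_num) (pow_ne_zero 2 h1)) h2)
  refine HasDerivAt.congr_deriv h ?_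
  simp only [Pi.mul_apply, Pi.pow_apply]
  field_simp
  ring

/-! ### One step of the WKB approximant -/

/-- A region of the slit plane on which the WKB approximant is uniformly non-degenerate: the branch
`m = √(1 - w)` has real part at least `μ` and modulus at most `R`. -/
def wkbRegion (μ R : ℝ) : Set ℂ :=
  {w | 1 - w ∈ slitPlane ∧ μ ≤ (wkbRoot w).re ∧ ‖wkbRoot w‖ ≤ R}

lemma le_norm_wkbRoot {μ R : ℝ} {w : ℂ} (hw : w ∈ wkbRegion μ R) : μ ≤ ‖wkbRoot w‖ :=
  hw.2.1.trans (re_le_norm _)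

lemma one_le_norm_one_add_wkbRoot {μ R : ℝ} {w : ℂ} (hw : w ∈ wkbRegion μ R) :
    1 + μ ≤ ‖1 + wkbRoot w‖ := by
  have h := re_le_norm (1 + wkbRoot w)
  have h2 := hw.2.1
  simp only [add_re, one_re] at h
  linarith

lemma norm_wkbPhase_taylor_le {μ : ℝ} (hμ : 0 < μ) (R : ℝ) :
    ∃ C : ℝ, 0 ≤ C ∧ ∀ w ζ : ℂ, segment ℝ w (w + ζ) ⊆ wkbRegion μ R →
      ‖wkbPhase (w + ζ) - wkbPhase w - ζ * log (1 + wkbRoot w) -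
        ζ ^ 2 / 2 * (-1 / (2 * wkbRoot w * (1 + wkbRoot w)))‖ ≤ C * ‖ζ‖ ^ 3 ∧
      ‖wkbAmp (w + ζ) - wkbAmp w - ζ * (1 / (4 * wkbRoot w ^ 2 * (1 + wkbRoot w)))‖ ≤
        C * ‖ζ‖ ^ 2 := by
  refine ⟨max ((1 + 2 * |R|) / (4 * μ ^ 3 * 1 ^ 2)) ((2 + 3 * |R|) / (8 * μ ^ 4 * 1 ^ 2)),
    le_max_of_le_left (by positivity), fun w ζ hs => ⟨?_, ?_⟩⟩
  · refine norm_taylor_two_le_on_segment (f := wkbPhase) (f' := fun w => log (1 + wkbRoot w))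
      (f'' := fun w => -1 / (2 * wkbRoot w * (1 + wkbRoot w)))
      (f''' := fun w => -(1 + 2 * wkbRoot w) / (4 * wkbRoot w ^ 3 * (1 + wkbRoot w) ^ 2))
      (fun p hp => hasDerivAt_wkbPhase (hs hp).1)
      (fun p hp => hasDerivAt_log_one_add_wkbRoot (hs hp).1)
      (fun p hp => hasDerivAt_wkbPhase_deriv_two (hs hp).1) (fun p hp => le_max_of_le_left ?_)
    have h1 := le_norm_wkbRoot (hs hp)
    have h2 := one_le_norm_one_add_wkbRoot (hs hp)
    have h3 : ‖wkbRoot p‖ ≤ |R| := (hs hp).2.2.trans (le_abs_self R)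
    rw [norm_div, norm_mul, norm_mul, norm_pow, norm_pow, norm_neg]
    have h4 : ‖1 + 2 * wkbRoot p‖ ≤ 1 + 2 * |R| :=
      (norm_add_le _ _).trans (by simp; linarith)
    have h5 : ‖(4 : ℂ)‖ = 4 := by simp
    rw [h5]
    gcongr
    linarith
  · have key := norm_taylor_one_le_on_segment (f := wkbAmp)
      (f' := fun w => 1 / (4 * wkbRoot w ^ 2 * (1 + wkbRoot w)))
      (f'' := fun w => (2 + 3 * wkbRoot w) / (8 * wkbRoot w ^ 4 * (1 + wkbRoot w) ^ 2))
      (w := w) (ζ := ζ)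
      (fun p hp => hasDerivAt_wkbAmp (hs hp).1)
      (fun p hp => hasDerivAt_wkbAmp_deriv (hs hp).1)
      (C := max ((1 + 2 * |R|) / (4 * μ ^ 3 * 1 ^ 2)) ((2 + 3 * |R|) / (8 * μ ^ 4 * 1 ^ 2)))
      (fun p hp => le_max_of_le_right ?_) _ (right_mem_segment ℝ _ _)
    · simpa using key
    have h1 := le_norm_wkbRoot (hs hp)
    have h2 := one_le_norm_one_add_wkbRoot (hs hp)
    have h3 : ‖wkbRoot p‖ ≤ |R| := (hs hp).2.2.trans (le_abs_self R)
    rw [norm_div, norm_mul, norm_mul, norm_pow, norm_pow]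
    have h4 : ‖2 + 3 * wkbRoot p‖ ≤ 2 + 3 * |R| :=
      (norm_add_le _ _).trans (by simp; linarith)
    have h5 : ‖(8 : ℂ)‖ = 8 := by simp
    rw [h5]
    gcongr
    linarith

/-- Exponentiating a first-order term with a second-order error; this turns the Taylor estimates of
`wkbPhase` and `wkbAmp` into estimates for the ratios of `wkb`. -/
lemma norm_exp_perturb_le {z A e : ℂ} {K : ℝ} (hA : ‖A‖ ≤ K)
    (he : ‖e‖ ≤ K * ‖z‖ ^ 2) (hz : ‖z‖ ≤ 1) (hKz : 2 * K * ‖z‖ ≤ 1) :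
    ‖exp (z * A + e) - (1 + z * A)‖ ≤ (4 * K ^ 2 + K) * ‖z‖ ^ 2 := by
  have hK : 0 ≤ K := (norm_nonneg _).trans hA
  have hz0 := norm_nonneg z
  have h1 : ‖z * A + e‖ ≤ 2 * K * ‖z‖ := by
    refine (norm_add_le _ _).trans ?_
    rw [norm_mul]
    nlinarith [mul_le_mul_of_nonneg_left hA hz0, mul_le_mul_of_nonneg_left hz hz0,
      mul_nonneg hK hz0]
  have h2 := norm_exp_sub_one_sub_id_le (h1.trans hKz)
  calc ‖exp (z * A + e) - (1 + z * A)‖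
      = ‖(exp (z * A + e) - 1 - (z * A + e)) + e‖ := by congr 1; ring
    _ ≤ ‖z * A + e‖ ^ 2 + K * ‖z‖ ^ 2 := (norm_add_le _ _).trans (add_le_add h2 he)
    _ ≤ (2 * K * ‖z‖) ^ 2 + K * ‖z‖ ^ 2 := by gcongr
    _ = _ := by ring

/-- The WKB approximant of the recurrence `h (j + 1) = 2 * h j - j * z * h (j - 1)`, normalised to
be `1` at `j = 0`. The recurrence is that of `h j = H_j(x) / x ^ j` with `z = 2 / x ^ 2`. -/
noncomputable def wkb (z : ℂ) (j : ℕ) : ℂ := exp (wkbPhase (j * z) / z + wkbAmp (j * z))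

lemma wkb_ne_zero (z : ℂ) (j : ℕ) : wkb z j ≠ 0 := exp_ne_zero _

lemma segment_subset_of_ray {D : Set ℂ} {n : ℕ} {z : ℂ}
    (hD : ∀ t ∈ Icc (0 : ℝ) n, (t : ℂ) * z ∈ D) {s t : ℝ} (hs : s ∈ Icc (0 : ℝ) n)
    (ht : t ∈ Icc (0 : ℝ) n) : segment ℝ ((s : ℂ) * z) ((t : ℂ) * z) ⊆ D := by
  rintro p ⟨α, β, hα, hβ, hαβ, rfl⟩
  have h := hD (α * s + β * t) ((convex_Icc (0 : ℝ) n) hs ht hα hβ hαβ)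
  convert h using 1
  push_cast
  simp only [real_smul]
  ring

/-- One step of the WKB approximant, forwards and backwards, to second order in `z`. -/
lemma norm_wkb_ratio_le {μ : ℝ} (hμ : 0 < μ) {R : ℝ} (hR : 0 ≤ R) :
    ∃ C : ℝ, 1 ≤ C ∧ ∀ (n : ℕ) (z : ℂ), z ≠ 0 → C * ‖z‖ ≤ 1 →
      (∀ t ∈ Icc (0 : ℝ) n, (t : ℂ) * z ∈ wkbRegion μ R) →
      (∀ j < n, ‖wkb z (j + 1) / wkb z j - (1 + wkbRoot (j * z)) * (1 + z *
        ((1 - wkbRoot (j * z)) / (4 * wkbRoot (j * z) ^ 2 * (1 + wkbRoot (j * z)))))‖ ≤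
          C * ‖z‖ ^ 2) ∧
      (∀ j < n, ‖wkb z j / wkb z (j + 1) - (1 + wkbRoot ((j + 1 : ℕ) * z))⁻¹ * (1 + z *
        (-1 / (4 * wkbRoot ((j + 1 : ℕ) * z) ^ 2)))‖ ≤ C * ‖z‖ ^ 2) := by
  obtain ⟨C₀, hC₀, hT⟩ := norm_wkbPhase_taylor_le hμ R
  set K : ℝ := 2 * C₀ + (1 + R) / (4 * μ ^ 2) with hK
  have hK1 : 0 ≤ K := by positivity
  have hK2 : (1 + R) / (4 * μ ^ 2) ≤ K := by rw [hK]; linarith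
  have hK3 : 2 * C₀ ≤ K := by
    rw [hK]; have : 0 ≤ (1 + R) / (4 * μ ^ 2) := by positivity
    linarith
  refine ⟨1 + 2 * K + (1 + R) * (4 * K ^ 2 + K), ?_, fun n z hz hCz hD => ?_⟩
  · have : 0 ≤ (1 + R) * (4 * K ^ 2 + K) := by positivity
    linarith
  have hz0 := norm_nonneg z
  have hb : 0 ≤ (1 + R) * (4 * K ^ 2 + K) := by positivity
  have hz1 : ‖z‖ ≤ 1 := by nlinarith [mul_nonneg hK1 hz0, mul_nonneg hb hz0]
  have hz2 : 2 * K * ‖z‖ ≤ 1 := by nlinarith [mul_nonneg hb hz0]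
  have hT1 : ∀ ζ : ℂ, ‖ζ‖ = ‖z‖ → ∀ w, segment ℝ w (w + ζ) ⊆ wkbRegion μ R →
      ‖(wkbPhase (w + ζ) - wkbPhase w) / ζ - log (1 + wkbRoot w) -
        ζ / 2 * (-1 / (2 * wkbRoot w * (1 + wkbRoot w)))‖ ≤ C₀ * ‖z‖ ^ 2 := by
    intro ζ hζ w hw
    have hζ0 : ζ ≠ 0 := by rw [← norm_ne_zero_iff, hζ]; exact norm_ne_zero_iff.2 hz
    have h := (hT w ζ hw).1
    rw [← mul_le_mul_iff_of_pos_right (norm_pos_iff.2 hζ0), ← norm_mul]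
    refine le_trans (le_of_eq ?_) (h.trans (le_of_eq ?_))
    · congr 1
      field_simp
    · rw [hζ]; ring
  have hend : ∀ e₁ e₂ : ℂ, ‖e₁‖ ≤ C₀ * ‖z‖ ^ 2 → ‖e₂‖ ≤ C₀ * ‖z‖ ^ 2 →
      ‖e₁ + e₂‖ ≤ K * ‖z‖ ^ 2 ∧ ‖-e₁ + e₂‖ ≤ K * ‖z‖ ^ 2 := by
    intro e₁ e₂ h₁ h₂
    have : 2 * C₀ * ‖z‖ ^ 2 ≤ K * ‖z‖ ^ 2 := by gcongr
    refine ⟨(norm_add_le _ _).trans (by linarith), (norm_add_le _ _).trans ?_⟩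
    rw [norm_neg]; linarith
  constructor
  · intro j hj
    have hj' : (j : ℝ) + 1 ≤ n := by exact_mod_cast hj
    have hj0 : (0 : ℝ) ≤ j := Nat.cast_nonneg j
    set w : ℂ := j * z with hw
    have hwz : ((j + 1 : ℕ) : ℂ) * z = w + z := by rw [hw]; push_cast; ring
    have hseg : segment ℝ w (w + z) ⊆ wkbRegion μ R := by
      have := segment_subset_of_ray hD (s := j) (t := j + 1) ⟨hj0, by linarith⟩
        ⟨by linarith, hj'⟩
      convert this using 2
      · rw [hw, ofReal_natCast]
      · rw [hw]; push_cast; ring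
    have hwD := hseg (left_mem_segment ℝ _ _)
    have h1 := hT1 z rfl w hseg
    have h2 := (hT w z hseg).2
    have hm0 := wkbRoot_ne_zero w
    have hm1 := one_add_wkbRoot_ne_zero hwD.1
    have hA : ‖(1 - wkbRoot w) / (4 * wkbRoot w ^ 2 * (1 + wkbRoot w))‖ ≤ K := by
      refine le_trans ?_ hK2
      have h3 := le_norm_wkbRoot hwD
      have h4 := one_le_norm_one_add_wkbRoot hwD
      have h5 : ‖1 - wkbRoot w‖ ≤ 1 + R := (norm_sub_le _ _).trans (by
        rw [norm_one]; linarith [hwD.2.2])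
      rw [norm_div, norm_mul, norm_mul, norm_pow, show ‖(4 : ℂ)‖ = 4 by simp,
        show 4 * μ ^ 2 = 4 * μ ^ 2 * 1 by ring]
      gcongr
      linarith
    have hq := norm_exp_perturb_le hA (hend _ _ h1 h2).1 hz1 hz2
    have hrat : wkb z (j + 1) / wkb z j = (1 + wkbRoot w) *
        exp (z * ((1 - wkbRoot w) / (4 * wkbRoot w ^ 2 * (1 + wkbRoot w))) +
        ((wkbPhase (w + z) - wkbPhase w) / z - log (1 + wkbRoot w) -
        z / 2 * (-1 / (2 * wkbRoot w * (1 + wkbRoot w))) +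
        (wkbAmp (w + z) - wkbAmp w - z * (1 / (4 * wkbRoot w ^ 2 * (1 + wkbRoot w)))))) := by
      rw [wkb, wkb, ← exp_sub, hwz, ← hw]
      conv_rhs => rw [← exp_log hm1, ← exp_add, exp_log hm1]
      congr 1
      field_simp
      ring
    rw [hrat, ← mul_sub, norm_mul]
    have h6 : ‖1 + wkbRoot w‖ ≤ 1 + R := (norm_add_le _ _).trans (by
        rw [norm_one]; linarith [hwD.2.2])
    calc _ ≤ (1 + R) * ((4 * K ^ 2 + K) * ‖z‖ ^ 2) := by gcongr
      _ ≤ _ := by nlinarith [mul_nonneg hK1 (sq_nonneg ‖z‖), sq_nonneg ‖z‖]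
  · intro j hj
    have hj' : (j : ℝ) + 1 ≤ n := by exact_mod_cast hj
    have hj0 : (0 : ℝ) ≤ j := Nat.cast_nonneg j
    set w : ℂ := (j + 1 : ℕ) * z with hw
    have hwz : (j : ℂ) * z = w + -z := by rw [hw]; push_cast; ring
    have hseg : segment ℝ w (w + -z) ⊆ wkbRegion μ R := by
      have := segment_subset_of_ray hD (s := j + 1) (t := j) ⟨by linarith, hj'⟩
        ⟨hj0, by linarith⟩
      convert this using 2
      · push_cast; rw [hw]; push_cast; ring
      · rw [← hwz]; simp
    have hwD := hseg (left_mem_segment ℝ _ _)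
    have h1 := hT1 (-z) (norm_neg z) w hseg
    have h2 := (hT w (-z) hseg).2
    rw [norm_neg] at h2
    have hm0 := wkbRoot_ne_zero w
    have hm1 := one_add_wkbRoot_ne_zero hwD.1
    have h4 := one_le_norm_one_add_wkbRoot hwD
    have hA : ‖-1 / (4 * wkbRoot w ^ 2)‖ ≤ K := by
      refine le_trans ?_ hK2
      have h3 := le_norm_wkbRoot hwD
      rw [norm_div, norm_mul, norm_pow, norm_neg, norm_one, show ‖(4 : ℂ)‖ = 4 by simp]
      gcongr
      linarith
    have hq := norm_exp_perturb_le hA (hend _ _ h1 h2).2 hz1 hz2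
    have hrat : wkb z j / wkb z (j + 1) = (1 + wkbRoot w)⁻¹ *
        exp (z * (-1 / (4 * wkbRoot w ^ 2)) +
        (-((wkbPhase (w + -z) - wkbPhase w) / -z - log (1 + wkbRoot w) -
        -z / 2 * (-1 / (2 * wkbRoot w * (1 + wkbRoot w)))) +
        (wkbAmp (w + -z) - wkbAmp w - -z * (1 / (4 * wkbRoot w ^ 2 * (1 + wkbRoot w)))))) := by
      rw [wkb, wkb, ← exp_sub, ← hw, hwz]
      conv_rhs => rw [← exp_log hm1, ← exp_neg, ← exp_add, exp_log hm1]
      congr 1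
      field_simp
      ring
    rw [hrat, ← mul_sub, norm_mul, norm_inv]
    have h6 : ‖1 + wkbRoot w‖⁻¹ ≤ 1 := inv_le_one_of_one_le₀ (by linarith)
    calc _ ≤ 1 * ((4 * K ^ 2 + K) * ‖z‖ ^ 2) := by gcongr
      _ ≤ _ := by nlinarith [mul_nonneg hK1 (sq_nonneg ‖z‖), sq_nonneg ‖z‖,
        mul_nonneg hR (mul_nonneg (add_nonneg (mul_nonneg zero_le_four (sq_nonneg K)) hK1)
          (sq_nonneg ‖z‖))]

/-! ### Asymptotics of the three-term recurrence -/

/-- Stability of a second-order recurrence for the ratio `y` of a solution to an approximate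
dominant solution: the increments of `y` contract with factor `k < 1` and are fed by a residual of
size `ε`. -/
lemma norm_sub_one_le_of_contraction {y κ ρ : ℕ → ℂ} {n : ℕ} {k ε : ℝ} (hk0 : 0 ≤ k) (hk : k < 1)
    (hε : 0 ≤ ε) (hy0 : y 0 = 1)
    (hy : ∀ j < n, y (j + 1) - y j = κ j * (y j - y (j - 1)) - ρ j * y j)
    (hκ : ∀ j < n, ‖κ j‖ ≤ k) (hρ : ∀ j < n, ‖ρ j‖ ≤ ε) (hn : n * (2 * ε / (1 - k)) ≤ 1) :
    ∀ j ≤ n, ‖y j - 1‖ ≤ j * (2 * ε / (1 - k)) := by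
  set M := 2 * ε / (1 - k) with hM
  have hk' : 0 < 1 - k := by linarith
  have hM0 : 0 ≤ M := by positivity
  have hM1 : M * (1 - k) = 2 * ε := by rw [hM]; field_simp
  have key : ∀ j ≤ n, ‖y j - 1‖ ≤ j * M ∧ ‖y j - y (j - 1)‖ ≤ M := by
    intro j
    induction j with
    | zero => intro _; simp [hy0, hM0]
    | succ j ih =>
      intro hj
      obtain ⟨h1, h2⟩ := ih (by omega)
      have hyj : ‖y j‖ ≤ 2 := by
        have h3 : (j : ℝ) * M ≤ n * M := by gcongr; omega
        calc ‖y j‖ = ‖(y j - 1) + 1‖ := by congr 1; ring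
          _ ≤ ‖y j - 1‖ + 1 := (norm_add_le _ _).trans (by rw [norm_one])
          _ ≤ 2 := by linarith
      have hd : ‖y (j + 1) - y j‖ ≤ M := by
        rw [hy j (by omega)]
        refine (norm_sub_le _ _).trans ?_
        rw [norm_mul, norm_mul]
        calc ‖κ j‖ * ‖y j - y (j - 1)‖ + ‖ρ j‖ * ‖y j‖ ≤ k * M + ε * 2 := by
              gcongr
              · exact hκ j (by omega)
              · exact hρ j (by omega)
          _ = M := by linarith
      refine ⟨?_, by simpa using hd⟩
      calc ‖y (j + 1) - 1‖ = ‖(y (j + 1) - y j) + (y j - 1)‖ := by congr 1; ring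
        _ ≤ M + j * M := (norm_add_le _ _).trans (add_le_add hd h1)
        _ = _ := by push_cast; ring
  exact fun j hj => (key j hj).1

lemma norm_mul_sub_one_le {𝕜 : Type*} [NormedField 𝕜] {p q : 𝕜} {ε : ℝ}
    (hp : ‖p - 1‖ ≤ ε) (hq : ‖q - 1‖ ≤ ε) (hε : ε ≤ 1) : ‖p * q - 1‖ ≤ 3 * ε := by
  have hε0 : 0 ≤ ε := (norm_nonneg _).trans hp
  calc ‖p * q - 1‖ = ‖(p - 1) * (q - 1) + (p - 1) + (q - 1)‖ := by congr 1; ring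
    _ ≤ ‖p - 1‖ * ‖q - 1‖ + ‖p - 1‖ + ‖q - 1‖ := by
        rw [← norm_mul]; exact (norm_add_le _ _).trans (by gcongr; exact norm_add_le _ _)
    _ ≤ ε * 1 + ε + ε := by gcongr; exact hq.trans hε
    _ = 3 * ε := by ring

lemma norm_div_sub_one_le {𝕜 : Type*} [NormedField 𝕜] {p q : 𝕜} {ε : ℝ}
    (hp : ‖p - 1‖ ≤ ε) (hq : ‖q - 1‖ ≤ ε) (hε : ε ≤ 1 / 2) : ‖p / q - 1‖ ≤ 4 * ε := by
  have hq1 : 1 / 2 ≤ ‖q‖ := by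
    have h := norm_sub_norm_le 1 q
    rw [norm_one, norm_sub_rev] at h
    linarith
  have hq0 : q ≠ 0 := norm_pos_iff.1 (by linarith)
  rw [div_sub_one hq0, norm_div, div_le_iff₀ (by linarith)]
  calc ‖p - q‖ = ‖(p - 1) - (q - 1)‖ := by congr 1; ring
    _ ≤ ε + ε := (norm_sub_le _ _).trans (add_le_add hp hq)
    _ ≤ 4 * ε * ‖q‖ := by nlinarith [(norm_nonneg _).trans hp]

lemma wkbRoot_zero : wkbRoot 0 = 1 := by simp [wkbRoot]

lemma wkb_zero (z : ℂ) : wkb z 0 = 1 := by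
  rw [wkb, Nat.cast_zero, zero_mul, wkbPhase, wkbAmp, wkbRoot_zero]
  norm_num

/-- In the WKB region the dominant characteristic root `1 + m` beats the recessive one `1 - m` by
a definite amount. -/
lemma norm_one_sub_wkbRoot_le {μ R : ℝ} (hR : 0 ≤ R) {w : ℂ} (hw : w ∈ wkbRegion μ R)
    (hμ : 0 < μ) : ‖1 - wkbRoot w‖ + 2 * (μ / (1 + R)) ≤ ‖1 + wkbRoot w‖ := by
  obtain ⟨-, h1, h2⟩ := hw
  set m := wkbRoot w
  have hs : ‖1 + m‖ ^ 2 - ‖1 - m‖ ^ 2 = 4 * m.re := by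
    rw [Complex.sq_norm, Complex.sq_norm, normSq_apply, normSq_apply]
    simp; ring
  have h3 : ‖1 + m‖ ≤ 1 + R := (norm_add_le _ _).trans (by rw [norm_one]; linarith)
  have h4 : ‖1 - m‖ ≤ 1 + R := (norm_sub_le _ _).trans (by rw [norm_one]; linarith)
  by_contra! h
  have hg : 0 < μ / (1 + R) := by positivity
  have h5 : μ / (1 + R) * (1 + R) = μ := by field_simp
  have h6 : 0 ≤ ‖1 + m‖ + ‖1 - m‖ := by positivity
  have h7 : (‖1 + m‖ - ‖1 - m‖) * (‖1 + m‖ + ‖1 - m‖) = 4 * m.re := by rw [← hs]; ring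
  have h8 : 0 < ‖1 + m‖ + ‖1 - m‖ := by
    rcases h6.eq_or_lt with h0 | h0
    · rw [← h0] at h7; linarith
    · exact h0
  nlinarith [mul_lt_mul_of_pos_right (show ‖1 + m‖ - ‖1 - m‖ < 2 * (μ / (1 + R)) by linarith) h8]

set_option maxHeartbeats 1000000 in
/-- The WKB approximant solves the recurrence up to a relative error of order `1 / n`. -/
theorem wkb_asymptotics {μ : ℝ} (hμ : 0 < μ) {R : ℝ} (hR : 0 ≤ R) :
    ∃ C : ℝ, 1 ≤ C ∧ ∀ (n : ℕ) (z : ℂ) (h : ℕ → ℂ), C ≤ n → z ≠ 0 →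
      (∀ t ∈ Icc (0 : ℝ) n, (t : ℂ) * z ∈ wkbRegion μ R) → h 0 = 1 →
      (∀ j, h (j + 1) = 2 * h j - j * z * h (j - 1)) →
      ‖h n / wkb z n - 1‖ ≤ C / n ∧
        ‖(1 + wkbRoot (n * z)) * h (n - 1) / h n - 1‖ ≤ C / n := by
  obtain ⟨C, hC, hrat⟩ := norm_wkb_ratio_le hμ hR
  set g : ℝ := μ / (2 * (1 + R)) with hg
  have hg0 : 0 < g := by positivity
  have hg2 : 2 * (μ / (1 + R)) = 4 * g := by rw [hg]; field_simp; ring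
  have hgμ : g ≤ μ / 2 := by
    rw [hg]; rw [div_le_div_iff₀ (by positivity) (by positivity)]; nlinarith [mul_nonneg hμ.le hR]
  set k : ℝ := 1 - 2 * g / (1 + R) with hk
  have hk1 : 1 - k = 2 * g / (1 + R) := by rw [hk]; ring
  have hk1' : 0 < 1 - k := by rw [hk1]; positivity
  set B : ℝ := 1 + R ^ 2 with hB
  have hB1 : 1 ≤ B := by rw [hB]; nlinarith
  set C₃ : ℝ := C * B + (1 + R) / (4 * μ ^ 2) with hC₃
  set C₄ : ℝ := 1 / (4 * μ ^ 2) + (1 + R) * C with hC₄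
  set C₅ : ℝ := 2 * C * B ^ 3 * (1 + R) / g with hC₅
  have hC0 : 0 < C := by linarith
  have p1 : 0 ≤ C * B := by positivity
  have p2 : 0 ≤ C₃ * B / g := by positivity
  have p5 : 0 ≤ C₅ := by positivity
  have p4 : 0 ≤ C₄ * B := by positivity
  refine ⟨1 + C * B + C₃ * B / g + 12 * (C₅ + C₄ * B), by linarith,
    fun n z h hn hz hD h0 hrec => ?_⟩
  have hn1 : (1 : ℝ) ≤ n := by linarith
  have hn0 : (0 : ℝ) < n := by linarith
  have hnN : 1 ≤ n := by exact_mod_cast hn1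
  have hz0 : 0 < ‖z‖ := norm_pos_iff.2 hz
  have hDj : ∀ j ≤ n, (j : ℂ) * z ∈ wkbRegion μ R := by
    intro j hj
    have := hD j ⟨Nat.cast_nonneg j, by exact_mod_cast hj⟩
    simpa using this
  -- `n * z = 1 - m ^ 2` is bounded on the region, hence `z = O(1 / n)`
  have hzn : ‖z‖ ≤ B / n := by
    have h1 := hDj n le_rfl
    have h2 : (n : ℂ) * z = 1 - wkbRoot (n * z) ^ 2 := by rw [wkbRoot_sq h1.1]; ring
    rw [le_div_iff₀ hn0]
    calc ‖z‖ * n = ‖(n : ℂ) * z‖ := by rw [norm_mul, Complex.norm_natCast, mul_comm]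
      _ ≤ 1 + ‖wkbRoot (n * z)‖ ^ 2 := by
        conv_lhs => rw [h2]
        refine (norm_sub_le _ _).trans ?_
        rw [norm_one, norm_pow]
      _ ≤ B := by rw [hB]; gcongr; exact h1.2.2
  have hCz : C * ‖z‖ ≤ 1 := by
    calc C * ‖z‖ ≤ C * (B / n) := by gcongr
      _ ≤ 1 := by rw [← mul_div_assoc, div_le_one hn0]; linarith
  have hz1 : ‖z‖ ≤ 1 := by nlinarith
  have hC₃z : C₃ * ‖z‖ ≤ g := by
    calc C₃ * ‖z‖ ≤ C₃ * (B / n) := by gcongr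
      _ = C₃ * B / g * g / n := by field_simp
      _ ≤ g := by
        rw [div_le_iff₀ hn0, mul_comm g]
        gcongr
        linarith
  obtain ⟨hplus, hminus⟩ := hrat n z hz hCz hD
  -- in terms of `y j = h j / wkb z j` the recurrence reads
  -- `P j * y (j + 1) = 2 * y j - Q j * y (j - 1)`; the first-order corrections `±T j` of `P j` and
  -- `Q j` cancel in `P j + Q j - 2`, leaving `O(z²)`
  set P : ℕ → ℂ := fun j => wkb z (j + 1) / wkb z j with hP
  set Q : ℕ → ℂ := fun j => j * z * wkb z (j - 1) / wkb z j with hQ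
  set m : ℕ → ℂ := fun j => wkbRoot (j * z) with hm
  set T : ℕ → ℂ := fun j => z * ((1 - m j) / (4 * m j ^ 2)) with hT
  have hm0 : ∀ j, m j ≠ 0 := fun j => wkbRoot_ne_zero _
  have hm1 : ∀ j ≤ n, 1 + m j ≠ 0 := fun j hj => one_add_wkbRoot_ne_zero (hDj j hj).1
  have hPT : ∀ j < n, ‖P j - (1 + m j + T j)‖ ≤ C * ‖z‖ ^ 2 := by
    intro j hj
    refine le_of_eq_of_le ?_ (hplus j hj)
    have h1 := hm0 j
    have h2 := hm1 j hj.le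
    congr 1
    simp only [hT]
    change _ = P j - (1 + m j) * (1 + z * ((1 - m j) / (4 * m j ^ 2 * (1 + m j))))
    field_simp
  have hQT : ∀ j < n, ‖Q j - (1 - m j - T j)‖ ≤ C * B * ‖z‖ ^ 2 := by
    intro j hj
    match j with
    | 0 =>
      have h1 : m 0 = 1 := by simp only [hm, Nat.cast_zero, zero_mul, wkbRoot_zero]
      simp only [hQ, hT, h1]
      simp
      positivity
    | i + 1 =>
      have h1 := hm0 (i + 1)
      have h2 := hm1 (i + 1) hj.le
      have h3 : ((i + 1 : ℕ) : ℂ) * z = (1 - m (i + 1)) * (1 + m (i + 1)) := by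
        have := wkbRoot_sq (hDj (i + 1) hj.le).1
        change m (i + 1) ^ 2 = _ at this
        linear_combination this
      have h4 : ‖((i + 1 : ℕ) : ℂ) * z‖ ≤ B := by
        rw [norm_mul, Complex.norm_natCast]
        calc ((i + 1 : ℕ) : ℝ) * ‖z‖ ≤ n * (B / n) := by gcongr
          _ = B := by field_simp
      have h5 := hminus i (by omega)
      have h7 : Q (i + 1) - (1 - m (i + 1) - T (i + 1)) = ((i + 1 : ℕ) * z) *
          (wkb z i / wkb z (i + 1) - (1 + m (i + 1))⁻¹ *
            (1 + z * (-1 / (4 * m (i + 1) ^ 2)))) := by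
        have h8 : ∀ M : ℂ, M ≠ 0 → 1 + M ≠ 0 → 1 - M - z * ((1 - M) / (4 * M ^ 2)) =
            (1 - M) * (1 + M) * ((1 + M)⁻¹ * (1 + z * (-1 / (4 * M ^ 2)))) := by
          intro M hM hM'
          field_simp
          ring
        rw [mul_sub, h3, ← h8 _ h1 h2, ← h3]
        simp only [hQ, hT, Nat.add_sub_cancel]
        rw [mul_div_assoc]
      rw [h7, norm_mul]
      calc _ ≤ B * (C * ‖z‖ ^ 2) := by gcongr
        _ = _ := by ring
  have hTb : ∀ j ≤ n, ‖T j‖ ≤ (1 + R) / (4 * μ ^ 2) * ‖z‖ := by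
    intro j hj
    have h1 := hDj j hj
    have h2 : ‖1 - m j‖ ≤ 1 + R := (norm_sub_le _ _).trans (by
        rw [norm_one]; linarith [h1.2.2])
    have h3 : μ ≤ ‖m j‖ := le_norm_wkbRoot h1
    simp only [hT]
    rw [norm_mul, norm_div, norm_mul, norm_pow, show ‖(4 : ℂ)‖ = 4 by simp, mul_comm]
    gcongr
  have hzsq : ‖z‖ ^ 2 ≤ ‖z‖ := by nlinarith
  have hPb : ∀ j < n, ‖1 + m j‖ - g ≤ ‖P j‖ := by
    intro j hj
    have h1 : ‖1 + m j - P j‖ ≤ g := by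
      calc ‖1 + m j - P j‖ = ‖-(P j - (1 + m j + T j)) - T j‖ := by congr 1; ring
        _ ≤ C * ‖z‖ ^ 2 + (1 + R) / (4 * μ ^ 2) * ‖z‖ := by
          refine (norm_sub_le _ _).trans (add_le_add ?_ (hTb j hj.le))
          rw [norm_neg]; exact hPT j hj
        _ ≤ C * B * ‖z‖ + (1 + R) / (4 * μ ^ 2) * ‖z‖ := by
          gcongr ?_ + _
          calc C * ‖z‖ ^ 2 ≤ C * ‖z‖ := by gcongr
            _ ≤ C * B * ‖z‖ := by gcongr; exact le_mul_of_one_le_right hC0.le hB1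
        _ = C₃ * ‖z‖ := by rw [hC₃]; ring
        _ ≤ g := hC₃z
    have := norm_sub_norm_le (1 + m j) (1 + m j - P j)
    rw [sub_sub_cancel] at this
    linarith
  have hQb : ∀ j < n, ‖Q j‖ ≤ ‖1 - m j‖ + g := by
    intro j hj
    calc ‖Q j‖ = ‖(Q j - (1 - m j - T j)) - T j + (1 - m j)‖ := by congr 1; ring
      _ ≤ C * B * ‖z‖ ^ 2 + (1 + R) / (4 * μ ^ 2) * ‖z‖ + ‖1 - m j‖ := by
        refine (norm_add_le _ _).trans (add_le_add_left ?_ _)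
        exact (norm_sub_le _ _).trans (add_le_add (hQT j hj) (hTb j hj.le))
      _ ≤ C * B * ‖z‖ + (1 + R) / (4 * μ ^ 2) * ‖z‖ + ‖1 - m j‖ := by gcongr
      _ = C₃ * ‖z‖ + ‖1 - m j‖ := by rw [hC₃]; ring
      _ ≤ _ := by linarith
  have hP1 : ∀ j < n, 1 ≤ ‖P j‖ := by
    intro j hj
    have := one_le_norm_one_add_wkbRoot (hDj j hj.le)
    change 1 + μ ≤ ‖1 + m j‖ at this
    linarith [hPb j hj]
  set ε : ℝ := 2 * C * B * ‖z‖ ^ 2 with hε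
  have hM : 2 * ε / (1 - k) = 2 * C * B * (1 + R) / g * ‖z‖ ^ 2 := by
    rw [hk1, hε]; field_simp
  have hnM : n * (2 * ε / (1 - k)) ≤ C₅ / n := by
    rw [hM]
    calc (n : ℝ) * (2 * C * B * (1 + R) / g * ‖z‖ ^ 2)
        ≤ n * (2 * C * B * (1 + R) / g * (B / n) ^ 2) := by gcongr
      _ = C₅ / n := by rw [hC₅]; field_simp
  have hC₅n : C₅ / n ≤ 1 := by rw [div_le_one hn0]; linarith
  have hκ : ∀ j < n, ‖Q j / P j‖ ≤ k := by
    intro j hj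
    have h1 := norm_one_sub_wkbRoot_le hR (hDj j hj.le) hμ
    change ‖1 - m j‖ + _ ≤ ‖1 + m j‖ at h1
    rw [hg2] at h1
    have h2 : ‖1 + m j‖ ≤ 1 + R := (norm_add_le _ _).trans (by
        rw [norm_one]; linarith [(hDj j hj.le).2.2])
    have h3 := hP1 j hj
    have h4 : 1 + μ ≤ ‖1 + m j‖ := one_le_norm_one_add_wkbRoot (hDj j hj.le)
    have h5 : 0 < ‖1 + m j‖ - g := by linarith
    rw [norm_div]
    calc ‖Q j‖ / ‖P j‖ ≤ (‖1 + m j‖ - g - 2 * g) / (‖1 + m j‖ - g) :=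
          div_le_div₀ (by linarith [norm_nonneg (1 - m j)]) (by linarith [hQb j hj]) h5 (hPb j hj)
      _ = 1 - 2 * g / (‖1 + m j‖ - g) := by field_simp
      _ ≤ k := by
        rw [hk]
        gcongr
        linarith
  have hρ : ∀ j < n, ‖(P j + Q j - 2) / P j‖ ≤ ε := by
    intro j hj
    rw [norm_div]
    refine (div_le_self (norm_nonneg _) (hP1 j hj)).trans ?_
    calc ‖P j + Q j - 2‖ = ‖(P j - (1 + m j + T j)) + (Q j - (1 - m j - T j))‖ := by
          congr 1; ring
      _ ≤ C * ‖z‖ ^ 2 + C * B * ‖z‖ ^ 2 :=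
          (norm_add_le _ _).trans (add_le_add (hPT j hj) (hQT j hj))
      _ ≤ C * B * ‖z‖ ^ 2 + C * B * ‖z‖ ^ 2 := by
          gcongr; exact le_mul_of_one_le_right hC0.le hB1
      _ = ε := by rw [hε]; ring
  have hk0 : 0 ≤ k := (norm_nonneg _).trans (hκ 0 hnN)
  set y : ℕ → ℂ := fun j => h j / wkb z j with hy
  have hyrec : ∀ j < n, y (j + 1) - y j =
      Q j / P j * (y j - y (j - 1)) - (P j + Q j - 2) / P j * y j := by
    intro j _
    have h1 := wkb_ne_zero z j
    have h2 := wkb_ne_zero z (j + 1)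
    have h3 := wkb_ne_zero z (j - 1)
    simp only [hy, hP, hQ]
    rw [hrec j]
    field_simp
    ring
  have hmain := norm_sub_one_le_of_contraction hk0 (by linarith) (by positivity)
    (show y 0 = 1 by simp [hy, h0, wkb_zero]) hyrec hκ hρ (hnM.trans hC₅n)
  have hM0 : 0 ≤ 2 * ε / (1 - k) := by positivity
  have hyn : ‖y n - 1‖ ≤ C₅ / n := (hmain n le_rfl).trans hnM
  have hyn' : ‖y (n - 1) - 1‖ ≤ C₅ / n := by
    refine (hmain (n - 1) (by omega)).trans (le_trans ?_ hnM)
    gcongr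
    omega
  have hC₄n : C₄ * B / n ≤ 1 := by rw [div_le_one hn0]; linarith
  have hsum : (C₅ + C₄ * B) / n ≤ 1 / 12 := by
    rw [div_le_iff₀ hn0]; linarith
  have hle5 : C₅ / n ≤ (C₅ + C₄ * B) / n := by gcongr; linarith
  have hle4 : C₄ * B / n ≤ (C₅ + C₄ * B) / n := by gcongr; linarith
  have hle : 12 * ((C₅ + C₄ * B) / n) ≤ (1 + C * B + C₃ * B / g + 12 * (C₅ + C₄ * B)) / n := by
    rw [← mul_div_assoc]; gcongr; linarith
  have hpos : 0 ≤ (C₅ + C₄ * B) / n := by positivity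
  refine ⟨by linarith, ?_⟩
  obtain ⟨i, rfl⟩ : ∃ i, n = i + 1 := ⟨n - 1, by omega⟩
  have h1 : ‖(1 + m (i + 1)) * (wkb z i / wkb z (i + 1)) - 1‖ ≤ (C₅ + C₄ * B) / (i + 1 : ℕ) := by
    refine le_trans ?_ hle4
    have h2 := hm1 (i + 1) le_rfl
    have h3 := hm0 (i + 1)
    have h4 := hDj (i + 1) le_rfl
    have h5 : ‖1 + m (i + 1)‖ ≤ 1 + R := (norm_add_le _ _).trans (by
        rw [norm_one]; linarith [h4.2.2])
    have h6 : μ ≤ ‖m (i + 1)‖ := le_norm_wkbRoot h4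
    calc ‖(1 + m (i + 1)) * (wkb z i / wkb z (i + 1)) - 1‖
        = ‖(1 + m (i + 1)) * (wkb z i / wkb z (i + 1) - (1 + m (i + 1))⁻¹ *
            (1 + z * (-1 / (4 * m (i + 1) ^ 2)))) + z * (-1 / (4 * m (i + 1) ^ 2))‖ := by
          congr 1
          rw [mul_sub, ← mul_assoc, mul_inv_cancel₀ h2]
          ring
      _ ≤ (1 + R) * (C * ‖z‖ ^ 2) + ‖z‖ * (1 / (4 * μ ^ 2)) := by
          refine (norm_add_le _ _).trans ?_
          rw [norm_mul, norm_mul z, norm_div, norm_mul, norm_pow, norm_neg, norm_one,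
            show ‖(4 : ℂ)‖ = 4 by simp]
          gcongr
          exact hminus i (by omega)
      _ ≤ (1 + R) * (C * ‖z‖) + ‖z‖ * (1 / (4 * μ ^ 2)) := by gcongr
      _ = C₄ * ‖z‖ := by rw [hC₄]; ring
      _ ≤ C₄ * (B / (i + 1 : ℕ)) := by gcongr
      _ = _ := by ring
  have h2 := norm_div_sub_one_le (hyn'.trans hle5) (hyn.trans hle5) (by linarith)
  have h3 := norm_mul_sub_one_le (h1.trans (by linarith)) h2 (by linarith)
  refine le_trans (le_of_eq ?_) ((h3.trans (by linarith)).trans hle)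
  congr 2
  simp only [hy, Nat.add_sub_cancel]
  have h4 := wkb_ne_zero z (i + 1)
  have h5 := wkb_ne_zero z i
  change (1 + m (i + 1)) * h i / h (i + 1) = _
  by_cases h6 : h (i + 1) = 0
  · simp [h6]
  · field_simp

/-! ### Plancherel–Rotach asymptotics off the interval of zeros -/

/-- The Joukowski map `a ↦ (a + a⁻¹) / 2`, so that `cosh u = joukowski (exp (-u))`. -/
noncomputable def joukowski (a : ℂ) : ℂ := (a + a⁻¹) / 2

lemma one_add_sq_ne_zero {a : ℂ} (ha : ‖a‖ < 1) : 1 + a ^ 2 ≠ 0 := by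
  intro h
  have h1 : ‖a ^ 2‖ = 1 := by
    rw [show a ^ 2 = -1 by linear_combination h]; simp
  rw [norm_pow] at h1
  nlinarith [norm_nonneg a]

lemma one_sub_sq_ne_zero {a : ℂ} (ha : ‖a‖ < 1) : 1 - a ^ 2 ≠ 0 := by
  intro h
  have h1 : ‖a ^ 2‖ = 1 := by
    rw [show a ^ 2 = 1 by linear_combination -h]; simp
  rw [norm_pow] at h1
  nlinarith [norm_nonneg a]

lemma joukowski_eq {a : ℂ} (h0 : a ≠ 0) : joukowski a = (1 + a ^ 2) / (2 * a) := by
  rw [joukowski]; field_simp; ring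

lemma joukowski_ne_zero {a : ℂ} (h0 : a ≠ 0) (ha : ‖a‖ < 1) : joukowski a ≠ 0 := by
  rw [joukowski_eq h0]
  exact div_ne_zero (one_add_sq_ne_zero ha) (by simp [h0])

/-- The square of a Joukowski image of the punctured disc avoids `[0, 1]`, so the WKB variable
stays on the slit plane. -/
lemma one_sub_div_joukowski_sq_mem_slitPlane {a : ℂ} (h0 : a ≠ 0) (ha : ‖a‖ < 1) {θ : ℝ}
    (hθ0 : 0 ≤ θ) (hθ : θ ≤ 1) : 1 - (θ : ℂ) / joukowski a ^ 2 ∈ slitPlane := by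
  by_contra h
  rw [mem_slitPlane_iff] at h
  push Not at h
  obtain ⟨h1, h2⟩ := h
  have hc := joukowski_ne_zero h0 ha
  obtain ⟨k, hk⟩ : ∃ k : ℝ, (θ : ℂ) / joukowski a ^ 2 = k := by
    refine ⟨((θ : ℂ) / joukowski a ^ 2).re, Complex.ext (by simp) ?_⟩
    simp only [sub_im, one_im, zero_sub, neg_eq_zero] at h2
    rw [h2, ofReal_im]
  have hk1 : 1 ≤ k := by
    rw [hk] at h1; simp at h1; exact h1
  have hc2 : joukowski a ^ 2 = ((θ / k : ℝ) : ℂ) := by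
    have : (k : ℂ) ≠ 0 := by exact_mod_cast (by linarith : k ≠ 0)
    push_cast
    field_simp
    field_simp at hk
    rw [hk]
  set t := θ / k with ht
  have ht0 : 0 ≤ t := by positivity
  have ht1 : t ≤ 1 := by rw [ht, div_le_one (by linarith)]; linarith
  -- `A = a ^ 2` is a root of a real quadratic with non-positive discriminant
  have hA : (a ^ 2) ^ 2 - ((4 * t - 2 : ℝ) : ℂ) * a ^ 2 + 1 = 0 := by
    rw [joukowski_eq h0] at hc2
    field_simp at hc2
    push_cast
    linear_combination hc2
  have hA1 : ‖a ^ 2‖ < 1 := by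
    rw [norm_pow]; nlinarith [norm_nonneg a]
  have hA2 : ‖a ^ 2‖ ^ 2 = (a ^ 2).re ^ 2 + (a ^ 2).im ^ 2 := by
    rw [Complex.sq_norm, normSq_apply]; ring
  have hA3 : (a ^ 2).re ^ 2 + (a ^ 2).im ^ 2 < 1 := by
    rw [← hA2]; nlinarith [norm_nonneg (a ^ 2)]
  generalize a ^ 2 = A at *
  have hre := congrArg re hA
  have him := congrArg im hA
  simp [pow_two] at hre him
  by_cases hq : A.im = 0
  · rw [hq] at hre hA3
    have e1 : A.re * A.re - (4 * t - 2) * A.re + 1 = 0 := by linarith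
    rcases le_total 0 A.re with h | h
    · have : (A.re - 1) ^ 2 ≤ 0 := by nlinarith
      have : A.re - 1 = 0 := by nlinarith
      nlinarith
    · have : (A.re + 1) ^ 2 ≤ 0 := by nlinarith
      have : A.re + 1 = 0 := by nlinarith
      nlinarith
  · have : 4 * t - 2 = 2 * A.re := by
      apply mul_right_cancel₀ hq; linarith
    rw [this] at hre
    nlinarith

/-- With `cosh u = joukowski a`, the WKB root at the end point `1 / cosh² u` of the ray is `tanh u`.
-/
lemma wkbRoot_inv_joukowski_sq {a : ℂ} (h0 : a ≠ 0) (ha : ‖a‖ < 1) :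
    wkbRoot (1 / joukowski a ^ 2) = (1 - a ^ 2) / (1 + a ^ 2) := by
  have hs := one_sub_div_joukowski_sq_mem_slitPlane h0 ha zero_le_one le_rfl
  rw [ofReal_one] at hs
  have h1 := wkbRoot_sq hs
  have h2 := wkbRoot_re_pos hs
  have hp := one_add_sq_ne_zero ha
  have h3 : wkbRoot (1 / joukowski a ^ 2) ^ 2 = ((1 - a ^ 2) / (1 + a ^ 2)) ^ 2 := by
    rw [h1, joukowski_eq h0]
    field_simp
    ring
  have hA1 : ‖a ^ 2‖ < 1 := by
    rw [norm_pow]; nlinarith [norm_nonneg a]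
  have h4 : 0 < ((1 - a ^ 2) / (1 + a ^ 2)).re := by
    have hA2 : ‖a ^ 2‖ ^ 2 = (a ^ 2).re ^ 2 + (a ^ 2).im ^ 2 := by
      rw [Complex.sq_norm, normSq_apply]; ring
    have hA3 : (a ^ 2).re ^ 2 + (a ^ 2).im ^ 2 < 1 := by
      rw [← hA2]; nlinarith [norm_nonneg (a ^ 2)]
    generalize a ^ 2 = A at *
    rw [div_re, ← add_div]
    refine div_pos ?_ (normSq_pos.2 hp)
    simp
    nlinarith
  rcases sq_eq_sq_iff_eq_or_eq_neg.1 h3 with h | h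
  · exact h
  · rw [h, neg_re] at h2; linarith

lemma continuousOn_joukowski : ContinuousOn joukowski {a | a ≠ 0} := by
  unfold joukowski
  fun_prop (disch := simp_all)

lemma continuousOn_wkbRoot_div_joukowski_sq :
    ContinuousOn (fun p : ℝ × ℂ => wkbRoot ((p.1 : ℂ) / joukowski p.2 ^ 2))
      {p | p.2 ≠ 0 ∧ ‖p.2‖ < 1 ∧ 0 ≤ p.1 ∧ p.1 ≤ 1} := by
  rintro p ⟨h0, h1, h2, h3⟩
  have hj : ContinuousWithinAt (fun p : ℝ × ℂ => joukowski p.2)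
      {p | p.2 ≠ 0 ∧ ‖p.2‖ < 1 ∧ 0 ≤ p.1 ∧ p.1 ≤ 1} p :=
    (continuousOn_joukowski p.2 h0).comp continuousWithinAt_snd (fun q hq => hq.1)
  have hp : ContinuousWithinAt (fun p : ℝ × ℂ => (p.1 : ℂ))
      {p | p.2 ≠ 0 ∧ ‖p.2‖ < 1 ∧ 0 ≤ p.1 ∧ p.1 ≤ 1} p :=
    (continuous_ofReal.comp continuous_fst).continuousWithinAt
  have hw := hp.div (hj.pow 2) (pow_ne_zero 2 (joukowski_ne_zero h0 h1))
  have hs := one_sub_div_joukowski_sq_mem_slitPlane h0 h1 h2 h3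
  exact ContinuousAt.comp_continuousWithinAt (g := wkbRoot)
    (f := fun p : ℝ × ℂ => (p.1 : ℂ) / joukowski p.2 ^ 2) (hasDerivAt_wkbRoot hs).continuousAt hw

/-- A continuous function that is positive on a compact set is bounded below by a positive
constant there. -/
lemma exists_pos_le_of_isCompact {X : Type*} [TopologicalSpace X] {K : Set X} (hK : IsCompact K)
    {f : X → ℝ} (hf : ContinuousOn f K) (hpos : ∀ x ∈ K, 0 < f x) :
    ∃ μ : ℝ, 0 < μ ∧ ∀ x ∈ K, μ ≤ f x := by
  rcases K.eq_empty_or_nonempty with hE | hne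
  · exact ⟨1, one_pos, by simp [hE]⟩
  · obtain ⟨p, hp, hmin⟩ := hK.exists_isMinOn hne hf
    exact ⟨f p, hpos p hp, fun q hq => hmin hq⟩

/-- For `a` in a closed annulus, the ray to `1 / (joukowski a)²` lies in a fixed `wkbRegion`. -/
lemma exists_wkbRegion {r₁ r₂ : ℝ} (hr₁ : 0 < r₁) (hr₂ : r₂ < 1) :
    ∃ μ R : ℝ, 0 < μ ∧ 0 ≤ R ∧ ∀ a : ℂ, r₁ ≤ ‖a‖ → ‖a‖ ≤ r₂ → ∀ θ ∈ Icc (0 : ℝ) 1,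
      (θ : ℂ) / joukowski a ^ 2 ∈ wkbRegion μ R := by
  obtain ⟨K, hK⟩ : ∃ K : Set (ℝ × ℂ), K = Icc (0 : ℝ) 1 ×ˢ {a : ℂ | r₁ ≤ ‖a‖ ∧ ‖a‖ ≤ r₂} :=
    ⟨_, rfl⟩
  have hKc : IsCompact K := by
    have h : {a : ℂ | r₁ ≤ ‖a‖ ∧ ‖a‖ ≤ r₂} = Metric.closedBall 0 r₂ \ Metric.ball 0 r₁ := by
      ext a; simp [and_comm]
    rw [hK, h]
    exact isCompact_Icc.prod ((isCompact_closedBall _ _).diff Metric.isOpen_ball)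
  have hK0 : K ⊆ {p | p.2 ≠ 0 ∧ ‖p.2‖ < 1 ∧ 0 ≤ p.1 ∧ p.1 ≤ 1} := by
    intro p hp
    rw [hK] at hp
    obtain ⟨h1, h2, h3⟩ := hp
    exact ⟨norm_pos_iff.1 (hr₁.trans_le h2), lt_of_le_of_lt h3 hr₂, h1⟩
  have hcont := continuousOn_wkbRoot_div_joukowski_sq.mono hK0
  obtain ⟨R, hR⟩ := hKc.exists_bound_of_continuousOn hcont
  obtain ⟨μ, hμ0, hμ⟩ := exists_pos_le_of_isCompact hKc (continuous_re.comp_continuousOn hcont)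
    (fun p hp => wkbRoot_re_pos (one_sub_div_joukowski_sq_mem_slitPlane (hK0 hp).1 (hK0 hp).2.1
      (hK0 hp).2.2.1 (hK0 hp).2.2.2))
  refine ⟨μ, |R|, hμ0, abs_nonneg R, fun a h1 h2 θ hθ => ?_⟩
  have hp : ((θ, a) : ℝ × ℂ) ∈ K := by rw [hK]; exact ⟨hθ, h1, h2⟩
  have e1 : 1 - (θ : ℂ) / joukowski a ^ 2 ∈ slitPlane :=
    one_sub_div_joukowski_sq_mem_slitPlane (hK0 hp).1 (hK0 hp).2.1 hθ.1 hθ.2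
  have e2 : μ ≤ (wkbRoot ((θ : ℂ) / joukowski a ^ 2)).re := hμ (θ, a) hp
  have e3 : ‖wkbRoot ((θ : ℂ) / joukowski a ^ 2)‖ ≤ R := hR (θ, a) hp
  exact ⟨e1, e2, e3.trans (le_abs_self R)⟩

/-- The WKB amplitude at the end point of the ray. -/
lemma norm_exp_wkbAmp {a : ℂ} (h0 : a ≠ 0) (ha : ‖a‖ < 1) :
    ‖exp (wkbAmp (1 / joukowski a ^ 2))‖ = 1 / Real.sqrt ‖1 - a ^ 2‖ := by
  have hs := one_sub_div_joukowski_sq_mem_slitPlane h0 ha zero_le_one le_rfl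
  rw [ofReal_one] at hs
  have h1 := one_add_wkbRoot_ne_zero hs
  have h2 := wkbRoot_ne_zero (1 / joukowski a ^ 2)
  have h3 : exp (wkbAmp (1 / joukowski a ^ 2)) ^ 2 = 1 / (1 - a ^ 2) := by
    rw [← exp_nat_mul, wkbAmp]
    push_cast
    rw [mul_div_cancel₀ _ two_ne_zero, exp_sub, exp_sub, exp_log h1, exp_log h2,
      exp_log two_ne_zero, wkbRoot_inv_joukowski_sq h0 ha]
    have := one_add_sq_ne_zero ha
    have := one_sub_sq_ne_zero ha
    field_simp
    ring
  have h4 := congrArg norm h3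
  rw [norm_pow, norm_div, norm_one] at h4
  rw [← Real.sqrt_sq (norm_nonneg (exp _)), h4, Real.sqrt_div zero_le_one, Real.sqrt_one]

/-- The Plancherel–Rotach size of `H_n (√(2n) cosh u)`, in terms of `a = exp (-u)`. -/
noncomputable def hermiteSize (n : ℕ) (a : ℂ) : ℝ :=
  (Real.sqrt (2 * n) / ‖a‖) ^ n * Real.exp (n * (a ^ 2).re / 2) / Real.sqrt ‖1 - a ^ 2‖

lemma hermiteSize_pos {n : ℕ} (hn : n ≠ 0) {a : ℂ} (h0 : a ≠ 0) (ha : ‖a‖ < 1) :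
    0 < hermiteSize n a := by
  have h1 := norm_pos_iff.2 (one_sub_sq_ne_zero ha)
  have h2 := norm_pos_iff.2 h0
  have h3 : (0 : ℝ) < n := by exact_mod_cast Nat.pos_of_ne_zero hn
  unfold hermiteSize
  positivity

/-- Exterior Plancherel–Rotach asymptotics with relative error `O(1 / n)`, uniformly for
`a = exp (-u)` in closed annuli inside the unit disc. -/
theorem hermiteH_asymptotics {r₁ r₂ : ℝ} (hr₁ : 0 < r₁) (hr₂ : r₂ < 1) :
    ∃ C : ℝ, 1 ≤ C ∧ ∀ (n : ℕ) (a : ℂ), C ≤ n → r₁ ≤ ‖a‖ → ‖a‖ ≤ r₂ →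
      hermiteH n ((Real.sqrt (2 * n) : ℝ) * joukowski a) ≠ 0 ∧
      |‖hermiteH n ((Real.sqrt (2 * n) : ℝ) * joukowski a)‖ / hermiteSize n a - 1| ≤ C / n ∧
      ‖((Real.sqrt (2 * n) : ℝ) : ℂ) * hermiteH (n - 1) ((Real.sqrt (2 * n) : ℝ) * joukowski a) /
        (a * hermiteH n ((Real.sqrt (2 * n) : ℝ) * joukowski a)) - 1‖ ≤ C / n := by
  obtain ⟨μ, R, hμ, hR, hreg⟩ := exists_wkbRegion hr₁ hr₂
  obtain ⟨C, hC, hmain⟩ := wkb_asymptotics hμ hR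
  refine ⟨2 * C, by linarith, fun n a hn h1 h2 => ?_⟩
  have h0 : a ≠ 0 := norm_pos_iff.1 (hr₁.trans_le h1)
  have ha : ‖a‖ < 1 := lt_of_le_of_lt h2 hr₂
  have hn0 : (0 : ℝ) < n := by linarith
  have hn0' : (n : ℂ) ≠ 0 := by exact_mod_cast hn0.ne'
  have hc := joukowski_ne_zero h0 ha
  set q : ℂ := ((Real.sqrt (2 * n) : ℝ) : ℂ) with hq
  have hq2 : q ^ 2 = 2 * n := by
    rw [hq, ← ofReal_pow, Real.sq_sqrt (by positivity)]; push_cast; ring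
  have hq0 : q ≠ 0 := by
    intro h; rw [h] at hq2
    have : (n : ℂ) = 0 := by linear_combination -hq2 / 2
    exact hn0' this
  set c := joukowski a with hcdef
  set x := q * c with hx
  have hx0 : x ≠ 0 := mul_ne_zero hq0 hc
  set z : ℂ := 2 / x ^ 2 with hz
  have hz0 : z ≠ 0 := div_ne_zero two_ne_zero (pow_ne_zero 2 hx0)
  have hzc : z = 1 / (n * c ^ 2) := by
    rw [hz, hx, mul_pow, hq2]; field_simp
  have hD : ∀ t ∈ Icc (0 : ℝ) n, (t : ℂ) * z ∈ wkbRegion μ R := by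
    intro t ht
    have := hreg a h1 h2 (t / n) ⟨div_nonneg ht.1 hn0.le, (div_le_one hn0).2 ht.2⟩
    rw [← hcdef] at this
    convert this using 1
    rw [hzc]; push_cast; field_simp
  have hnz : (n : ℂ) * z = 1 / c ^ 2 := by rw [hzc]; field_simp
  obtain ⟨hA, hB⟩ := hmain n z (fun j => hermiteH j x / x ^ j) (by linarith) hz0 hD
    (by simp [hermiteH_zero]) (by
      intro j
      rw [hermiteH_succ, hz]
      cases j with
      | zero => simp; field_simp
      | succ i => simp only [Nat.add_sub_cancel]; field_simp; push_cast; ring)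
  rw [hnz] at hB
  have hp := one_add_sq_ne_zero ha
  have hm := wkbRoot_inv_joukowski_sq h0 ha
  rw [← hcdef] at hm
  -- the WKB approximant at `j = n` in closed form
  have hs := one_sub_div_joukowski_sq_mem_slitPlane h0 ha zero_le_one le_rfl
  rw [ofReal_one, ← hcdef] at hs
  have hlog := one_add_wkbRoot_ne_zero hs
  have hw : x ^ n * wkb z n = (q / a) ^ n * exp (n * a ^ 2 / 2) * exp (wkbAmp (1 / c ^ 2)) := by
    have hph : wkbPhase (1 / c ^ 2) / z = n * log (1 + wkbRoot (1 / c ^ 2)) + n * a ^ 2 / 2 := by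
      rw [wkbPhase, hzc]
      have e1 : (1 - wkbRoot (1 / c ^ 2)) ^ 2 / 2 * c ^ 2 = a ^ 2 / 2 := by
        rw [hm, hcdef, joukowski_eq h0]; field_simp; ring
      calc _ = n * log (1 + wkbRoot (1 / c ^ 2)) +
            n * ((1 - wkbRoot (1 / c ^ 2)) ^ 2 / 2 * c ^ 2) := by field_simp
        _ = _ := by rw [e1]; ring
    rw [wkb, hnz, hph, exp_add, exp_add, exp_nat_mul, exp_log hlog, ← mul_assoc, ← mul_assoc,
      ← mul_pow]
    congr 3
    rw [hm, hx, hcdef, joukowski_eq h0]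
    field_simp
    ring
  have hwn : ‖x ^ n * wkb z n‖ = hermiteSize n a := by
    rw [hw, norm_mul, norm_mul, norm_pow, norm_div, hcdef, norm_exp_wkbAmp h0 ha, norm_exp,
      hermiteSize, hq, norm_real, Real.norm_of_nonneg (Real.sqrt_nonneg _)]
    have : ((n : ℂ) * a ^ 2 / 2).re = n * (a ^ 2).re / 2 := by
      rw [show (n : ℂ) * a ^ 2 / 2 = ((n / 2 : ℝ) : ℂ) * a ^ 2 by push_cast; ring, re_ofReal_mul]
      ring
    rw [this]
    ring
  have hCn : C / n ≤ 1 / 2 := by rw [div_le_iff₀ hn0]; linarith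
  have hle : C / n ≤ 2 * C / n := by gcongr; linarith
  have hwz := wkb_ne_zero z n
  have hH0 : hermiteH n x ≠ 0 := by
    intro h
    rw [h] at hA
    simp at hA
    linarith
  refine ⟨hH0, ?_, ?_⟩
  · refine le_trans ?_ (hA.trans hle)
    rw [← hwn, ← norm_div, div_div]
    simpa using abs_norm_sub_norm_le (hermiteH n x / (x ^ n * wkb z n)) 1
  · refine le_trans (le_of_eq ?_) (hB.trans hle)
    congr 2
    obtain ⟨i, rfl⟩ : ∃ i, n = i + 1 := ⟨n - 1, by
      have : 0 < n := by exact_mod_cast hn0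
      omega⟩
    have e2 : (1 + wkbRoot (1 / c ^ 2)) * x = q / a := by
      rw [hm, hx, hcdef, joukowski_eq h0]; field_simp; ring
    have e3 : wkbRoot (1 / c ^ 2) = q / a / x - 1 := by
      rw [← e2]; field_simp; ring
    rw [e3]
    simp only [Nat.add_sub_cancel]
    field_simp
    ring

/-! ### The truncated Mehler sum as a function of its parameter -/

/-- The coefficient `H_j(x) H_j(y) / (2^j j!)` of the Mehler series. -/
noncomputable def mehlerCoeff (x y : ℂ) (j : ℕ) : ℂ :=
  hermiteH j x * hermiteH j y / (2 ^ j * (j.factorial : ℂ))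

/-- The truncated Mehler series. -/
noncomputable def mehlerSum (x y : ℂ) (n : ℕ) (s : ℂ) : ℂ :=
  ∑ j ∈ Finset.range n, mehlerCoeff x y j * s ^ j

/-- The exponent of the Mehler kernel `(1 - s²)^{-1/2} exp (mehlerExp x y s)`, which is the sum of
the full Mehler series. -/
noncomputable def mehlerExp (x y s : ℂ) : ℂ :=
  (2 * s * x * y - s ^ 2 * (x ^ 2 + y ^ 2)) / (1 - s ^ 2)

/-- The logarithmic derivative of the Mehler kernel `(1 - s²)^{-1/2} exp (mehlerExp x y s)`,
multiplied by `(1 - s²)²`. -/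
noncomputable def mehlerDrift (x y s : ℂ) : ℂ :=
  s * (1 - s ^ 2) + 2 * x * y * (1 + s ^ 2) - 2 * s * (x ^ 2 + y ^ 2)

/-- The boundary term produced by truncating the Mehler series; it only involves `H_n` and
`H_{n-1}`. -/
noncomputable def mehlerBoundary (x y : ℂ) (n : ℕ) (s : ℂ) : ℂ :=
  (-(1 - s ^ 2) * (hermiteH n x * hermiteH n y)
    + 2 * s * (x * hermiteH n x * hermiteH (n - 1) y + y * hermiteH (n - 1) x * hermiteH n y)
    - 2 * s ^ 2 * (x * hermiteH (n - 1) x * hermiteH n y + y * hermiteH n x * hermiteH (n - 1) y)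
    - 2 * n * s * (1 - s ^ 2) * (hermiteH (n - 1) x * hermiteH (n - 1) y)) /
      (2 ^ n * (n.factorial : ℂ))

/-- The first-order equation of the Mehler kernel, for the truncated series. -/
lemma mehlerSum_ode (x y s : ℂ) (n : ℕ) :
    (1 - s ^ 2) ^ 2 * ∑ j ∈ Finset.range n, mehlerCoeff x y j * (j * s ^ (j - 1)) =
      mehlerDrift x y s * mehlerSum x y n s + n * s ^ (n - 1) * mehlerBoundary x y n s := by
  induction n with
  | zero => simp [mehlerSum]
  | succ n ih =>
    rw [Finset.sum_range_succ, mul_add, ih, mehlerSum, mehlerSum, Finset.sum_range_succ]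
    have key : n * s ^ (n - 1) * mehlerBoundary x y n s +
        (1 - s ^ 2) ^ 2 * (mehlerCoeff x y n * (n * s ^ (n - 1))) =
        mehlerDrift x y s * (mehlerCoeff x y n * s ^ n) +
        (n + 1 : ℕ) * s ^ (n + 1 - 1) * mehlerBoundary x y (n + 1) s := by
      cases n with
      | zero =>
        simp [mehlerBoundary, mehlerCoeff, mehlerDrift, hermiteH_zero, hermiteH_one]
        ring
      | succ k =>
        have hk : ((k.factorial : ℕ) : ℂ) ≠ 0 := by exact_mod_cast k.factorial_ne_zero
        have hk1 : ((k : ℂ) + 1) ≠ 0 := by exact_mod_cast k.succ_ne_zero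
        have hk2 : ((k : ℂ) + 1 + 1) ≠ 0 := by exact_mod_cast (k + 1).succ_ne_zero
        simp only [mehlerBoundary, mehlerCoeff, mehlerDrift, Nat.add_sub_cancel,
          hermiteH_succ_succ, Nat.factorial_succ]
        push_cast
        field_simp
        ring
    linear_combination key

lemma hasDerivAt_mehlerSum (x y s : ℂ) (n : ℕ) :
    HasDerivAt (mehlerSum x y n)
      (∑ j ∈ Finset.range n, mehlerCoeff x y j * (j * s ^ (j - 1))) s :=
  HasDerivAt.fun_sum fun j _ => (hasDerivAt_pow j s).const_mul _

lemma hasDerivAt_mehlerExp (x y : ℂ) {s : ℂ} (hs : 1 - s ^ 2 ≠ 0) :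
    HasDerivAt (mehlerExp x y)
      ((2 * x * y * (1 + s ^ 2) - 2 * s * (x ^ 2 + y ^ 2)) / (1 - s ^ 2) ^ 2) s := by
  have h1 : HasDerivAt (fun s : ℂ => 2 * s * x * y - s ^ 2 * (x ^ 2 + y ^ 2))
      (2 * x * y - 2 * s * (x ^ 2 + y ^ 2)) s := by
    have := (((hasDerivAt_id s).const_mul 2).mul_const x).mul_const y |>.sub
      ((hasDerivAt_pow 2 s).mul_const (x ^ 2 + y ^ 2))
    refine this.congr_deriv ?_
    simp
  have h2 : HasDerivAt (fun s : ℂ => 1 - s ^ 2) (-(2 * s)) s := by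
    refine ((hasDerivAt_pow 2 s).const_sub 1).congr_deriv ?_
    simp
  refine (h1.div h2 hs).congr_deriv ?_
  field_simp
  ring

/-- The reciprocal of the Mehler kernel. -/
noncomputable def mehlerInv (x y : ℂ) (s : ℝ) : ℂ :=
  ((Real.sqrt (1 - s ^ 2) : ℝ) : ℂ) * exp (-mehlerExp x y s)

lemma one_sub_sq_ofReal_ne_zero {s : ℝ} (hs : 0 < 1 - s ^ 2) : 1 - (s : ℂ) ^ 2 ≠ 0 := by
  exact_mod_cast hs.ne'

lemma hasDerivAt_mehlerInv (x y : ℂ) {s : ℝ} (hs : 0 < 1 - s ^ 2) :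
    HasDerivAt (mehlerInv x y)
      (-(mehlerDrift x y s / (1 - (s : ℂ) ^ 2) ^ 2) * mehlerInv x y s) s := by
  have hs' := one_sub_sq_ofReal_ne_zero hs
  have h1 : HasDerivAt (fun s : ℝ => Real.sqrt (1 - s ^ 2)) (-s / Real.sqrt (1 - s ^ 2)) s := by
    have h := ((hasDerivAt_pow 2 s).const_sub 1).sqrt hs.ne'
    refine h.congr_deriv ?_
    have := (Real.sqrt_pos.2 hs).ne'
    field_simp
    push_cast
    ring
  have h2 := ((hasDerivAt_mehlerExp x y hs').neg.cexp).comp_ofReal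
  refine (h1.ofReal_comp.mul h2).congr_deriv ?_
  have h3 : ((Real.sqrt (1 - s ^ 2) : ℝ) : ℂ) ^ 2 = 1 - (s : ℂ) ^ 2 := by
    rw [← ofReal_pow, Real.sq_sqrt hs.le]; push_cast; ring
  have h4 : ((Real.sqrt (1 - s ^ 2) : ℝ) : ℂ) ≠ 0 := by
    exact_mod_cast (Real.sqrt_pos.2 hs).ne'
  simp only [mehlerInv, mehlerDrift, Pi.neg_apply]
  push_cast
  generalize exp (-mehlerExp x y s) = e
  generalize ((Real.sqrt (1 - s ^ 2) : ℝ) : ℂ) = r at *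
  rw [← h3]
  field_simp
  ring

lemma hasDerivAt_mehlerSum_mul_mehlerInv (x y : ℂ) (n : ℕ) {s : ℝ} (hs : 0 < 1 - s ^ 2) :
    HasDerivAt (fun s : ℝ => mehlerSum x y n s * mehlerInv x y s)
      (n * (s : ℂ) ^ (n - 1) * mehlerBoundary x y n s / (1 - (s : ℂ) ^ 2) ^ 2 *
        mehlerInv x y s) s := by
  have hs' := one_sub_sq_ofReal_ne_zero hs
  refine ((hasDerivAt_mehlerSum x y s n).comp_ofReal.mul
    (hasDerivAt_mehlerInv x y hs)).congr_deriv ?_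
  have h := mehlerSum_ode x y s n
  generalize ∑ j ∈ Finset.range n, mehlerCoeff x y j * (j * (s : ℂ) ^ (j - 1)) = T at h ⊢
  field_simp
  linear_combination h * mehlerInv x y s

/-! ### The saddle points of the Mehler exponent -/

/-- The quartic whose roots `e^{±u±v}` are the stationary points in `s` of
`log s - mehlerExp x y s / n` to leading order, for `x = √(2n) cosh u` and `y = √(2n) cosh v`, in terms of
`a = e^{-u}` and `b = e^{-v}`. -/
noncomputable def saddlePoly (a b s : ℂ) : ℂ :=
  (s - a * b) * (s - (a * b)⁻¹) * (s - a / b) * (s - b / a)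

lemma saddlePoly_eq {a b : ℂ} (ha : a ≠ 0) (hb : b ≠ 0) (s : ℂ) :
    saddlePoly a b s = (1 - s ^ 2) ^ 2 - 4 * joukowski a * joukowski b * s * (1 + s ^ 2) +
      4 * s ^ 2 * (joukowski a ^ 2 + joukowski b ^ 2) := by
  rw [saddlePoly, joukowski, joukowski]
  field_simp
  ring

/-- The profile by which the truncated sum differs from its first omitted term. -/
noncomputable def edgeFactor (a b s : ℂ) : ℂ := a * b / (s - a * b)

lemma hasDerivAt_edgeFactor (a b : ℂ) {s : ℂ} (hs : s - a * b ≠ 0) :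
    HasDerivAt (edgeFactor a b) (-(a * b) / (s - a * b) ^ 2) s := by
  refine ((hasDerivAt_const s (a * b)).div ((hasDerivAt_id s).sub_const (a * b)) hs).congr_deriv ?_
  simp

/-- The boundary term with `√(2n) H_{n-1} / H_n` replaced by free parameters `β`, `γ`. -/
noncomputable def boundarySymbol (c d β γ s : ℂ) : ℂ :=
  -(1 - s ^ 2) + 2 * s * (c * γ + d * β) - 2 * s ^ 2 * (c * β + d * γ) - s * (1 - s ^ 2) * (β * γ)

/-- At the limiting values of the ratios three of the four saddle factors cancel, which makes
`edgeFactor` the leading profile. -/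
lemma boundarySymbol_eq {a b : ℂ} (ha : a ≠ 0) (hb : b ≠ 0) {s : ℂ} (hs : s - a * b ≠ 0) :
    boundarySymbol (joukowski a) (joukowski b) a b s = edgeFactor a b s * saddlePoly a b s := by
  rw [boundarySymbol, edgeFactor, saddlePoly, joukowski, joukowski]
  field_simp
  ring

lemma mehlerBoundary_eq {x y q c d : ℂ} {n : ℕ} (hq : q ^ 2 = 2 * n)
    (hx : x = q * c) (hy : y = q * d) (hHx : hermiteH n x ≠ 0) (hHy : hermiteH n y ≠ 0) (s : ℂ) :
    mehlerBoundary x y n s = mehlerCoeff x y n * boundarySymbol c d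
      (q * hermiteH (n - 1) x / hermiteH n x) (q * hermiteH (n - 1) y / hermiteH n y) s := by
  have hf : ((n.factorial : ℕ) : ℂ) ≠ 0 := by exact_mod_cast n.factorial_ne_zero
  rw [mehlerBoundary, mehlerCoeff, boundarySymbol, ← hq]
  generalize hermiteH n x = A at *
  generalize hermiteH n y = B at *
  rw [hx, hy]
  field_simp

/-- A relative error `ε` in the ratios changes the boundary symbol by `O(ε)`. -/
lemma norm_boundarySymbol_sub_le {a b c d δ ε' : ℂ} {s ε R : ℝ} (ha : ‖a‖ ≤ 1) (hb : ‖b‖ ≤ 1)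
    (hc : ‖c‖ ≤ R) (hd : ‖d‖ ≤ R) (hδ : ‖δ‖ ≤ ε) (hε' : ‖ε'‖ ≤ ε) (hε : ε ≤ 1) (hs0 : 0 ≤ s)
    (hs : s ≤ 1) :
    ‖boundarySymbol c d (a * (1 + δ)) (b * (1 + ε')) s - boundarySymbol c d a b s‖ ≤
      (8 * R + 3) * ε := by
  have hR : 0 ≤ R := (norm_nonneg _).trans hc
  have hε0 : 0 ≤ ε := (norm_nonneg _).trans hδ
  have hsn : ‖(s : ℂ)‖ ≤ 1 := by rw [norm_real, Real.norm_of_nonneg hs0]; exact hs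
  have hs2 : ‖(1 : ℂ) - (s : ℂ) ^ 2‖ ≤ 1 := by
    have : (1 : ℂ) - (s : ℂ) ^ 2 = ((1 - s ^ 2 : ℝ) : ℂ) := by push_cast; ring
    rw [this, norm_real, Real.norm_of_nonneg (by nlinarith)]
    nlinarith
  have e : boundarySymbol c d (a * (1 + δ)) (b * (1 + ε')) s - boundarySymbol c d a b s =
      2 * s * (c * (b * ε')) + 2 * s * (d * (a * δ)) - 2 * s ^ 2 * (c * (a * δ)) -
      2 * s ^ 2 * (d * (b * ε')) - s * (1 - s ^ 2) * (a * b) * (δ + ε' + δ * ε') := by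
    rw [boundarySymbol, boundarySymbol]; ring
  have hm : ∀ p q r : ℂ, ‖p‖ ≤ R → ‖q‖ ≤ 1 → ‖r‖ ≤ ε → ‖p * (q * r)‖ ≤ R * (1 * ε) := by
    intro p q r hp hq hr
    rw [norm_mul, norm_mul]; gcongr
  have h2 : ‖2 * (s : ℂ)‖ ≤ 2 * 1 := by
    rw [norm_mul, show ‖(2 : ℂ)‖ = 2 by simp]; gcongr
  have h3 : ‖2 * (s : ℂ) ^ 2‖ ≤ 2 * 1 ^ 2 := by
    rw [norm_mul, norm_pow, show ‖(2 : ℂ)‖ = 2 by simp]; gcongr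
  have t1 := hm _ _ _ hc hb hε'
  have t2 := hm _ _ _ hd ha hδ
  have t3 := hm _ _ _ hc ha hδ
  have t4 := hm _ _ _ hd hb hε'
  have t5 : ‖δ + ε' + δ * ε'‖ ≤ 3 * ε := by
    refine (norm_add₃_le).trans ?_
    rw [norm_mul]
    nlinarith [norm_nonneg δ, norm_nonneg ε', mul_le_mul hδ hε' (norm_nonneg _) hε0]
  rw [e]
  calc _ ≤ ‖2 * (s : ℂ) * (c * (b * ε'))‖ + ‖2 * (s : ℂ) * (d * (a * δ))‖ +
        ‖2 * (s : ℂ) ^ 2 * (c * (a * δ))‖ + ‖2 * (s : ℂ) ^ 2 * (d * (b * ε'))‖ +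
        ‖(s : ℂ) * (1 - (s : ℂ) ^ 2) * (a * b) * (δ + ε' + δ * ε')‖ := by
        refine (norm_sub_le _ _).trans (add_le_add_left ?_ _)
        refine (norm_sub_le _ _).trans (add_le_add_left ?_ _)
        refine (norm_sub_le _ _).trans (add_le_add_left ?_ _)
        exact norm_add_le _ _
    _ ≤ 2 * 1 * (R * (1 * ε)) + 2 * 1 * (R * (1 * ε)) + 2 * 1 ^ 2 * (R * (1 * ε)) +
        2 * 1 ^ 2 * (R * (1 * ε)) + 1 * 1 * (1 * 1) * (3 * ε) := by
        simp only [norm_mul (_ * _) _, norm_mul (s : ℂ) _, norm_mul a b]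
        gcongr
    _ = _ := by ring

/-! ### Comparison of the truncated Mehler sum with its edge profile -/

/-- The Mehler drift in terms of `saddlePoly`, up to the contribution of the factor
`(1 - s²)^{-1/2}`. -/
lemma mehlerDrift_eq {a b x y q s : ℂ} {n : ℕ} (ha : a ≠ 0) (hb : b ≠ 0) (hq : q ^ 2 = 2 * n)
    (hx : x = q * joukowski a) (hy : y = q * joukowski b) :
    s * mehlerDrift x y s = s ^ 2 * (1 - s ^ 2) + n * ((1 - s ^ 2) ^ 2 - saddlePoly a b s) := by
  rw [saddlePoly_eq ha hb, mehlerDrift, hx, hy]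
  linear_combination (2 * s * joukowski a * joukowski b * (1 + s ^ 2) -
    2 * s ^ 2 * (joukowski a ^ 2 + joukowski b ^ 2)) * hq

lemma hasDerivAt_pow_mul_exp_neg_mehlerExp_re {a b x y q : ℂ} {n : ℕ} (hn : n ≠ 0) (ha : a ≠ 0)
    (hb : b ≠ 0) (hq : q ^ 2 = 2 * n) (hx : x = q * joukowski a) (hy : y = q * joukowski b)
    {s : ℝ} (hs : 0 < 1 - s ^ 2) :
    HasDerivAt (fun s : ℝ => s ^ n * Real.exp (-(mehlerExp x y s).re))
      (n * s ^ (n - 1) * Real.exp (-(mehlerExp x y s).re) *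
        ((saddlePoly a b s).re / (1 - s ^ 2) ^ 2)) s := by
  have hs' := one_sub_sq_ofReal_ne_zero hs
  have h1 : HasDerivAt (fun s : ℝ => (mehlerExp x y s).re)
      ((2 * x * y * (1 + (s : ℂ) ^ 2) - 2 * s * (x ^ 2 + y ^ 2)) / (1 - (s : ℂ) ^ 2) ^ 2).re s :=
    reCLM.hasFDerivAt.comp_hasDerivAt s (hasDerivAt_mehlerExp x y hs').comp_ofReal
  refine ((hasDerivAt_pow n s).mul h1.neg.exp).congr_deriv ?_
  obtain ⟨k, rfl⟩ : ∃ k, n = k + 1 := ⟨n - 1, by omega⟩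
  have h2 := mehlerDrift_eq (s := s) ha hb hq hx hy
  rw [mehlerDrift] at h2
  have h3 : s * ((2 * x * y * (1 + (s : ℂ) ^ 2) - 2 * s * (x ^ 2 + y ^ 2)) /
      (1 - (s : ℂ) ^ 2) ^ 2).re =
      ((k + 1 : ℕ) : ℝ) * (1 - (saddlePoly a b s).re / (1 - s ^ 2) ^ 2) := by
    rw [← re_ofReal_mul, ← mul_div_assoc]
    have h4 : (s : ℂ) * (2 * x * y * (1 + (s : ℂ) ^ 2) - 2 * s * (x ^ 2 + y ^ 2)) =
        ((k + 1 : ℕ) : ℂ) * ((1 - (s : ℂ) ^ 2) ^ 2 - saddlePoly a b s) := by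
      linear_combination h2
    have h5 : ((k + 1 : ℕ) : ℂ) * ((1 - (s : ℂ) ^ 2) ^ 2 - saddlePoly a b s) /
        (1 - (s : ℂ) ^ 2) ^ 2 = (((k + 1 : ℕ) : ℝ) : ℂ) *
          (1 - saddlePoly a b s / (((1 - s ^ 2) ^ 2 : ℝ) : ℂ)) := by
      push_cast
      field_simp
    rw [h4, h5, re_ofReal_mul, sub_re, one_re, div_ofReal_re]
  simp only [Nat.add_sub_cancel]
  rw [pow_succ]
  rw [Pi.neg_apply]
  linear_combination (-s ^ k * Real.exp (-(mehlerExp x y s).re)) * h3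

lemma norm_mehlerInv {x y : ℂ} {s : ℝ} :
    ‖mehlerInv x y s‖ = Real.sqrt (1 - s ^ 2) * Real.exp (-(mehlerExp x y s).re) := by
  rw [mehlerInv, norm_mul, norm_real, Real.norm_of_nonneg (Real.sqrt_nonneg _), norm_exp, neg_re]

/-- Comparison of the truncated Mehler sum with its edge profile. Both sides are divided by the
Mehler kernel and differentiated in the Mehler parameter along `[0, τ]`; the derivatives agree to
leading order, and the remainder is dominated by the derivative of
`s ^ n * exp (-Re mehlerExp)` because the real part of `saddlePoly` stays positive. -/
theorem norm_mehlerSum_sub_le {τ c₀ κ R C₁ : ℝ} (hτ0 : 0 < τ) (hτ1 : τ < 1) (hc₀ : 0 < c₀)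
    (hκ : 0 < κ) (hC₁ : 0 ≤ C₁) {n : ℕ} (hn : n ≠ 0) (hn1 : C₁ / n ≤ 1) {a b x y q δ ε : ℂ}
    (ha0 : a ≠ 0) (hb0 : b ≠ 0) (ha : ‖a‖ ≤ 1) (hb : ‖b‖ ≤ 1) (hja : ‖joukowski a‖ ≤ R)
    (hjb : ‖joukowski b‖ ≤ R) (hq : q ^ 2 = 2 * n) (hx : x = q * joukowski a)
    (hy : y = q * joukowski b) (hHx : hermiteH n x ≠ 0) (hHy : hermiteH n y ≠ 0)
    (hδ : ‖δ‖ ≤ C₁ / n) (hε : ‖ε‖ ≤ C₁ / n)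
    (hrx : q * hermiteH (n - 1) x / hermiteH n x = a * (1 + δ))
    (hry : q * hermiteH (n - 1) y / hermiteH n y = b * (1 + ε))
    (hsad : ∀ s ∈ Icc 0 τ, c₀ ≤ (saddlePoly a b (s : ℝ)).re)
    (hdist : ∀ s ∈ Icc 0 τ, κ ≤ ‖((s : ℝ) : ℂ) - a * b‖) :
    ‖mehlerSum x y n τ * mehlerInv x y τ -
        mehlerCoeff x y n * τ ^ n * mehlerInv x y τ * edgeFactor a b τ‖ ≤
      1 + (C₁ * (8 * R + 3) / (1 - τ ^ 2) ^ 2 + 1 / κ / (1 - τ ^ 2) + 1 / κ ^ 2) / c₀ / n *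
        (‖mehlerCoeff x y n‖ * (τ ^ n * Real.exp (-(mehlerExp x y τ).re))) := by
  have hR : 0 ≤ R := (norm_nonneg _).trans hja
  have hn0 : (0 : ℝ) < n := by exact_mod_cast Nat.pos_of_ne_zero hn
  have hτ2 : 0 < 1 - τ ^ 2 := by nlinarith
  set K : ℝ := C₁ * (8 * R + 3) / (1 - τ ^ 2) ^ 2 + 1 / κ / (1 - τ ^ 2) + 1 / κ ^ 2 with hK
  have hK0 : 0 ≤ K := by positivity
  have hs2 : ∀ s ∈ Icc 0 τ, 1 - τ ^ 2 ≤ 1 - s ^ 2 := by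
    intro s hs; nlinarith [hs.1, hs.2]
  have hs2' : ∀ s ∈ Icc 0 τ, 0 < 1 - s ^ 2 := fun s hs => hτ2.trans_le (hs2 s hs)
  obtain ⟨k, rfl⟩ : ∃ k, n = k + 1 := ⟨n - 1, by omega⟩
  have hkf : ∀ s ∈ Icc 0 τ, ((s : ℝ) : ℂ) - a * b ≠ 0 := fun s hs =>
    norm_pos_iff.1 (hκ.trans_le (hdist s hs))
  set p := mehlerCoeff x y (k + 1) with hp
  -- the derivative of the difference: the terms of order `n` cancel by `boundarySymbol_eq`, except
  -- for the effect of the ratio errors `δ`, `ε`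
  set D' : ℝ → ℂ := fun s => p * mehlerInv x y s * (s : ℂ) ^ k *
    ((k + 1 : ℕ) * (boundarySymbol (joukowski a) (joukowski b) (a * (1 + δ)) (b * (1 + ε)) s -
      boundarySymbol (joukowski a) (joukowski b) a b s) / (1 - (s : ℂ) ^ 2) ^ 2 +
      edgeFactor a b s * (s ^ 2 / (1 - (s : ℂ) ^ 2)) - s * (-(a * b) / (s - a * b) ^ 2)) with hD'
  have hder : ∀ s ∈ Icc 0 τ, HasDerivAt (fun s : ℝ => mehlerSum x y (k + 1) s * mehlerInv x y s -
      p * (s : ℂ) ^ (k + 1) * mehlerInv x y s * edgeFactor a b s) (D' s) s := by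
    intro s hs
    have h1 := hasDerivAt_mehlerSum_mul_mehlerInv x y (k + 1) (hs2' s hs)
    have h2 := (((hasDerivAt_pow (k + 1) (s : ℂ)).const_mul p).comp_ofReal.mul
      (hasDerivAt_mehlerInv x y (hs2' s hs))).mul (hasDerivAt_edgeFactor a b (hkf s hs)).comp_ofReal
    refine (h1.sub h2).congr_deriv ?_
    rw [mehlerBoundary_eq hq hx hy hHx hHy, hrx, hry]
    have h3 := mehlerDrift_eq (s := s) ha0 hb0 hq hx hy
    have h4 := boundarySymbol_eq ha0 hb0 (hkf s hs)
    have h5 := one_sub_sq_ofReal_ne_zero (hs2' s hs)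
    have h6 := hkf s hs
    simp only [hD', h4, Nat.add_sub_cancel, Pi.mul_apply, ← hp]
    generalize boundarySymbol (joukowski a) (joukowski b) (a * (1 + δ)) (b * (1 + ε)) s = w
    generalize mehlerInv x y s = W
    generalize edgeFactor a b s = f
    generalize saddlePoly a b s = P at h3 ⊢
    generalize ((k + 1 : ℕ) : ℂ) = N at h3 ⊢
    generalize mehlerDrift x y s = G at h3 ⊢
    rw [pow_succ]
    generalize (-(a * b) / ((s : ℂ) - a * b) ^ 2) = e
    have h7 : (s : ℂ) ^ 2 / (1 - (s : ℂ) ^ 2) =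
        s ^ 2 * (1 - (s : ℂ) ^ 2) / (1 - (s : ℂ) ^ 2) ^ 2 := by field_simp
    have h8 : N = N * (1 - (s : ℂ) ^ 2) ^ 2 / (1 - (s : ℂ) ^ 2) ^ 2 := by field_simp
    rw [h7]
    linear_combination (p * W * s ^ k * f / (1 - (s : ℂ) ^ 2) ^ 2) * h3 - (p * W * s ^ k * f) * h8
  have hbound : ∀ s ∈ Icc 0 τ, ‖D' s‖ ≤ K * ‖p‖ * (s ^ k * Real.exp (-(mehlerExp x y s).re)) := by
    intro s hs
    have h1 := hs2 s hs
    have h1' := hs2' s hs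
    have hs1 : s ≤ 1 := hs.2.trans hτ1.le
    have hW : ‖mehlerInv x y s‖ ≤ Real.exp (-(mehlerExp x y s).re) := by
      rw [norm_mehlerInv]
      refine mul_le_of_le_one_left (Real.exp_pos _).le ?_
      rw [Real.sqrt_le_one]; nlinarith [hs.1]
    have hsn : ‖(s : ℂ)‖ = s := by rw [norm_real, Real.norm_of_nonneg hs.1]
    have h2 : ‖(1 : ℂ) - (s : ℂ) ^ 2‖ = 1 - s ^ 2 := by
      have : (1 : ℂ) - (s : ℂ) ^ 2 = ((1 - s ^ 2 : ℝ) : ℂ) := by push_cast; ring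
      rw [this, norm_real, Real.norm_of_nonneg h1'.le]
    have h3 := norm_boundarySymbol_sub_le ha hb hja hjb hδ hε hn1 hs.1 hs1
    have hab : ‖a * b‖ ≤ 1 := by rw [norm_mul]; exact mul_le_one₀ ha (norm_nonneg _) hb
    have hk := hdist s hs
    have t1 : ‖((k + 1 : ℕ) : ℂ) * (boundarySymbol (joukowski a) (joukowski b) (a * (1 + δ))
        (b * (1 + ε)) s - boundarySymbol (joukowski a) (joukowski b) a b s) /
          (1 - (s : ℂ) ^ 2) ^ 2‖ ≤ C₁ * (8 * R + 3) / (1 - τ ^ 2) ^ 2 := by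
      rw [norm_div, norm_mul, norm_pow, h2, Complex.norm_natCast]
      refine div_le_div₀ (by positivity) ?_ (by positivity) (by gcongr)
      calc _ ≤ ((k + 1 : ℕ) : ℝ) * ((8 * R + 3) * (C₁ / (k + 1 : ℕ))) :=
            mul_le_mul_of_nonneg_left h3 hn0.le
        _ = _ := by field_simp
    have t2 : ‖edgeFactor a b s * (s ^ 2 / (1 - (s : ℂ) ^ 2))‖ ≤ 1 / κ / (1 - τ ^ 2) := by
      rw [norm_mul, edgeFactor, norm_div, norm_div, norm_pow, h2, hsn, div_div, ← mul_one_div,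
        ← div_div, mul_one_div]
      have : s ^ 2 ≤ 1 := by nlinarith [hs.1]
      calc ‖a * b‖ / ‖(s : ℂ) - a * b‖ * (s ^ 2 / (1 - s ^ 2))
          ≤ 1 / κ * (1 / (1 - τ ^ 2)) := by gcongr
        _ = _ := by ring
    have t3 : ‖(s : ℂ) * (-(a * b) / (s - a * b) ^ 2)‖ ≤ 1 / κ ^ 2 := by
      rw [norm_mul, norm_div, norm_pow, norm_neg, hsn]
      calc s * (‖a * b‖ / ‖(s : ℂ) - a * b‖ ^ 2) ≤ 1 * (1 / κ ^ 2) := by gcongr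
        _ = _ := by ring
    have t4 := (norm_sub_le _ _).trans (add_le_add ((norm_add_le _ _).trans (add_le_add t1 t2)) t3)
    simp only [hD']
    rw [norm_mul, norm_mul, norm_mul, norm_pow, hsn]
    calc _ ≤ ‖p‖ * Real.exp (-(mehlerExp x y s).re) * s ^ k * K := by
          have := pow_nonneg hs.1 k
          gcongr
      _ = _ := by ring
  set L : ℝ := K / c₀ / (k + 1 : ℕ) * ‖p‖ with hL
  have hL0 : 0 ≤ L := by positivity
  have hB : ∀ s ∈ Icc 0 τ, HasDerivAt
      (fun s : ℝ => 1 + L * (s ^ (k + 1) * Real.exp (-(mehlerExp x y s).re)))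
      (L * ((k + 1 : ℕ) * s ^ (k + 1 - 1) * Real.exp (-(mehlerExp x y s).re) *
        ((saddlePoly a b s).re / (1 - s ^ 2) ^ 2))) s := fun s hs =>
    ((hasDerivAt_pow_mul_exp_neg_mehlerExp_re hn ha0 hb0 hq hx hy (hs2' s hs)).const_mul
      L).const_add 1
  have key := image_norm_le_of_norm_deriv_right_le_deriv_boundary'
    (fun s hs => (hder s hs).continuousAt.continuousWithinAt)
    (fun s hs => (hder s (Ico_subset_Icc_self hs)).hasDerivWithinAt) ?_
    (fun s hs => (hB s hs).continuousAt.continuousWithinAt)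
    (fun s hs => (hB s (Ico_subset_Icc_self hs)).hasDerivWithinAt) ?_
    (right_mem_Icc.2 hτ0.le)
  · refine key.trans (le_of_eq ?_)
    rw [hL]; ring
  · simp [mehlerSum, mehlerInv, mehlerExp, mehlerCoeff, Finset.sum_range_succ', hermiteH_zero]
  · intro s hs
    have hs' := Ico_subset_Icc_self hs
    refine (hbound s hs').trans ?_
    have h1 : c₀ ≤ (saddlePoly a b s).re / (1 - s ^ 2) ^ 2 := by
      have h2 := hs2' s hs'
      rw [le_div_iff₀ (by positivity)]
      have : (1 - s ^ 2) ^ 2 ≤ 1 := by nlinarith [hs.1]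
      nlinarith [hsad s hs']
    have h3 := pow_nonneg hs.1 k
    rw [Nat.add_sub_cancel, hL]
    calc K * ‖p‖ * (s ^ k * Real.exp (-(mehlerExp x y s).re))
        = K / c₀ / (k + 1 : ℕ) * ‖p‖ * ((k + 1 : ℕ) * s ^ k *
          Real.exp (-(mehlerExp x y s).re) * c₀) := by field_simp
      _ ≤ _ := by gcongr

/-! ### Stirling's formula with an error term -/

/-- The Stirling approximation `√(2πn) (n / e)ⁿ`. -/
noncomputable def stirlingApprox (n : ℕ) : ℝ := Real.sqrt (2 * Real.pi * n) * (n / Real.exp 1) ^ n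

lemma stirlingApprox_pos {n : ℕ} (hn : n ≠ 0) : 0 < stirlingApprox n := by
  have : (0 : ℝ) < n := by exact_mod_cast Nat.pos_of_ne_zero hn
  have := Real.pi_pos
  unfold stirlingApprox
  positivity

lemma log_stirlingSeq_succ_le (n : ℕ) :
    Real.log (Stirling.stirlingSeq (n + 1)) ≤
      Real.log (Real.sqrt Real.pi) + 1 / (12 * ((n : ℝ) + 1)) := by
  have hmono : Monotone fun k : ℕ =>
      Real.log (Stirling.stirlingSeq (k + 1)) - 1 / (12 * ((k : ℝ) + 1)) := by
    refine monotone_nat_of_le_succ fun k => ?_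
    have h := Stirling.log_stirlingSeq_sdiff_le (k + 1)
    have e : 1 / (12 * ((k + 1 : ℕ) : ℝ) * (((k + 1 : ℕ) : ℝ) + 1)) =
        1 / (12 * ((k : ℝ) + 1)) - 1 / (12 * (((k + 1 : ℕ) : ℝ) + 1)) := by
      push_cast; field_simp; ring
    linarith
  have hlim : Tendsto (fun k : ℕ =>
      Real.log (Stirling.stirlingSeq (k + 1)) - 1 / (12 * ((k : ℝ) + 1))) atTop
      (𝓝 (Real.log (Real.sqrt Real.pi) - 0)) := by
    refine Tendsto.sub ?_ ?_
    · exact ((Real.continuousAt_log (Real.sqrt_pos.2 Real.pi_pos).ne').tendsto.comp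
        Stirling.tendsto_stirlingSeq_sqrt_pi).comp (tendsto_add_atTop_nat 1)
    · have := (tendsto_one_div_add_atTop_nhds_zero_nat (𝕜 := ℝ)).const_mul (1 / 12)
      rw [mul_zero] at this
      refine this.congr fun k => ?_
      field_simp
  have := hmono.ge_of_tendsto hlim n
  linarith

lemma abs_factorial_div_stirlingApprox_sub_one_le {n : ℕ} (hn : n ≠ 0) :
    |(n.factorial : ℝ) / stirlingApprox n - 1| ≤ 1 / n := by
  have h1 := stirlingApprox_pos hn
  have hn0 : (1 : ℝ) ≤ n := by exact_mod_cast Nat.one_le_iff_ne_zero.2 hn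
  have h2 : (n.factorial : ℝ) / stirlingApprox n = Stirling.stirlingSeq n / Real.sqrt Real.pi := by
    rw [stirlingApprox, Stirling.stirlingSeq, show 2 * Real.pi * n = Real.pi * (2 * n) by ring,
      Real.sqrt_mul Real.pi_pos.le, div_div]
    ring
  have hπ := Real.sqrt_pos.2 Real.pi_pos
  have h3 : 1 ≤ Stirling.stirlingSeq n / Real.sqrt Real.pi := by
    rw [one_le_div hπ]; exact Stirling.sqrt_pi_le_stirlingSeq hn
  rw [h2, abs_of_nonneg (by linarith)]
  obtain ⟨k, rfl⟩ : ∃ k, n = k + 1 := ⟨n - 1, by omega⟩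
  have h4 := log_stirlingSeq_succ_le k
  have h5 := Stirling.stirlingSeq'_pos k
  have h6 : Stirling.stirlingSeq (k + 1) / Real.sqrt Real.pi ≤
      Real.exp (1 / (12 * ((k : ℝ) + 1))) := by
    rw [← Real.log_le_iff_le_exp (by positivity), Real.log_div h5.ne' hπ.ne']
    linarith
  have h7 : |1 / (12 * ((k : ℝ) + 1))| ≤ 1 := by
    rw [abs_of_nonneg (by positivity), div_le_one (by positivity)]
    push_cast at hn0; linarith
  have h8 := Real.abs_exp_sub_one_le h7
  rw [abs_of_nonneg (by positivity : (0:ℝ) ≤ 1 / (12 * ((k : ℝ) + 1)))] at h8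
  have h9 := le_abs_self (Real.exp (1 / (12 * ((k : ℝ) + 1))) - 1)
  have h10 : 2 * (1 / (12 * ((k : ℝ) + 1))) ≤ 1 / ((k + 1 : ℕ) : ℝ) := by
    push_cast
    rw [show 2 * (1 / (12 * ((k : ℝ) + 1))) = 1 / 6 * (1 / ((k : ℝ) + 1)) by field_simp; ring]
    have : 0 ≤ 1 / ((k : ℝ) + 1) := by positivity
    linarith
  linarith

/-! ### The edge of the ellipse -/

lemma inv_eq_conj_div {a : ℂ} {t : ℝ} (ha : ‖a‖ ^ 2 = t) :
    a⁻¹ = ((a.re / t : ℝ) : ℂ) - ((a.im / t : ℝ) : ℂ) * I := by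
  rw [Complex.sq_norm] at ha
  apply Complex.ext <;> simp [inv_re, inv_im, ha, neg_div]

/-- At two edge points that are not conjugate to each other (in the variables `a`, `b`), the real
part of `saddlePoly` is positive along the whole path of integration. -/
lemma saddlePoly_re_pos {τ : ℝ} (hτ0 : 0 < τ) (hτ1 : τ < 1) {a b : ℂ} (ha : ‖a‖ ^ 2 = τ)
    (hb : ‖b‖ ^ 2 = τ) (hab : a * b ≠ τ) {s : ℝ} (hs0 : 0 ≤ s) (hs : s ≤ τ) :
    0 < (saddlePoly a b s).re := by
  have ha0 : a ≠ 0 := by rintro rfl; simp at ha; linarith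
  have hb0 : b ≠ 0 := by rintro rfl; simp at hb; linarith
  set w := a * b with hw
  set v := a / b with hv
  have hw0 : w ≠ 0 := mul_ne_zero ha0 hb0
  have hv0 : v ≠ 0 := div_ne_zero ha0 hb0
  have hwn : ‖w‖ ^ 2 = τ ^ 2 := by rw [hw, norm_mul, mul_pow, ha, hb]; ring
  have hvn : ‖v‖ ^ 2 = 1 := by rw [hv, norm_div, div_pow, ha, hb, div_self hτ0.ne']
  have hfac : saddlePoly a b s = ((1 + s ^ 2 - 2 * s * v.re : ℝ) : ℂ) *
      (1 + (s : ℂ) ^ 2 - s * (w + w⁻¹)) := by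
    have h1 : v + v⁻¹ = ((2 * v.re : ℝ) : ℂ) := by
      rw [inv_eq_conj_div hvn]
      apply Complex.ext <;> simp
      ring
    have h2 : ((1 + s ^ 2 - 2 * s * v.re : ℝ) : ℂ) = 1 + (s : ℂ) ^ 2 - s * (v + v⁻¹) := by
      rw [h1]; push_cast; ring
    rw [h2, saddlePoly, ← hw, ← hv, show b / a = v⁻¹ by rw [hv, inv_div]]
    field_simp
    ring
  rw [hfac, re_ofReal_mul]
  have hvre : v.re ≤ 1 := by
    have := re_le_norm v
    nlinarith [norm_nonneg v]
  have hwn' : ‖w‖ = τ := by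
    rw [← Real.sqrt_sq (norm_nonneg w), hwn, Real.sqrt_sq hτ0.le]
  have hwre : w.re < τ := by
    refine lt_of_le_of_ne ((re_le_norm w).trans hwn'.le) fun h => hab ?_
    rw [Complex.sq_norm, normSq_apply, h] at hwn
    have : w.im = 0 := by nlinarith
    apply Complex.ext <;> simp [h, this]
  refine mul_pos (by nlinarith) ?_
  have h3 : (1 + (s : ℂ) ^ 2 - s * (w + w⁻¹)).re = 1 + s ^ 2 - s * (w.re + w.re / τ ^ 2) := by
    rw [inv_eq_conj_div hwn, sub_re, add_re, re_ofReal_mul, ← ofReal_pow, one_re, ofReal_re,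
      add_re, sub_re, ofReal_re, re_ofReal_mul, I_re, mul_zero, sub_zero]
  rw [h3]
  have h4 : 0 < τ ^ 2 * (1 + s ^ 2) - s * w.re * (τ ^ 2 + 1) := by
    rcases hs0.eq_or_lt with h | h
    · rw [← h]; nlinarith
    · have e1 : 0 ≤ τ * ((τ - s) * (1 - τ * s)) := by
        refine mul_nonneg hτ0.le (mul_nonneg (by linarith) ?_)
        nlinarith
      have e2 : 0 < s * (τ ^ 2 + 1) * (τ - w.re) :=
        mul_pos (by positivity) (by linarith)
      nlinarith
  have h5 : 1 + s ^ 2 - s * (w.re + w.re / τ ^ 2) =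
      (τ ^ 2 * (1 + s ^ 2) - s * w.re * (τ ^ 2 + 1)) / τ ^ 2 := by
    field_simp
  rw [h5]
  positivity

/-- The exponential rate of the first omitted term of the Mehler series, relative to the Mehler
kernel. -/
noncomputable def edgeRate (τ : ℝ) (a b : ℂ) : ℝ :=
  1 + Real.log τ - Real.log (‖a‖ * ‖b‖) + ((a ^ 2).re + (b ^ 2).re) / 2 -
    2 * (mehlerExp (joukowski a) (joukowski b) τ).re

/-- At the edge, the omitted terms dominate the Mehler kernel exponentially: the rate is
`2τ / (1 - τ²) * |cosh u - conj (cosh v)|²`. -/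
lemma edgeRate_pos {τ : ℝ} (hτ0 : 0 < τ) (hτ1 : τ < 1) {a b : ℂ} (ha : ‖a‖ ^ 2 = τ)
    (hb : ‖b‖ ^ 2 = τ) (hab : a * b ≠ τ) : 0 < edgeRate τ a b := by
  have hlog : Real.log (‖a‖ * ‖b‖) = Real.log τ := by
    congr 1
    have : (‖a‖ * ‖b‖) ^ 2 = τ ^ 2 := by rw [mul_pow, ha, hb]; ring
    exact (pow_left_inj₀ (by positivity) hτ0.le two_ne_zero).1 this
  have h1 : 0 < 1 - τ ^ 2 := by nlinarith
  have hA : a.re ^ 2 + a.im ^ 2 = τ := by rw [← ha, Complex.sq_norm, normSq_apply]; ring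
  have hB : b.re ^ 2 + b.im ^ 2 = τ := by rw [← hb, Complex.sq_norm, normSq_apply]; ring
  have cr : (joukowski a).re = (1 + τ) / (2 * τ) * a.re := by
    rw [joukowski, inv_eq_conj_div ha]; simp; field_simp; ring
  have ci : (joukowski a).im = -((1 - τ) / (2 * τ) * a.im) := by
    rw [joukowski, inv_eq_conj_div ha]; simp; field_simp; ring
  have dr : (joukowski b).re = (1 + τ) / (2 * τ) * b.re := by
    rw [joukowski, inv_eq_conj_div hb]; simp; field_simp; ring
  have di : (joukowski b).im = -((1 - τ) / (2 * τ) * b.im) := by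
    rw [joukowski, inv_eq_conj_div hb]; simp; field_simp; ring
  have hne : 0 < ((1 + τ) * (a.re - b.re)) ^ 2 + ((1 - τ) * (a.im + b.im)) ^ 2 := by
    by_contra h
    have e1 : ((1 + τ) * (a.re - b.re)) ^ 2 = 0 := by
      nlinarith [sq_nonneg ((1 + τ) * (a.re - b.re)), sq_nonneg ((1 - τ) * (a.im + b.im))]
    have e2 : ((1 - τ) * (a.im + b.im)) ^ 2 = 0 := by
      nlinarith [sq_nonneg ((1 + τ) * (a.re - b.re)), sq_nonneg ((1 - τ) * (a.im + b.im))]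
    have e3 : a.re - b.re = 0 := by
      rcases mul_eq_zero.1 (pow_eq_zero_iff two_ne_zero |>.1 e1) with h | h <;> linarith
    have e4 : a.im + b.im = 0 := by
      rcases mul_eq_zero.1 (pow_eq_zero_iff two_ne_zero |>.1 e2) with h | h <;> linarith
    have e5 : b.re = a.re := by linarith
    have e6 : b.im = -a.im := by linarith
    refine hab (Complex.ext ?_ ?_)
    · simp [e5, e6]; nlinarith
    · simp [e5, e6]; ring
  have hE : (mehlerExp (joukowski a) (joukowski b) τ).re =
      (2 * τ * ((joukowski a).re * (joukowski b).re - (joukowski a).im * (joukowski b).im) -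
        τ ^ 2 * ((joukowski a).re ^ 2 - (joukowski a).im ^ 2 +
          ((joukowski b).re ^ 2 - (joukowski b).im ^ 2))) / (1 - τ ^ 2) := by
    rw [mehlerExp, show (1 : ℂ) - (τ : ℂ) ^ 2 = ((1 - τ ^ 2 : ℝ) : ℂ) by push_cast; ring,
      div_ofReal_re]
    congr 1
    simp [pow_two]
    ring
  have hval : edgeRate τ a b = (((1 + τ) * (a.re - b.re)) ^ 2 +
      ((1 - τ) * (a.im + b.im)) ^ 2) / (2 * τ * (1 - τ ^ 2)) := by
    rw [edgeRate, hlog, hE, cr, ci, dr, di]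
    have ea : (a ^ 2).re = a.re ^ 2 - a.im ^ 2 := by simp [pow_two]
    have eb : (b ^ 2).re = b.re ^ 2 - b.im ^ 2 := by simp [pow_two]
    rw [ea, eb]
    field_simp
    linear_combination -(1 - τ ^ 2) * (hA + hB)
  rw [hval]
  positivity

/-! ### Edge asymptotics of the truncated Mehler sum -/

/-- The asymptotic size of the truncated Mehler sum of order `n` at `x = √(2n) cosh u`,
`y = √(2n) cosh v`, in terms of `a = exp (-u)` and `b = exp (-v)`. -/
noncomputable def mehlerSize (τ : ℝ) (n : ℕ) (a b : ℂ) : ℝ :=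
  hermiteSize n a * hermiteSize n b / (2 ^ n * stirlingApprox n) * τ ^ n * ‖edgeFactor a b τ‖

lemma mehlerExp_mul (q c d s : ℂ) : mehlerExp (q * c) (q * d) s = q ^ 2 * mehlerExp c d s := by
  rw [mehlerExp, mehlerExp]; ring

/-- The first omitted term of the Mehler series, divided by the Mehler kernel, grows at the
exponential rate `edgeRate`. -/
lemma exp_edgeRate_le {τ : ℝ} (hτ0 : 0 < τ) {n : ℕ} (hn : n ≠ 0) {a b : ℂ} (ha0 : a ≠ 0)
    (hb0 : b ≠ 0) (ha : ‖a‖ < 1) (hb : ‖b‖ < 1) :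
    Real.exp (n * edgeRate τ a b) / (6 * n) ≤
      hermiteSize n a * hermiteSize n b / (2 ^ n * stirlingApprox n) * τ ^ n *
        Real.exp (-(2 * n * (mehlerExp (joukowski a) (joukowski b) τ).re)) := by
  have hn1 : (1 : ℝ) ≤ n := by exact_mod_cast Nat.one_le_iff_ne_zero.2 hn
  have hn0 : (0 : ℝ) < n := by linarith
  have hna := norm_pos_iff.2 ha0
  have hnb := norm_pos_iff.2 hb0
  have hsa := norm_pos_iff.2 (one_sub_sq_ne_zero ha)
  have hsb := norm_pos_iff.2 (one_sub_sq_ne_zero hb)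
  have hle : ∀ c : ℂ, ‖c‖ < 1 → ‖1 - c ^ 2‖ ≤ 2 := by
    intro c hc
    refine (norm_sub_le _ _).trans ?_
    rw [norm_one, norm_pow]
    nlinarith [norm_nonneg c]
  have hπ := Real.pi_pos
  have hroot : Real.sqrt ‖1 - a ^ 2‖ * Real.sqrt ‖1 - b ^ 2‖ * Real.sqrt (2 * Real.pi * n) ≤
      6 * n := by
    rw [← Real.sqrt_mul (norm_nonneg _), ← Real.sqrt_mul (by positivity)]
    refine Real.sqrt_le_iff.2 ⟨by positivity, ?_⟩
    have := hle a ha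
    have := hle b hb
    calc ‖1 - a ^ 2‖ * ‖1 - b ^ 2‖ * (2 * Real.pi * n) ≤ 2 * 2 * (2 * 4 * n) := by
          gcongr; exact Real.pi_le_four
      _ ≤ (6 * n) ^ 2 := by nlinarith
  have hexp : Real.exp (n * edgeRate τ a b) = Real.exp 1 ^ n * τ ^ n / (‖a‖ * ‖b‖) ^ n *
      (Real.exp (n * (a ^ 2).re / 2) * Real.exp (n * (b ^ 2).re / 2)) *
      Real.exp (-(2 * n * (mehlerExp (joukowski a) (joukowski b) τ).re)) := by
    have e1 : Real.exp (n * Real.log τ) = τ ^ n := by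
      rw [Real.exp_nat_mul, Real.exp_log hτ0]
    have e2 : Real.exp (n * Real.log (‖a‖ * ‖b‖)) = (‖a‖ * ‖b‖) ^ n := by
      rw [Real.exp_nat_mul, Real.exp_log (by positivity)]
    rw [← e1, ← e2, ← Real.exp_nat_mul, ← Real.exp_add, ← Real.exp_sub, ← Real.exp_add,
      ← Real.exp_add, ← Real.exp_add]
    congr 1
    rw [edgeRate]
    ring
  have hq : Real.sqrt (2 * n) ^ n * Real.sqrt (2 * n) ^ n = 2 ^ n * n ^ n := by
    rw [← mul_pow, Real.mul_self_sqrt (by positivity), mul_pow]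
  have hid : hermiteSize n a * hermiteSize n b / (2 ^ n * stirlingApprox n) * τ ^ n *
        Real.exp (-(2 * n * (mehlerExp (joukowski a) (joukowski b) τ).re)) =
      Real.exp (n * edgeRate τ a b) /
        (Real.sqrt ‖1 - a ^ 2‖ * Real.sqrt ‖1 - b ^ 2‖ * Real.sqrt (2 * Real.pi * n)) := by
    rw [hexp, hermiteSize, hermiteSize, stirlingApprox]
    simp only [div_pow, mul_pow]
    have := Real.sqrt_pos.2 hsa
    have := Real.sqrt_pos.2 hsb
    have : 0 < Real.sqrt (2 * Real.pi * n) := by positivity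
    field_simp
    linear_combination hq
  rw [hid]
  gcongr

/-- Near a pair of edge points all quantities controlling the comparison along `[0, τ]` are
uniformly non-degenerate. -/
lemma exists_edge_bounds {τ : ℝ} (hτ0 : 0 < τ) (hτ1 : τ < 1) {a₀ b₀ : ℂ} (ha : ‖a₀‖ ^ 2 = τ)
    (hb : ‖b₀‖ ^ 2 = τ) (hab : a₀ * b₀ ≠ τ) :
    ∃ r c₀ κ lam : ℝ, 0 < r ∧ 0 < c₀ ∧ 0 < κ ∧ 0 < lam ∧
      ∀ a ∈ Metric.ball a₀ r, ∀ b ∈ Metric.ball b₀ r,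
        (∀ s ∈ Icc 0 τ, c₀ ≤ (saddlePoly a b (s : ℝ)).re) ∧
        (∀ s ∈ Icc 0 τ, κ ≤ ‖((s : ℝ) : ℂ) - a * b‖) ∧ lam ≤ edgeRate τ a b := by
  have ha0 : a₀ ≠ 0 := by rintro rfl; simp at ha; linarith
  have hb0 : b₀ ≠ 0 := by rintro rfl; simp at hb; linarith
  have hτ2 : 1 - (τ : ℂ) ^ 2 ≠ 0 := one_sub_sq_ofReal_ne_zero (by nlinarith)
  have hsc : ∀ s : ℝ, ContinuousAt (fun p : (ℂ × ℂ) × ℝ => (saddlePoly p.1.1 p.1.2 p.2).re)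
      ((a₀, b₀), s) := by
    intro s
    refine continuous_re.continuousAt.comp' ?_
    unfold saddlePoly
    have h1 : a₀ * b₀ ≠ 0 := mul_ne_zero ha0 hb0
    fun_prop (disch := simpa)
  have hdc : ∀ s : ℝ, ContinuousAt (fun p : (ℂ × ℂ) × ℝ => ‖(p.2 : ℂ) - p.1.1 * p.1.2‖)
      ((a₀, b₀), s) := by
    intro s
    fun_prop
  have hec : ContinuousAt (fun p : ℂ × ℂ => edgeRate τ p.1 p.2) (a₀, b₀) := by
    unfold edgeRate mehlerExp joukowski
    have h1 : ‖a₀‖ * ‖b₀‖ ≠ 0 := mul_ne_zero (norm_ne_zero_iff.2 ha0) (norm_ne_zero_iff.2 hb0)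
    fun_prop (disch := first | assumption | norm_num)
  have hpos : ∀ s ∈ Icc (0 : ℝ) τ, 0 < (saddlePoly a₀ b₀ s).re := fun s hs =>
    saddlePoly_re_pos hτ0 hτ1 ha hb hab hs.1 hs.2
  obtain ⟨c₀, hc₀, hc₀'⟩ := exists_pos_le_of_isCompact isCompact_Icc
    (f := fun s : ℝ => (saddlePoly a₀ b₀ s).re)
    (fun s _ => ContinuousAt.continuousWithinAt
      ((hsc s).comp' (f := fun s : ℝ => ((a₀, b₀), s)) (by fun_prop))) hpos
  obtain ⟨κ, hκ, hκ'⟩ := exists_pos_le_of_isCompact (isCompact_Icc (a := (0 : ℝ)) (b := τ))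
    (f := fun s : ℝ => ‖(s : ℂ) - a₀ * b₀‖) (by fun_prop) (fun s hs => by
      rw [norm_pos_iff]
      intro h
      have := hpos s hs
      rw [saddlePoly, h] at this
      simp at this)
  have hlam := edgeRate_pos hτ0 hτ1 ha hb hab
  have ev1 : ∀ᶠ p in 𝓝 (a₀, b₀), ∀ s ∈ Icc (0 : ℝ) τ, c₀ / 2 < (saddlePoly p.1 p.2 s).re :=
    isCompact_Icc.eventually_forall_of_forall_eventually fun s hs =>
      (hsc s).eventually (lt_mem_nhds (by linarith [hc₀' s hs] : c₀ / 2 < _))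
  have ev2 : ∀ᶠ p in 𝓝 (a₀, b₀), ∀ s ∈ Icc (0 : ℝ) τ, κ / 2 < ‖(s : ℂ) - p.1 * p.2‖ :=
    isCompact_Icc.eventually_forall_of_forall_eventually fun s hs =>
      (hdc s).eventually (lt_mem_nhds (by linarith [hκ' s hs] : κ / 2 < _))
  have ev3 : ∀ᶠ p in 𝓝 (a₀, b₀), edgeRate τ a₀ b₀ / 2 < edgeRate τ p.1 p.2 :=
    hec.eventually (lt_mem_nhds (by simp only; linarith))
  obtain ⟨r, hr, hball⟩ := Metric.eventually_nhds_iff_ball.1 (ev1.and (ev2.and ev3))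
  refine ⟨r, c₀ / 2, κ / 2, edgeRate τ a₀ b₀ / 2, hr, by linarith, by linarith, by linarith,
    fun a haB b hbB => ?_⟩
  obtain ⟨h1, h2, h3⟩ := hball (a, b) (by
    rw [← ball_prod_same]; exact ⟨haB, hbB⟩)
  exact ⟨fun s hs => (h1 s hs).le, fun s hs => (h2 s hs).le, h3.le⟩

set_option maxHeartbeats 1000000 in
/-- Edge asymptotics of the truncated Mehler sum, uniformly near a pair of non-conjugate edge
points. -/
theorem mehlerSum_asymptotics {τ : ℝ} (hτ0 : 0 < τ) (hτ1 : τ < 1) {a₀ b₀ : ℂ}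
    (ha : ‖a₀‖ ^ 2 = τ) (hb : ‖b₀‖ ^ 2 = τ) (hab : a₀ * b₀ ≠ τ) :
    ∃ r C : ℝ, 0 < r ∧ 1 ≤ C ∧ ∀ n : ℕ, C ≤ n → ∀ a ∈ Metric.ball a₀ r, ∀ b ∈ Metric.ball b₀ r,
      a ≠ 0 ∧ b ≠ 0 ∧ ‖a‖ < 1 ∧ ‖b‖ < 1 ∧ (τ : ℂ) - a * b ≠ 0 ∧
      |‖mehlerSum ((Real.sqrt (2 * n) : ℝ) * joukowski a) ((Real.sqrt (2 * n) : ℝ) * joukowski b)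
        n τ‖ / mehlerSize τ n a b - 1| ≤ C / n := by
  obtain ⟨r, c₀, κ, lam, hr, hc₀, hκ, hlam, hbd⟩ := exists_edge_bounds hτ0 hτ1 ha hb hab
  obtain ⟨t, ht⟩ : ∃ t : ℝ, t = Real.sqrt τ := ⟨_, rfl⟩
  have ht0 : 0 < t := by rw [ht]; exact Real.sqrt_pos.2 hτ0
  have ht1 : t < 1 := by rw [ht, Real.sqrt_lt' one_pos]; simpa using hτ1
  have hnorm : ∀ c : ℂ, ‖c‖ ^ 2 = τ → ‖c‖ = t := fun c hc => by
    rw [ht, ← hc, Real.sqrt_sq (norm_nonneg c)]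
  set r₁ := t / 2 with hr₁
  set r₂ := (1 + t) / 2 with hr₂
  have hr₁0 : 0 < r₁ := by positivity
  have hr₂1 : r₂ < 1 := by rw [hr₂]; linarith
  obtain ⟨C₁, hC₁, hherm⟩ := hermiteH_asymptotics hr₁0 hr₂1
  set R := (1 + 1 / r₁) / 2 with hR
  have hR0 : 0 ≤ R := by positivity
  have hτ2 : 0 < 1 - τ ^ 2 := by nlinarith
  set K := (C₁ * (8 * R + 3) / (1 - τ ^ 2) ^ 2 + 1 / κ / (1 - τ ^ 2) + 1 / κ ^ 2) / c₀ with hK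
  have hK0 : 0 ≤ K := by positivity
  have hst : 0 < Real.sqrt (1 - τ ^ 2) := Real.sqrt_pos.2 hτ2
  set K₂ := (1 + K) / (Real.sqrt (1 - τ ^ 2) * (r₁ ^ 2 / 2)) with hK₂
  have hK₂0 : 0 ≤ K₂ := by positivity
  have hl0 : 0 ≤ 72 / lam ^ 3 := by positivity
  -- `min (t / 2) ((1 - t) / 2)` keeps `a`, `b` in the annulus `r₁ ≤ |·| ≤ r₂`; the summand
  -- `72 / lam ^ 3` makes the cubic Taylor term of `exp (n * lam)` at least `12 * n ^ 2`
  refine ⟨min r (min (t / 2) ((1 - t) / 2)), 3 * (12 * C₁ + K₂) + 72 / lam ^ 3,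
    lt_min hr (lt_min (by linarith) (by linarith)), by linarith, ?_⟩
  intro n hn a haB b hbB
  have hmem : ∀ c₁ c₂ : ℂ, ‖c₁‖ = t → c₂ ∈ Metric.ball c₁ (min r (min (t / 2) ((1 - t) / 2))) →
      c₂ ∈ Metric.ball c₁ r ∧ r₁ ≤ ‖c₂‖ ∧ ‖c₂‖ ≤ r₂ := by
    intro c₁ c₂ h1 h2
    rw [Metric.mem_ball, lt_min_iff, lt_min_iff, dist_eq_norm] at h2
    have h3 := abs_le.1 (abs_norm_sub_norm_le c₂ c₁)
    refine ⟨by rw [Metric.mem_ball, dist_eq_norm]; exact h2.1, ?_, ?_⟩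
    · rw [hr₁]; linarith [h3.1]
    · rw [hr₂]; linarith [h3.2]
  obtain ⟨haB', ha1, ha2⟩ := hmem a₀ a (hnorm _ ha) haB
  obtain ⟨hbB', hb1, hb2⟩ := hmem b₀ b (hnorm _ hb) hbB
  obtain ⟨hsad, hdist, hrate⟩ := hbd a haB' b hbB'
  have ha0 : a ≠ 0 := norm_pos_iff.1 (hr₁0.trans_le ha1)
  have hb0 : b ≠ 0 := norm_pos_iff.1 (hr₁0.trans_le hb1)
  have hal : ‖a‖ < 1 := ha2.trans_lt hr₂1
  have hbl : ‖b‖ < 1 := hb2.trans_lt hr₂1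
  have hτab : (τ : ℂ) - a * b ≠ 0 :=
    norm_pos_iff.1 (hκ.trans_le (hdist τ (right_mem_Icc.2 hτ0.le)))
  refine ⟨ha0, hb0, hal, hbl, hτab, ?_⟩
  have hnC₁ : 36 * C₁ ≤ n := by linarith
  have hn0 : (0 : ℝ) < n := by linarith
  have hnN : n ≠ 0 := by rintro rfl; simp at hn0
  have hnK : 3 * (12 * C₁ + K₂) ≤ n := by linarith
  have hnl : 72 / lam ^ 3 ≤ n := by linarith
  obtain ⟨hHx, hsx, hrx⟩ := hherm n a (by linarith) ha1 ha2
  obtain ⟨hHy, hsy, hry⟩ := hherm n b (by linarith) hb1 hb2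
  obtain ⟨q, hq⟩ : ∃ q : ℂ, q = ((Real.sqrt (2 * n) : ℝ) : ℂ) := ⟨_, rfl⟩
  rw [← hq] at hHx hsx hrx hHy hsy hry ⊢
  have hq2 : q ^ 2 = 2 * n := by
    rw [hq, ← ofReal_pow, Real.sq_sqrt (by positivity)]; push_cast; ring
  obtain ⟨x, hx⟩ : ∃ x : ℂ, x = q * joukowski a := ⟨_, rfl⟩
  obtain ⟨y, hy⟩ : ∃ y : ℂ, y = q * joukowski b := ⟨_, rfl⟩
  rw [← hx] at hHx hsx hrx ⊢
  rw [← hy] at hHy hsy hry ⊢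
  have hjR : ∀ c : ℂ, r₁ ≤ ‖c‖ → ‖c‖ < 1 → ‖joukowski c‖ ≤ R := by
    intro c h1 h2
    rw [joukowski, norm_div, hR, show ‖(2 : ℂ)‖ = 2 by simp]
    gcongr
    refine (norm_add_le _ _).trans (add_le_add h2.le ?_)
    rw [norm_inv, ← one_div]
    gcongr
  have hcmp := norm_mehlerSum_sub_le hτ0 hτ1 hc₀ hκ (by linarith : (0 : ℝ) ≤ C₁) hnN
    (by rw [div_le_one hn0]; linarith) ha0 hb0 hal.le hbl.le (hjR a ha1 hal) (hjR b hb1 hbl)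
    hq2 hx hy hHx hHy hrx hry (by field_simp; ring) (by field_simp; ring) hsad hdist
  rw [← hK] at hcmp
  -- the size of the first omitted coefficient
  have hfac := abs_factorial_div_stirlingApprox_sub_one_le hnN
  have hSt := stirlingApprox_pos hnN
  have hza := hermiteSize_pos hnN ha0 hal
  have hzb := hermiteSize_pos hnN hb0 hbl
  -- `ρ` is the relative error of Plancherel–Rotach and Stirling combined
  set ρ : ℝ := ‖hermiteH n x‖ / hermiteSize n a * (‖hermiteH n y‖ / hermiteSize n b) /
    ((n.factorial : ℝ) / stirlingApprox n) with hρ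
  have hε : C₁ / n ≤ 1 / 36 := by rw [div_le_iff₀ hn0]; linarith
  have h1n : 1 / (n : ℝ) ≤ C₁ / n := by gcongr
  have hC₁n : 0 ≤ C₁ / n := by positivity
  have hρ1 : ‖ρ - 1‖ ≤ 4 * (3 * (C₁ / n)) :=
    norm_div_sub_one_le (norm_mul_sub_one_le hsx hsy (by linarith))
      (hfac.trans (by linarith)) (by linarith)
  have hρ2 : 1 / 2 ≤ ρ := by
    have := (abs_le.1 hρ1).1
    linarith
  set P₀ : ℝ := hermiteSize n a * hermiteSize n b / (2 ^ n * stirlingApprox n) with hP₀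
  have hP₀0 : 0 < P₀ := by positivity
  have hP : ‖mehlerCoeff x y n‖ = ρ * P₀ := by
    have : (n.factorial : ℝ) ≠ 0 := by exact_mod_cast n.factorial_ne_zero
    rw [mehlerCoeff, norm_div, norm_mul, norm_mul, norm_pow, Complex.norm_natCast,
      show ‖(2 : ℂ)‖ = 2 by simp, hρ, hP₀]
    field_simp
  set W : ℝ := Real.exp (-(mehlerExp x y τ).re) with hW
  have hW0 : 0 < W := Real.exp_pos _
  -- the comparison error `1` at the base point is absorbed by exponential growth
  have hT0 : 2 * n ≤ P₀ * τ ^ n * W := by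
    have h1 := exp_edgeRate_le hτ0 hnN ha0 hb0 hal hbl
    have h2 : (mehlerExp x y τ).re = 2 * n * (mehlerExp (joukowski a) (joukowski b) τ).re := by
      rw [hx, hy, mehlerExp_mul, hq2, show (2 : ℂ) * n = ((2 * n : ℝ) : ℂ) by push_cast; ring,
        re_ofReal_mul]
    rw [← h2] at h1
    refine le_trans ?_ h1
    have h3 : (n * lam) ^ 3 / (Nat.factorial 3 : ℝ) ≤ Real.exp (n * edgeRate τ a b) :=
      (Real.pow_div_factorial_le_exp _ (by positivity) 3).trans
        (Real.exp_le_exp.2 (by gcongr))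
    rw [le_div_iff₀ (by positivity)]
    refine le_trans ?_ h3
    rw [div_le_iff₀ (by positivity)] at hnl
    have h4 : ((Nat.factorial 3 : ℕ) : ℝ) = 6 := by norm_num [Nat.factorial]
    rw [h4, le_div_iff₀ (by norm_num)]
    nlinarith [mul_le_mul_of_nonneg_left hnl (sq_nonneg (n : ℝ))]
  set T : ℝ := ‖mehlerCoeff x y n‖ * (τ ^ n * W) with hT
  have hTρ : T = ρ * (P₀ * τ ^ n * W) := by rw [hT, hP]; ring
  have hTn : n ≤ T := by
    rw [hTρ]
    calc (n : ℝ) = 1 / 2 * (2 * n) := by ring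
      _ ≤ _ := by gcongr
  have hT0' : 0 < T := hn0.trans_le hTn
  have hk : r₁ ^ 2 / 2 ≤ ‖edgeFactor a b τ‖ := by
    rw [edgeFactor, norm_div, norm_mul, pow_two]
    have h1 : ‖(τ : ℂ) - a * b‖ ≤ 2 := by
      refine (norm_sub_le _ _).trans ?_
      rw [norm_mul, norm_real, Real.norm_of_nonneg hτ0.le]
      nlinarith [norm_nonneg a, norm_nonneg b]
    have := norm_pos_iff.2 hτab
    gcongr
  have hk0 : 0 < ‖edgeFactor a b τ‖ := lt_of_lt_of_le (by positivity) hk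
  set A : ℂ := mehlerCoeff x y n * τ ^ n * mehlerInv x y τ * edgeFactor a b τ with hA
  have hAn : ‖A‖ = T * Real.sqrt (1 - τ ^ 2) * ‖edgeFactor a b τ‖ := by
    rw [hA, norm_mul, norm_mul, norm_mul, norm_pow, norm_real, Real.norm_of_nonneg hτ0.le,
      norm_mehlerInv, hT]
    ring
  have hAn0 : 0 < ‖A‖ := by rw [hAn]; positivity
  have hA0 : A ≠ 0 := norm_pos_iff.1 hAn0
  have hquot : ‖mehlerSum x y n τ * mehlerInv x y τ / A - 1‖ ≤ K₂ / n := by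
    rw [div_sub_one hA0, norm_div, div_le_iff₀ hAn0]
    refine hcmp.trans ?_
    calc 1 + K / n * T ≤ T / n + K / n * T := by
          gcongr; rwa [one_le_div hn0]
      _ = K₂ / n * (T * Real.sqrt (1 - τ ^ 2) * (r₁ ^ 2 / 2)) := by
          rw [hK₂]; field_simp
      _ ≤ K₂ / n * ‖A‖ := by rw [hAn]; gcongr
  have hquot' : ‖(‖mehlerSum x y n τ * mehlerInv x y τ / A‖ - 1 : ℝ)‖ ≤ (12 * C₁ + K₂) / n := by
    have h1 := (abs_norm_sub_norm_le (mehlerSum x y n τ * mehlerInv x y τ / A) 1).trans hquot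
    rw [norm_one] at h1
    refine h1.trans ?_
    gcongr
    linarith
  have hρ' : ‖ρ - 1‖ ≤ (12 * C₁ + K₂) / n := by
    refine hρ1.trans ?_
    rw [show 4 * (3 * (C₁ / n)) = 12 * C₁ / n by ring]
    gcongr
    linarith
  have hfin := norm_mul_sub_one_le hquot' hρ' (by rw [div_le_one hn0]; linarith)
  have hmain : ‖mehlerSum x y n τ‖ / mehlerSize τ n a b =
      ‖mehlerSum x y n τ * mehlerInv x y τ / A‖ * ρ := by
    have hI : ‖mehlerInv x y τ‖ ≠ 0 := by rw [norm_mehlerInv]; positivity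
    have hτn : τ ^ n ≠ 0 := by positivity
    have hρ0 : ρ ≠ 0 := by linarith
    rw [mehlerSize, ← hP₀, hA, norm_div, norm_mul, norm_mul, norm_mul, norm_mul, norm_pow,
      norm_real, Real.norm_of_nonneg hτ0.le, hP]
    field_simp
  rw [hmain]
  refine hfin.trans ?_
  rw [← mul_div_assoc]
  gcongr
  linarith

/-! ### Elliptic coordinates and the cluster function -/

/-- The variable `a = exp (-(ξ + iη))` attached to elliptic coordinates. -/
noncomputable def ellA (ξ η : ℝ) : ℂ := exp (-((ξ : ℂ) + (η : ℂ) * I))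

lemma ellA_ne_zero (ξ η : ℝ) : ellA ξ η ≠ 0 := exp_ne_zero _

lemma norm_ellA (ξ η : ℝ) : ‖ellA ξ η‖ = Real.exp (-ξ) := by
  rw [ellA, norm_exp]; simp

lemma joukowski_ellA (ξ η : ℝ) :
    joukowski (ellA ξ η) = Complex.cosh ((ξ : ℂ) + (η : ℂ) * I) := by
  rw [joukowski, ellA, Complex.cosh, exp_neg, inv_inv, add_comm]

lemma conj_joukowski (a : ℂ) :
    (starRingEnd ℂ) (joukowski a) = joukowski ((starRingEnd ℂ) a) := by
  simp [joukowski, conj_ofNat]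

lemma hermiteSize_conj (n : ℕ) (a : ℂ) :
    hermiteSize n ((starRingEnd ℂ) a) = hermiteSize n a := by
  have h : 1 - (starRingEnd ℂ) a ^ 2 = (starRingEnd ℂ) (1 - a ^ 2) := by simp
  rw [hermiteSize, hermiteSize, h, norm_conj, norm_conj, ← map_pow, conj_re]

lemma norm_one_sub_ellA_sq (ξ η : ℝ) :
    ‖1 - ellA ξ η ^ 2‖ = 2 * ‖Complex.sinh ((ξ : ℂ) + (η : ℂ) * I)‖ * Real.exp (-ξ) := by
  have h : 1 - ellA ξ η ^ 2 = 2 * Complex.sinh ((ξ : ℂ) + (η : ℂ) * I) * ellA ξ η := by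
    rw [Complex.sinh, ellA, exp_neg]
    have := exp_ne_zero ((ξ : ℂ) + (η : ℂ) * I)
    field_simp
  rw [h, norm_mul, norm_mul, norm_ellA, show ‖(2 : ℂ)‖ = 2 by simp]

lemma ellA_sq_re (ξ η : ℝ) : (ellA ξ η ^ 2).re = Real.exp (-2 * ξ) * Real.cos (2 * η) := by
  have hre : (((2 : ℕ) : ℂ) * -((ξ : ℂ) + (η : ℂ) * I)).re = -2 * ξ := by simp
  have him : (((2 : ℕ) : ℂ) * -((ξ : ℂ) + (η : ℂ) * I)).im = -(2 * η) := by simp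
  rw [ellA, ← exp_nat_mul, exp_re, hre, him, Real.cos_neg]

lemma exp_xiTau {τ : ℝ} (hτ0 : 0 < τ) : Real.exp (2 * xiTau τ) = τ⁻¹ := by
  rw [xiTau, show 2 * (-(1 / 2) * Real.log τ) = -Real.log τ by ring, Real.exp_neg,
    Real.exp_log hτ0]

lemma exp_xiTau_sq {τ : ℝ} (hτ0 : 0 < τ) : Real.exp (xiTau τ) ^ 2 = τ⁻¹ := by
  rw [← exp_xiTau hτ0, ← Real.exp_nat_mul]; push_cast; rfl

lemma four_mul_cosh_xiTau_sq {τ : ℝ} (hτ0 : 0 < τ) :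
    4 * τ * Real.cosh (xiTau τ) ^ 2 = (1 + τ) ^ 2 := by
  have h := exp_xiTau_sq hτ0
  rw [Real.cosh_eq, Real.exp_neg]
  have h0 := Real.exp_pos (xiTau τ)
  generalize Real.exp (xiTau τ) = e at *
  field_simp at h ⊢
  nlinarith

lemma four_mul_sinh_xiTau_sq {τ : ℝ} (hτ0 : 0 < τ) :
    4 * τ * Real.sinh (xiTau τ) ^ 2 = (1 - τ) ^ 2 := by
  have h := four_mul_cosh_xiTau_sq hτ0
  have h2 := Real.cosh_sq (xiTau τ)
  rw [h2] at h
  linarith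

/-- The defining relation of `g`, valid also on the boundary `ξ = ξ_τ`. -/
lemma sq_mul_g {τ : ℝ} (hτ0 : 0 < τ) (hτ1 : τ < 1) (ξ η : ℝ) :
    (ξ - xiTau τ) ^ 2 * g τ ξ η = -(1 / 2 + ξ - xiTau τ + 1 / 2 * Real.exp (-2 * ξ) *
      Real.cos (2 * η) - 2 * τ * (Real.cosh ξ ^ 2 * Real.cos η ^ 2 / (1 + τ))
        - 2 * τ * (Real.sinh ξ ^ 2 * Real.sin η ^ 2 / (1 - τ))) := by
  unfold g
  split_ifs with h
  · subst h
    have h1 := four_mul_cosh_xiTau_sq hτ0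
    have h2 := four_mul_sinh_xiTau_sq hτ0
    have h3 : Real.exp (-2 * xiTau τ) = τ := by
      rw [neg_mul, Real.exp_neg, exp_xiTau hτ0, inv_inv]
    have h4 : 1 + τ ≠ 0 := by linarith
    have h5 : 1 - τ ≠ 0 := by linarith
    rw [h3, Real.cos_two_mul, sub_self]
    have h6 : 2 * τ * (Real.cosh (xiTau τ) ^ 2 * Real.cos η ^ 2 / (1 + τ)) =
        (1 + τ) / 2 * Real.cos η ^ 2 := by
      field_simp
      linear_combination Real.cos η ^ 2 * h1
    have h7 : 2 * τ * (Real.sinh (xiTau τ) ^ 2 * Real.sin η ^ 2 / (1 - τ)) =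
        (1 - τ) / 2 * Real.sin η ^ 2 := by
      field_simp
      linear_combination Real.sin η ^ 2 * h2
    rw [h6, h7, Real.sin_sq]
    ring
  · have : ξ - xiTau τ ≠ 0 := sub_ne_zero.2 h
    field_simp

lemma re_im_of_coord {τ : ℝ} {Z : ℂ} {ξ η : ℝ}
    (hZ : Z = 2 * ((Real.sqrt τ : ℝ) : ℂ) * Complex.cosh ((ξ : ℂ) + (η : ℂ) * I)) :
    Z.re = 2 * Real.sqrt τ * (Real.cosh ξ * Real.cos η) ∧
      Z.im = 2 * Real.sqrt τ * (Real.sinh ξ * Real.sin η) := by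
  have h : Complex.cosh ((ξ : ℂ) + (η : ℂ) * I) =
      ((Real.cosh ξ * Real.cos η : ℝ) : ℂ) + ((Real.sinh ξ * Real.sin η : ℝ) : ℂ) * I := by
    rw [Complex.cosh_add, Complex.cosh_mul_I, Complex.sinh_mul_I]
    push_cast
    ring
  rw [hZ, h, show 2 * ((Real.sqrt τ : ℝ) : ℂ) = ((2 * Real.sqrt τ : ℝ) : ℂ) by push_cast; ring,
    re_ofReal_mul, im_ofReal_mul]
  simp only [add_re, add_im, ofReal_re, ofReal_im, re_ofReal_mul, im_ofReal_mul, I_re, I_im]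
  constructor <;> ring

/-- The weight times the squared Plancherel–Rotach size: all exponential factors combine into
`exp (-2n (ξ - ξ_τ)² g)`. -/
lemma weight_mul_hermiteSize_sq {τ : ℝ} (hτ0 : 0 < τ) (hτ1 : τ < 1) (n : ℕ) {Z : ℂ} {ξ η : ℝ}
    (hZ : Z = 2 * ((Real.sqrt τ : ℝ) : ℂ) * Complex.cosh ((ξ : ℂ) + (η : ℂ) * I)) :
    weight τ (((Real.sqrt n : ℝ) : ℂ) * Z) * hermiteSize n (ellA ξ η) ^ 2 =
      (2 * n) ^ n / (Real.exp 1 ^ n * τ ^ n) *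
        Real.exp (-2 * n * (ξ - xiTau τ) ^ 2 * g τ ξ η) * Real.exp ξ /
          (2 * ‖Complex.sinh ((ξ : ℂ) + (η : ℂ) * I)‖) := by
  obtain ⟨hre, him⟩ := re_im_of_coord hZ
  have hn : (Real.sqrt n) ^ 2 = n := Real.sq_sqrt (Nat.cast_nonneg n)
  have hτs : (Real.sqrt τ) ^ 2 = τ := Real.sq_sqrt hτ0.le
  have hw : weight τ (((Real.sqrt n : ℝ) : ℂ) * Z) =
      Real.exp (-(n * (4 * τ * (Real.cosh ξ ^ 2 * Real.cos η ^ 2 / (1 + τ)) +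
        4 * τ * (Real.sinh ξ ^ 2 * Real.sin η ^ 2 / (1 - τ))))) := by
    rw [weight, re_ofReal_mul, im_ofReal_mul, hre, him]
    congr 1
    simp only [mul_pow, hn, hτs]
    ring
  have hs : hermiteSize n (ellA ξ η) ^ 2 = (2 * n) ^ n * (Real.exp ξ ^ n) ^ 2 *
      Real.exp (n * (Real.exp (-2 * ξ) * Real.cos (2 * η))) * Real.exp ξ /
        (2 * ‖Complex.sinh ((ξ : ℂ) + (η : ℂ) * I)‖) := by
    rw [hermiteSize, div_pow, Real.sq_sqrt (norm_nonneg _), norm_one_sub_ellA_sq, norm_ellA,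
      ellA_sq_re, mul_pow, ← Real.exp_nat_mul _ 2, Real.exp_neg, div_inv_eq_mul, mul_pow, mul_pow,
      ← pow_mul, mul_comm n 2, pow_mul, Real.sq_sqrt (by positivity)]
    rw [show ((2 : ℕ) : ℝ) * (n * (Real.exp (-2 * ξ) * Real.cos (2 * η)) / 2) =
      n * (Real.exp (-2 * ξ) * Real.cos (2 * η)) by push_cast; ring]
    rw [← div_eq_mul_inv, div_div_eq_mul_div]
  have hexp : Real.exp (-(n * (4 * τ * (Real.cosh ξ ^ 2 * Real.cos η ^ 2 / (1 + τ)) +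
        4 * τ * (Real.sinh ξ ^ 2 * Real.sin η ^ 2 / (1 - τ))))) * (Real.exp ξ ^ n) ^ 2 *
      Real.exp (n * (Real.exp (-2 * ξ) * Real.cos (2 * η))) =
      1 / (Real.exp 1 ^ n * τ ^ n) * Real.exp (-2 * n * (ξ - xiTau τ) ^ 2 * g τ ξ η) := by
    have e1 : 1 / (Real.exp 1 ^ n * τ ^ n) = Real.exp (-n + n * (2 * xiTau τ)) := by
      rw [Real.exp_add, Real.exp_nat_mul, exp_xiTau hτ0, Real.exp_neg, ← Real.exp_nat_mul, mul_one,
        inv_pow, one_div, mul_inv]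
    rw [e1, ← Real.exp_nat_mul, ← Real.exp_nat_mul, ← Real.exp_add, ← Real.exp_add,
      ← Real.exp_add]
    congr 1
    have := sq_mul_g hτ0 hτ1 ξ η
    push_cast
    linear_combination (2 * n : ℝ) * this
  rw [hw, hs]
  linear_combination ((2 * n) ^ n * Real.exp ξ /
    (2 * ‖Complex.sinh ((ξ : ℂ) + (η : ℂ) * I)‖)) * hexp

/-- The squared edge factor in elliptic coordinates. -/
lemma norm_edgeFactor_sq {τ : ℝ} (hτ0 : 0 < τ) (ξ η ξ' η' : ℝ)
    (hne : (τ : ℂ) - ellA ξ η * (starRingEnd ℂ) (ellA ξ' η') ≠ 0) :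
    0 < Real.cosh (2 * ((ξ + ξ') / 2 - xiTau τ)) - Real.cos (η - η') ∧
    ‖edgeFactor (ellA ξ η) ((starRingEnd ℂ) (ellA ξ' η')) τ‖ ^ 2 =
      1 / (Real.exp ξ * Real.exp ξ' * (2 * τ) *
        (Real.cosh (2 * ((ξ + ξ') / 2 - xiTau τ)) - Real.cos (η - η'))) := by
  have hab : ellA ξ η * (starRingEnd ℂ) (ellA ξ' η') =
      exp (-(((ξ + ξ' : ℝ) : ℂ) + ((η - η' : ℝ) : ℂ) * I)) := by
    rw [ellA, ellA, ← exp_conj, ← exp_add]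
    congr 1
    simp
    ring
  have hE : ∀ X θ : ℝ, exp (-((X : ℂ) + (θ : ℂ) * I)) =
      ((Real.exp (-X) * Real.cos θ : ℝ) : ℂ) - ((Real.exp (-X) * Real.sin θ : ℝ) : ℂ) * I := by
    intro X θ
    rw [neg_add, exp_add, ← neg_mul, exp_mul_I, cos_neg, sin_neg]
    push_cast
    ring
  have hdn : ‖(τ : ℂ) - ellA ξ η * (starRingEnd ℂ) (ellA ξ' η')‖ ^ 2 =
      τ ^ 2 - 2 * τ * Real.exp (-(ξ + ξ')) * Real.cos (η - η') + Real.exp (-(ξ + ξ')) ^ 2 := by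
    rw [hab, hE, Complex.sq_norm, normSq_apply]
    simp only [sub_re, sub_im, ofReal_re, ofReal_im, re_ofReal_mul, im_ofReal_mul, I_re, I_im]
    have := Real.sin_sq_add_cos_sq (η - η')
    linear_combination Real.exp (-(ξ + ξ')) ^ 2 * this
  have hcosh : Real.cosh (2 * ((ξ + ξ') / 2 - xiTau τ)) =
      (τ * Real.exp (ξ + ξ') + (τ * Real.exp (ξ + ξ'))⁻¹) / 2 := by
    have h1 : Real.exp (2 * ((ξ + ξ') / 2 - xiTau τ)) = τ * Real.exp (ξ + ξ') := by
      rw [show 2 * ((ξ + ξ') / 2 - xiTau τ) = (ξ + ξ') - 2 * xiTau τ by ring, Real.exp_sub,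
        exp_xiTau hτ0, div_inv_eq_mul, mul_comm]
    rw [Real.cosh_eq, Real.exp_neg, h1]
  have hX := Real.exp_pos (ξ + ξ')
  have hd : Real.cosh (2 * ((ξ + ξ') / 2 - xiTau τ)) - Real.cos (η - η') =
      ‖(τ : ℂ) - ellA ξ η * (starRingEnd ℂ) (ellA ξ' η')‖ ^ 2 * Real.exp (ξ + ξ') / (2 * τ) := by
    rw [hdn, hcosh, Real.exp_neg]
    field_simp
    ring
  have hpos : 0 < ‖(τ : ℂ) - ellA ξ η * (starRingEnd ℂ) (ellA ξ' η')‖ := norm_pos_iff.2 hne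
  refine ⟨by rw [hd]; positivity, ?_⟩
  rw [hd, edgeFactor, norm_div, norm_mul, norm_conj, norm_ellA, norm_ellA, ← Real.exp_add,
    ← Real.exp_add, show -ξ + -ξ' = -(ξ + ξ') by ring, Real.exp_neg]
  field_simp

/-- The scaled cluster function in terms of the truncated Mehler sum. -/
lemma clusterT2_eq {τ : ℝ} (hτ0 : 0 < τ) (hτ1 : τ < 1) (n : ℕ) {Z Z' : ℂ} {ξ η ξ' η' : ℝ}
    (hZ : Z = 2 * ((Real.sqrt τ : ℝ) : ℂ) * Complex.cosh ((ξ : ℂ) + (η : ℂ) * I))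
    (hZ' : Z' = 2 * ((Real.sqrt τ : ℝ) : ℂ) * Complex.cosh ((ξ' : ℂ) + (η' : ℂ) * I)) :
    clusterT2 τ n Z Z' = -((n : ℝ) ^ 2 / (Real.pi ^ 2 * (1 - τ ^ 2)) *
      (weight τ (((Real.sqrt n : ℝ) : ℂ) * Z) * weight τ (((Real.sqrt n : ℝ) : ℂ) * Z')) *
      ‖mehlerSum ((Real.sqrt (2 * n) : ℝ) * joukowski (ellA ξ η))
        ((Real.sqrt (2 * n) : ℝ) * joukowski ((starRingEnd ℂ) (ellA ξ' η'))) n τ‖ ^ 2) := by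
  have hτ2 : 0 < 1 - τ ^ 2 := by nlinarith
  have hscale : ∀ {W : ℂ} {X θ : ℝ},
      W = 2 * ((Real.sqrt τ : ℝ) : ℂ) * Complex.cosh ((X : ℂ) + (θ : ℂ) * I) →
      ((Real.sqrt n : ℝ) : ℂ) * W / ((Real.sqrt (2 * τ) : ℝ) : ℂ) =
        (Real.sqrt (2 * n) : ℝ) * joukowski (ellA X θ) := by
    intro W X θ hW
    rw [hW, joukowski_ellA, Real.sqrt_mul zero_le_two, Real.sqrt_mul zero_le_two]
    have h2 : ((Real.sqrt 2 : ℝ) : ℂ) ^ 2 = 2 := by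
      rw [← ofReal_pow, Real.sq_sqrt zero_le_two]; norm_num
    have h3 : ((Real.sqrt 2 : ℝ) : ℂ) ≠ 0 := by
      exact_mod_cast (Real.sqrt_pos.2 zero_lt_two).ne'
    have h4 : ((Real.sqrt τ : ℝ) : ℂ) ≠ 0 := by
      exact_mod_cast (Real.sqrt_pos.2 hτ0).ne'
    push_cast
    field_simp
    rw [h2]
    ring
  have hker : kernel τ n (((Real.sqrt n : ℝ) : ℂ) * Z) (((Real.sqrt n : ℝ) : ℂ) * Z') =
      ((1 / (Real.pi * Real.sqrt (1 - τ ^ 2)) *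
        Real.sqrt (weight τ (((Real.sqrt n : ℝ) : ℂ) * Z) *
          weight τ (((Real.sqrt n : ℝ) : ℂ) * Z')) : ℝ) : ℂ) *
      mehlerSum ((Real.sqrt (2 * n) : ℝ) * joukowski (ellA ξ η))
        ((Real.sqrt (2 * n) : ℝ) * joukowski ((starRingEnd ℂ) (ellA ξ' η'))) n τ := by
    rw [kernel, mehlerSum, hscale hZ, hscale hZ']
    push_cast
    rw [mul_assoc, Finset.mul_sum (a := ((Real.sqrt _ : ℝ) : ℂ))]
    congr 1
    refine Finset.sum_congr rfl fun j _ => ?_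
    rw [conj_hermiteH, map_mul, conj_ofReal, conj_joukowski, mehlerCoeff, div_pow]
    have : ((j.factorial : ℕ) : ℂ) ≠ 0 := by exact_mod_cast j.factorial_ne_zero
    field_simp
  have hwp : 0 ≤ weight τ (((Real.sqrt n : ℝ) : ℂ) * Z) *
      weight τ (((Real.sqrt n : ℝ) : ℂ) * Z') :=
    mul_nonneg (Real.exp_pos _).le (Real.exp_pos _).le
  rw [clusterT2, scaledKernel, hker, norm_mul, norm_mul, Complex.norm_natCast, norm_real,
    Real.norm_of_nonneg (by positivity), mul_pow, mul_pow, mul_pow, Real.sq_sqrt hwp, div_pow,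
    mul_pow, Real.sq_sqrt hτ2.le]
  ring

/-- The explicit leading term of the cluster function, as predicted by the asymptotic sizes. -/
lemma clusterT2_leading {τ : ℝ} (hτ0 : 0 < τ) (hτ1 : τ < 1) {n : ℕ} (hn : n ≠ 0) {Z Z' : ℂ}
    {ξ η ξ' η' : ℝ}
    (hZ : Z = 2 * ((Real.sqrt τ : ℝ) : ℂ) * Complex.cosh ((ξ : ℂ) + (η : ℂ) * I))
    (hZ' : Z' = 2 * ((Real.sqrt τ : ℝ) : ℂ) * Complex.cosh ((ξ' : ℂ) + (η' : ℂ) * I))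
    (hne : (τ : ℂ) - ellA ξ η * (starRingEnd ℂ) (ellA ξ' η') ≠ 0) :
    (n : ℝ) ^ 2 / (Real.pi ^ 2 * (1 - τ ^ 2)) *
      (weight τ (((Real.sqrt n : ℝ) : ℂ) * Z) * weight τ (((Real.sqrt n : ℝ) : ℂ) * Z')) *
      mehlerSize τ n (ellA ξ η) ((starRingEnd ℂ) (ellA ξ' η')) ^ 2 =
    (n : ℝ) / (16 * τ * Real.pi ^ 3 * (1 - τ ^ 2)) *
      ((Real.exp (-2 * n * (ξ - xiTau τ) ^ 2 * g τ ξ η) *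
          Real.exp (-2 * n * (ξ' - xiTau τ) ^ 2 * g τ ξ' η')) /
        (Real.cosh (2 * ((ξ + ξ') / 2 - xiTau τ)) - Real.cos (η - η'))) *
      (1 / ‖Complex.sinh ((ξ : ℂ) + (η : ℂ) * I) * Complex.sinh ((ξ' : ℂ) + (η' : ℂ) * I)‖) := by
  have hn0 : (0 : ℝ) < n := by exact_mod_cast Nat.pos_of_ne_zero hn
  have hτ2 : 0 < 1 - τ ^ 2 := by nlinarith
  have h1 := weight_mul_hermiteSize_sq hτ0 hτ1 n hZ
  have h2 := weight_mul_hermiteSize_sq hτ0 hτ1 n hZ'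
  obtain ⟨hd, h3⟩ := norm_edgeFactor_sq hτ0 ξ η ξ' η' hne
  have hπ := Real.pi_pos
  have h4 : stirlingApprox n ^ 2 = 2 * Real.pi * n * (n ^ n / Real.exp 1 ^ n) ^ 2 := by
    rw [stirlingApprox, mul_pow, Real.sq_sqrt (by positivity), div_pow]
  have h5 : (n : ℝ) ^ 2 / (Real.pi ^ 2 * (1 - τ ^ 2)) *
      (weight τ (((Real.sqrt n : ℝ) : ℂ) * Z) * weight τ (((Real.sqrt n : ℝ) : ℂ) * Z')) *
      mehlerSize τ n (ellA ξ η) ((starRingEnd ℂ) (ellA ξ' η')) ^ 2 =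
      (n : ℝ) ^ 2 / (Real.pi ^ 2 * (1 - τ ^ 2)) *
      (weight τ (((Real.sqrt n : ℝ) : ℂ) * Z) * hermiteSize n (ellA ξ η) ^ 2) *
      (weight τ (((Real.sqrt n : ℝ) : ℂ) * Z') * hermiteSize n (ellA ξ' η') ^ 2) *
      ((τ ^ n) ^ 2 / ((2 ^ n) ^ 2 * stirlingApprox n ^ 2)) *
      ‖edgeFactor (ellA ξ η) ((starRingEnd ℂ) (ellA ξ' η')) τ‖ ^ 2 := by
    rw [mehlerSize, hermiteSize_conj, mul_pow, mul_pow, div_pow, mul_pow, mul_pow]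
    ring
  rw [h5, h1, h2, h3, h4, norm_mul, mul_pow]
  generalize Real.exp (-2 * n * (ξ - xiTau τ) ^ 2 * g τ ξ η) = G₁
  generalize Real.exp (-2 * n * (ξ' - xiTau τ) ^ 2 * g τ ξ' η') = G₂
  generalize Real.cosh (2 * ((ξ + ξ') / 2 - xiTau τ)) - Real.cos (η - η') = Dn at *
  generalize ‖Complex.sinh ((ξ : ℂ) + (η : ℂ) * I)‖ = S₁
  generalize ‖Complex.sinh ((ξ' : ℂ) + (η' : ℂ) * I)‖ = S₂
  have e1 := Real.exp_pos ξ
  have e2 := Real.exp_pos ξ'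
  have e3 := Real.exp_pos 1
  have e4 : (0 : ℝ) < (n : ℝ) ^ n := by positivity
  have e5 : (0 : ℝ) < τ ^ n := by positivity
  have e6 : (0 : ℝ) < Real.exp 1 ^ n := by positivity
  generalize (n : ℝ) ^ n = A at *
  generalize τ ^ n = B at *
  generalize Real.exp 1 ^ n = E at *
  by_cases hS₁ : S₁ = 0
  · simp [hS₁]
  by_cases hS₂ : S₂ = 0
  · simp [hS₂]
  field_simp
  ring

/-! ### The uniform expansion near a pair of boundary points -/

/-- Points of the boundary of the ellipse have radial elliptic coordinate `ξ_τ`. -/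
lemma coord_eq_xiTau_of_mem_frontier {τ : ℝ} (hτ0 : 0 < τ) (hτ1 : τ < 1) {Z : ℂ} {ξ η : ℝ}
    (hZ : Z ∈ frontier (ellipse τ)) (hc : IsEllipticCoord τ Z ξ η) : ξ = xiTau τ := by
  have hcont : Continuous fun Z : ℂ => (Z.re / (1 + τ)) ^ 2 + (Z.im / (1 - τ)) ^ 2 := by fun_prop
  have hlevel : (Z.re / (1 + τ)) ^ 2 + (Z.im / (1 - τ)) ^ 2 = 1 :=
    frontier_lt_subset_eq hcont continuous_const hZ
  obtain ⟨hξ, -, -, hcoord⟩ := hc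
  obtain ⟨hre, him⟩ := re_im_of_coord hcoord
  have hτs : (Real.sqrt τ) ^ 2 = τ := Real.sq_sqrt hτ0.le
  have hC := four_mul_cosh_xiTau_sq hτ0
  have hS := four_mul_sinh_xiTau_sq hτ0
  have h1 : 0 < 1 + τ := by linarith
  have h2 : 0 < 1 - τ := by linarith
  have hx0 : 0 ≤ xiTau τ := by
    rw [xiTau]; nlinarith [Real.log_neg hτ0 hτ1]
  have hsum : 4 * τ * Real.cosh ξ ^ 2 * Real.cos η ^ 2 / (1 + τ) ^ 2 +
      4 * τ * Real.sinh ξ ^ 2 * Real.sin η ^ 2 / (1 - τ) ^ 2 = 1 := by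
    refine Eq.trans ?_ hlevel
    rw [hre, him, div_pow, div_pow]
    simp only [mul_pow, hτs]
    ring
  have hcs := Real.sin_sq_add_cos_sq η
  -- both quotients below are `1` at `ξ = ξ_τ` and strictly increasing in `ξ`
  have key : ∀ C S : ℝ, C * Real.cos η ^ 2 + S * Real.sin η ^ 2 = 1 →
      ¬ (C < 1 ∧ S < 1) ∧ ¬ (1 < C ∧ 1 < S) := by
    intro C S h
    have e1 := sq_nonneg (Real.cos η)
    have e2 := sq_nonneg (Real.sin η)
    have h0 : (C - 1) * Real.cos η ^ 2 + (S - 1) * Real.sin η ^ 2 = 0 := by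
      linear_combination h - hcs
    constructor
    · rintro ⟨h3, h4⟩
      rcases e1.eq_or_lt with h5 | h5
      · rw [← h5] at h0 hcs
        nlinarith
      · nlinarith [mul_pos (sub_pos.2 h3) h5, mul_nonneg (sub_pos.2 h4).le e2]
    · rintro ⟨h3, h4⟩
      rcases e1.eq_or_lt with h5 | h5
      · rw [← h5] at h0 hcs
        nlinarith
      · nlinarith [mul_pos (sub_pos.2 h3) h5, mul_nonneg (sub_pos.2 h4).le e2]
  have hk := key (4 * τ * Real.cosh ξ ^ 2 / (1 + τ) ^ 2) (4 * τ * Real.sinh ξ ^ 2 / (1 - τ) ^ 2)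
    (Eq.trans (by ring) hsum)
  rw [← hC, ← hS] at hk
  have hCp : 0 < 4 * τ * Real.cosh (xiTau τ) ^ 2 := by rw [hC]; positivity
  have hSp : 0 < 4 * τ * Real.sinh (xiTau τ) ^ 2 := by rw [hS]; positivity
  rw [div_lt_one hCp, div_lt_one hSp, one_lt_div hCp, one_lt_div hSp] at hk
  have hmono : ∀ u v : ℝ, 0 ≤ u → u < v →
      4 * τ * Real.cosh u ^ 2 < 4 * τ * Real.cosh v ^ 2 ∧
        4 * τ * Real.sinh u ^ 2 < 4 * τ * Real.sinh v ^ 2 := by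
    intro u v hu huv
    have hs : Real.sinh u < Real.sinh v := Real.sinh_strictMono huv
    have hs0 : 0 ≤ Real.sinh u := Real.sinh_nonneg_iff.2 hu
    have hsq : Real.sinh u ^ 2 < Real.sinh v ^ 2 := by gcongr
    refine ⟨?_, by gcongr⟩
    rw [Real.cosh_sq, Real.cosh_sq]
    gcongr
  rcases lt_trichotomy ξ (xiTau τ) with h | h | h
  · exact absurd (hmono _ _ hξ h) hk.1
  · exact h
  · exact absurd (hmono _ _ hx0 h) hk.2

lemma norm_ellA_xiTau_sq {τ : ℝ} (hτ0 : 0 < τ) (η : ℝ) : ‖ellA (xiTau τ) η‖ ^ 2 = τ := by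
  rw [norm_ellA, Real.exp_neg, inv_pow, exp_xiTau_sq hτ0, inv_inv]

/-- The inverse Joukowski map is Lipschitz near the boundary of the ellipse, so elliptic
coordinates vary continuously up to the `2π`-ambiguity of the angle. -/
lemma norm_ellA_sub_le {τ : ℝ} (hτ0 : 0 < τ) (hτ1 : τ < 1) {Z Z₀ : ℂ} {ξ η η₀ : ℝ} (hξ : 0 ≤ ξ)
    (hZ : Z = 2 * ((Real.sqrt τ : ℝ) : ℂ) * Complex.cosh ((ξ : ℂ) + (η : ℂ) * I))
    (hZ₀ : Z₀ = 2 * ((Real.sqrt τ : ℝ) : ℂ) * Complex.cosh ((xiTau τ : ℂ) + (η₀ : ℂ) * I)) :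
    ‖ellA ξ η - ellA (xiTau τ) η₀‖ * (1 - Real.sqrt τ) ≤ ‖Z - Z₀‖ := by
  rw [← joukowski_ellA] at hZ hZ₀
  have ha1 : ‖ellA ξ η‖ ≤ 1 := by rw [norm_ellA]; exact Real.exp_le_one_iff.2 (by linarith)
  have hb : ‖ellA (xiTau τ) η₀‖ = Real.sqrt τ := by
    rw [← norm_ellA_xiTau_sq hτ0 η₀, Real.sqrt_sq (norm_nonneg _)]
    rw [norm_ellA_xiTau_sq hτ0]
  have ha0 := ellA_ne_zero ξ η
  have hb0 := ellA_ne_zero (xiTau τ) η₀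
  have hs : 0 < Real.sqrt τ := Real.sqrt_pos.2 hτ0
  have hs1 : Real.sqrt τ < 1 := by rw [Real.sqrt_lt' one_pos]; simpa using hτ1
  generalize ellA ξ η = a at *
  generalize ellA (xiTau τ) η₀ = b at *
  have hid : (Real.sqrt τ : ℂ) * (a - b) * (1 - a * b) = -((Z - Z₀) * (a * b)) := by
    rw [hZ, hZ₀, joukowski, joukowski]
    field_simp
    ring
  have hn := congrArg norm hid
  rw [norm_mul, norm_mul, norm_neg, norm_mul, norm_mul, hb, norm_real,
    Real.norm_of_nonneg hs.le] at hn
  have hab : 1 - Real.sqrt τ ≤ ‖1 - a * b‖ := by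
    have h1 := norm_sub_norm_le 1 (a * b)
    rw [norm_one, norm_mul, hb] at h1
    nlinarith
  have h2 : Real.sqrt τ * (‖a - b‖ * (1 - Real.sqrt τ)) ≤ Real.sqrt τ * ‖Z - Z₀‖ := by
    calc Real.sqrt τ * (‖a - b‖ * (1 - Real.sqrt τ))
        ≤ Real.sqrt τ * ‖a - b‖ * ‖1 - a * b‖ := by rw [mul_assoc]; gcongr
      _ = ‖Z - Z₀‖ * (‖a‖ * Real.sqrt τ) := hn
      _ ≤ ‖Z - Z₀‖ * (1 * Real.sqrt τ) := by gcongr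
      _ = _ := by ring
  exact le_of_mul_le_mul_left h2 hs


/-- The uniform expansion near a pair of distinct boundary points. -/
lemma clusterT2_asymptotics {τ : ℝ} (hτ0 : 0 < τ) (hτ1 : τ < 1) {Z₀ Z₀' : ℂ}
    (hZ₀ : Z₀ ∈ frontier (ellipse τ))
    (hZ₀' : Z₀' ∈ frontier (ellipse τ)) (hne : Z₀ ≠ Z₀') :
    ∃ U : Set (ℂ × ℂ), IsOpen U ∧ (Z₀, Z₀') ∈ U ∧
      ∃ (C : ℝ) (N : ℕ), ∀ n : ℕ, N ≤ n → ∀ Z Z' : ℂ, (Z, Z') ∈ U →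
        ∀ ξ η ξ' η' : ℝ,
          IsEllipticCoord τ Z ξ η →
          IsEllipticCoord τ Z' ξ' η' →
          ∃ δ : ℝ, |δ| ≤ C / n ∧
            clusterT2 τ n Z Z' =
              -((n : ℝ) / (16 * τ * Real.pi ^ 3 * (1 - τ ^ 2))) *
                ((Real.exp (-2 * n * (ξ - xiTau τ) ^ 2 *
                      g τ ξ η) *
                    Real.exp (-2 * n * (ξ' - xiTau τ) ^ 2 *
                      g τ ξ' η')) /
                  (Real.cosh (2 * ((ξ + ξ') / 2 - xiTau τ)) -
                    Real.cos (η - η'))) *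
                (1 / ‖Complex.sinh ((ξ : ℂ) + (η : ℂ) * Complex.I) *
                    Complex.sinh ((ξ' : ℂ) + (η' : ℂ) * Complex.I)‖) *
                (1 + δ) := by
  obtain ⟨⟨ξ₀, η₀⟩, hc, -⟩ := existsUnique_isEllipticCoord hτ0 Z₀
  obtain ⟨⟨ξ₀', η₀'⟩, hc', -⟩ := existsUnique_isEllipticCoord hτ0 Z₀'
  simp only at hc hc'
  obtain rfl := coord_eq_xiTau_of_mem_frontier hτ0 hτ1 hZ₀ hc
  obtain rfl := coord_eq_xiTau_of_mem_frontier hτ0 hτ1 hZ₀' hc'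
  have ha := norm_ellA_xiTau_sq hτ0 η₀
  have hb : ‖(starRingEnd ℂ) (ellA (xiTau τ) η₀')‖ ^ 2 = τ := by
    rw [Complex.norm_conj]; exact norm_ellA_xiTau_sq hτ0 η₀'
  -- `a₀ b₀ = τ` would force `a₀` and `conj b₀`, hence `Z₀` and `Z₀'`, to coincide
  have hab : ellA (xiTau τ) η₀ * (starRingEnd ℂ) (ellA (xiTau τ) η₀') ≠ τ := by
    intro h
    apply hne
    have h1 : ellA (xiTau τ) η₀' * (starRingEnd ℂ) (ellA (xiTau τ) η₀') = τ := by
      rw [Complex.mul_conj, ← Complex.sq_norm, norm_ellA_xiTau_sq hτ0]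
    have h2 : ellA (xiTau τ) η₀ = ellA (xiTau τ) η₀' :=
      mul_right_cancel₀ ((map_ne_zero _).2 (ellA_ne_zero (xiTau τ) η₀')) (h.trans h1.symm)
    rw [hc.2.2.2, hc'.2.2.2, ← joukowski_ellA, ← joukowski_ellA, h2]
  obtain ⟨r, C, hr, hC, hmain⟩ := mehlerSum_asymptotics hτ0 hτ1 ha hb hab
  have hs1 : 0 < 1 - Real.sqrt τ := by
    have : Real.sqrt τ < 1 := by rw [Real.sqrt_lt' one_pos]; simpa using hτ1
    linarith
  have hρ : 0 < r * (1 - Real.sqrt τ) := by positivity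
  refine ⟨Metric.ball Z₀ (r * (1 - Real.sqrt τ)) ×ˢ Metric.ball Z₀' (r * (1 - Real.sqrt τ)),
    Metric.isOpen_ball.prod Metric.isOpen_ball,
    ⟨Metric.mem_ball_self hρ, Metric.mem_ball_self hρ⟩, 3 * C, ⌈C⌉₊, ?_⟩
  rintro n hn Z Z' ⟨hZU, hZU'⟩ ξ η ξ' η' hco hco'
  have hnC : C ≤ n := Nat.ceil_le.1 hn
  have hn0 : (0 : ℝ) < n := by linarith
  have hnN : n ≠ 0 := by rintro rfl; simp at hn0
  have hin : ellA ξ η ∈ Metric.ball (ellA (xiTau τ) η₀) r := by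
    rw [Metric.mem_ball, dist_eq_norm]
    have h1 := norm_ellA_sub_le hτ0 hτ1 hco.1 hco.2.2.2 hc.2.2.2
    rw [Metric.mem_ball, dist_eq_norm] at hZU
    exact lt_of_mul_lt_mul_right (h1.trans_lt hZU) hs1.le
  have hin' : (starRingEnd ℂ) (ellA ξ' η') ∈
      Metric.ball ((starRingEnd ℂ) (ellA (xiTau τ) η₀')) r := by
    rw [Metric.mem_ball, dist_eq_norm, ← map_sub, Complex.norm_conj]
    have h1 := norm_ellA_sub_le hτ0 hτ1 hco'.1 hco'.2.2.2 hc'.2.2.2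
    rw [Metric.mem_ball, dist_eq_norm] at hZU'
    exact lt_of_mul_lt_mul_right (h1.trans_lt hZU') hs1.le
  obtain ⟨ha0, hb0, hal, hbl, hτab, hδ⟩ := hmain n hnC _ hin _ hin'
  have hsize : 0 < mehlerSize τ n (ellA ξ η) ((starRingEnd ℂ) (ellA ξ' η')) := by
    have h1 := hermiteSize_pos hnN ha0 hal
    have h2 := hermiteSize_pos hnN hb0 hbl
    have h3 := stirlingApprox_pos hnN
    have h4 : 0 < ‖edgeFactor (ellA ξ η) ((starRingEnd ℂ) (ellA ξ' η')) τ‖ :=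
      norm_pos_iff.2 (div_ne_zero (mul_ne_zero ha0 hb0) hτab)
    unfold mehlerSize
    positivity
  have hlead := clusterT2_leading hτ0 hτ1 hnN hco.2.2.2 hco'.2.2.2 hτab
  rw [clusterT2_eq hτ0 hτ1 n hco.2.2.2 hco'.2.2.2]
  generalize ‖mehlerSum _ _ n τ‖ = S at *
  generalize mehlerSize τ n (ellA ξ η) ((starRingEnd ℂ) (ellA ξ' η')) = M at *
  -- the kernel is squared in modulus, so the relative error is that of `(S / M) * (S / M)`
  have hδ2 : ‖S / M * (S / M) - 1‖ ≤ 3 * (C / n) :=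
    norm_mul_sub_one_le hδ hδ ((div_le_one hn0).2 hnC)
  refine ⟨S / M * (S / M) - 1, hδ2.trans (le_of_eq (by ring)), ?_⟩
  have hsq : S ^ 2 = M ^ 2 * (S / M * (S / M)) := by field_simp
  rw [add_sub_cancel, hsq, ← mul_assoc, hlead]
  ring

end EllipticGinibre

theorem mainTheorem2 (τ : ℝ) (hτ0 : 0 < τ) (hτ1 : τ < 1) (Z₀ Z₀' : ℂ)
    (hZ₀ : Z₀ ∈ frontier (EllipticGinibre.ellipse τ))
    (hZ₀' : Z₀' ∈ frontier (EllipticGinibre.ellipse τ))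
    (hne : Z₀ ≠ Z₀') :
    (∃ U : Set (ℂ × ℂ), IsOpen U ∧ (Z₀, Z₀') ∈ U ∧
      ∃ (C : ℝ) (N : ℕ), ∀ n : ℕ, N ≤ n → ∀ Z Z' : ℂ, (Z, Z') ∈ U →
        ∀ ξ η ξ' η' : ℝ,
          EllipticGinibre.IsEllipticCoord τ Z ξ η →
          EllipticGinibre.IsEllipticCoord τ Z' ξ' η' →
          ∃ δ : ℝ, |δ| ≤ C / n ∧
            EllipticGinibre.clusterT2 τ n Z Z' =
              -((n : ℝ) / (16 * τ * Real.pi ^ 3 * (1 - τ ^ 2))) *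
                ((Real.exp (-2 * n * (ξ - EllipticGinibre.xiTau τ) ^ 2 *
                      EllipticGinibre.g τ ξ η) *
                    Real.exp (-2 * n * (ξ' - EllipticGinibre.xiTau τ) ^ 2 *
                      EllipticGinibre.g τ ξ' η')) /
                  (Real.cosh (2 * ((ξ + ξ') / 2 - EllipticGinibre.xiTau τ)) -
                    Real.cos (η - η'))) *
                (1 / ‖Complex.sinh ((ξ : ℂ) + (η : ℂ) * Complex.I) *
                    Complex.sinh ((ξ' : ℂ) + (η' : ℂ) * Complex.I)‖) *
                (1 + δ)) ∧
    (∃ η₀ η₀' : ℝ,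
      EllipticGinibre.IsEllipticCoord τ Z₀ (EllipticGinibre.xiTau τ) η₀ ∧
      EllipticGinibre.IsEllipticCoord τ Z₀' (EllipticGinibre.xiTau τ) η₀' ∧
      ∃ (C : ℝ) (N : ℕ), ∀ n : ℕ, N ≤ n →
        ∃ δ : ℝ, |δ| ≤ C / n ∧
          EllipticGinibre.clusterT2 τ n Z₀ Z₀' =
            -((n : ℝ) / (16 * τ * Real.pi ^ 3 * (1 - τ ^ 2))) *
              (1 / (1 - Real.cos (η₀ - η₀'))) *
              (1 / ‖Complex.sinh ((EllipticGinibre.xiTau τ : ℂ) + (η₀ : ℂ) * Complex.I) *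
                  Complex.sinh ((EllipticGinibre.xiTau τ : ℂ) - (η₀' : ℂ) * Complex.I)‖) *
              (1 + δ)) := by
  have hU := EllipticGinibre.clusterT2_asymptotics hτ0 hτ1 hZ₀ hZ₀' hne
  refine ⟨hU, ?_⟩
  obtain ⟨U, -, hmem, C, N, hmain⟩ := hU
  obtain ⟨⟨ξ₀, η₀⟩, hc, -⟩ := EllipticGinibre.existsUnique_isEllipticCoord hτ0 Z₀
  obtain ⟨⟨ξ₀', η₀'⟩, hc', -⟩ := EllipticGinibre.existsUnique_isEllipticCoord hτ0 Z₀'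
  simp only at hc hc'
  obtain rfl := EllipticGinibre.coord_eq_xiTau_of_mem_frontier hτ0 hτ1 hZ₀ hc
  obtain rfl := EllipticGinibre.coord_eq_xiTau_of_mem_frontier hτ0 hτ1 hZ₀' hc'
  refine ⟨η₀, η₀', hc, hc', C, N, fun n hn => ?_⟩
  obtain ⟨δ, hδ, hval⟩ := hmain n hn Z₀ Z₀' hmem _ _ _ _ hc hc'
  refine ⟨δ, hδ, ?_⟩
  have hconj : ‖Complex.sinh ((EllipticGinibre.xiTau τ : ℂ) - (η₀' : ℂ) * Complex.I)‖ =
      ‖Complex.sinh ((EllipticGinibre.xiTau τ : ℂ) + (η₀' : ℂ) * Complex.I)‖ := by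
    rw [← Complex.norm_conj, ← Complex.sinh_conj]
    congr 2
    simp
  rw [hval, norm_mul, norm_mul, hconj, add_self_div_two]
  simp
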